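/- **Definitions.** An SDDM matrix is a real symmetric nonsingular matrix $A$ with $A_{ij}\le 0$ for $i\ne j$ and $A_{ii}\ge\sum_{j\neq i}|A_{ij}|$ for all $i$. A symmetric matrix $A$ is $\alpha$-strongly diagonally dominant if $A_{ii}\ge(1+\alpha)\sum_{j\ne i}|A_{ij}|$ for all $i$. We write $A\approx_\epsilon B$ if $e^{\epsilon}B\succcurlyeq A\succcurlyeq e^{-\epsilon}B$ in the Loewner order, $\mathrm{Sc}(M,F)=M_{CC}-M_{CF}M_{FF}^{-1}M_{FC}$ for the Schur complement of a set $F$ of rows with complement $C$, and $\|x\|_A=(x^TAx)^{1/2}$. A vector $\tilde x$ is an $\epsilon$-approximate solution of $Ax=b$ if $\|\tilde x-A^{-1}b\|_A\le\epsilon\|A^{-1}b\|_A$. Put $\lg x=\max(1,\log x)$. A *vertex sparsifier chain* of an SDDM matrix $M^{(0)}$ with last size at most $s$ consists of SDDM matrices $M^{(1)},\dots,M^{(d)}$ ($d\ge1$), sets $F_1,\dots,F_{d-1}$ and parameters $\alpha_i\ge4$ ($1\le i<d$), $0<\epsilon_i\le\frac12$ ($0\le i<d$), such that $M^{(1)}\approx_{\epsilon_0}M^{(0)}$;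 for $1\le i<d$, $F_i$ is a subset of the rows of $M^{(i)}$, $M^{(i)}_{F_iF_i}$ is $\alpha_i$-strongly diagonally dominant and $M^{(i+1)}\approx_{\epsilon_i}\mathrm{Sc}(M^{(i)},F_i)$; and $M^{(d)}$ has dimension at most $s$. It is an *$\eta$-vertex sparsifier chain of depth $D$ and work $W$* if $2\sum_{i=0}^{d-1}\epsilon_i\le\eta$, $\sum_{i=1}^{d-1}m_i\log_{\alpha_i}\epsilon_i^{-1}\le W$ and $\sum_{i=1}^{d-1}(\log n)\log_{\alpha_i}\epsilon_i^{-1}\le D$, where $m_i$ is the number of nonzero entries of $M^{(i)}$ and $n$ is the dimension of $M^{(0)}$. Computations are arithmetic circuits over $\mathbb R$ with gates $+,-,\times,/$ of fan-in two, unbounded fan-out and rational constants; *work* is the number of gates and *depth* the length of a longest path. For $s\in\mathbb N$ and reals $\kappa>0$, $c_1,c_2$, call a chain of an $n$-dimensional SDDM matrix *$(s,\kappa,c_1,c_2)$-good* if it is a $1$-vertex sparsifier chain of depth $c_1\lg^2 n\,\lg(\log n)$ and work $c_2n$, with last size at most $s$ and $\log_{\alpha_i}\epsilon_i^{-1}\ge\kappa$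 for all $1\le i<d$ (with $\log 0=0$). **Theorem.** 1. There are constants $s$, $\kappa>0$, $c_1$, $c_2$ such that every SDDM matrix, of any dimension $n$, has an $(s,\kappa,c_1,c_2)$-good chain. That is, every SDDM matrix of dimension $n$ has a $1$-vertex sparsifier chain of depth $O(\log^2 n\log\log n)$ and work $O(n)$. 2. For all $s$, $\kappa>0$, $c_1$, $c_2$ there is a constant $C$ such that the following holds. Let $M$ be an SDDM matrix of dimension $n$ with $m$ nonzero entries, given with an $(s,\kappa,c_1,c_2)$-good chain, and let $0<\epsilon<1$. There is a circuit of work at most $C\,m\,\lg(1/\epsilon)$ and depth at most $C\,\lg^2 n\,\lg(\log n)\,\lg(1/\epsilon)$ that takes as inputs the entries of $M$, of the matrices of the chain and of a vector $b\in\mathbb R^n$, and, for every $b$, outputs an $\epsilon$-approximate solution of $Mx=b$ without dividing by zero. The circuit depends only on $n$, $\epsilon$, $d$, the sets $F_i$, the parameters $\alpha_i,\epsilon_i$ and the positions of the nonzero entries of $M$ and of the $M^{(i)}$: the same circuit works for every other SDDM matrix and chain (with last size at most $s$) that share these data. -/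

import Mathlib

noncomputable section

namespace SparseChol

open Finset

/-! ### Matrices -/

/-- `A` is diagonally dominant, symmetric, nonsingular, with non-positive off-diagonal entries. -/
structure IsSDDM {ι : Type} [Fintype ι] [DecidableEq ι] (A : Matrix ι ι ℝ) : Prop where
  symm : A.IsSymm
  dominant : ∀ i, ∑ j ∈ univ.erase i, |A i j| ≤ A i i
  offDiag_nonpos : ∀ i j, i ≠ j → A i j ≤ 0
  nonsingular : IsUnit A.det

/-- `A` is `α`-strongly diagonally dominant. -/
def IsStronglyDD {ι : Type} [Fintype ι] [DecidableEq ι] (α : ℝ) (A : Matrix ι ι ℝ) : Prop :=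
  A.IsSymm ∧ ∀ i, (1 + α) * ∑ j ∈ univ.erase i, |A i j| ≤ A i i

/-- `A ≈_ε B`, i.e. `e^ε B ≽ A ≽ e^{-ε} B` in the Loewner order. -/
def Approx {ι : Type} [Fintype ι] (ε : ℝ) (A B : Matrix ι ι ℝ) : Prop :=
  (Real.exp ε • B - A).PosSemidef ∧ (A - Real.exp (-ε) • B).PosSemidef

/-- The number of nonzero entries of a matrix. -/
def nnz {ι : Type} [Fintype ι] (A : Matrix ι ι ℝ) : ℕ :=
  #{p : ι × ι | A p.1 p.2 ≠ 0}

/-- The two matrices have their nonzero entries at the same positions. -/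
def SamePattern {ι : Type} (A B : Matrix ι ι ℝ) : Prop :=
  ∀ i j, A i j = 0 ↔ B i j = 0

/-- `‖x‖_A = (xᵀ A x)^{1/2}`. -/
def energyNorm {ι : Type} [Fintype ι] (A : Matrix ι ι ℝ) (x : ι → ℝ) : ℝ :=
  Real.sqrt (x ⬝ᵥ A.mulVec x)

/-- `y` is an `ε`-approximate solution of `A x = b`. -/
def IsApproxSolution {ι : Type} [Fintype ι] [DecidableEq ι]
    (ε : ℝ) (A : Matrix ι ι ℝ) (b y : ι → ℝ) : Prop :=
  energyNorm A (y - A⁻¹.mulVec b) ≤ ε * energyNorm A (A⁻¹.mulVec b)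

/-! ### Blocks and Schur complements

The rows of a matrix in a chain are indexed by a finite set `V`; for `F ⊆ V` the eliminated
rows are those in `F`, and the remaining ones are `C = V \ F`. -/

/-- The rows in `F`, as rows of a matrix indexed by `V`. -/
def fine {ι : Type} (V F : Finset ι) (v : {v : ↥V // (v : ι) ∈ F}) : ↥V := v.1

/-- The rows in `C = V \ F`, as rows of a matrix indexed by `V`. -/
def coarse {ι : Type} [DecidableEq ι] (V F : Finset ι) (v : ↥(V \ F)) : ↥V :=
  ⟨v.1, (mem_sdiff.1 v.2).1⟩

/-- The block `M_{FF}`. -/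
def blockFF {ι : Type} {V : Finset ι} (M : Matrix V V ℝ) (F : Finset ι) :
    Matrix {v : ↥V // (v : ι) ∈ F} {v : ↥V // (v : ι) ∈ F} ℝ :=
  M.submatrix (fine V F) (fine V F)

/-- The Schur complement `M_{CC} - M_{CF} M_{FF}⁻¹ M_{FC}`. -/
def schur {ι : Type} [DecidableEq ι] {V : Finset ι} (M : Matrix V V ℝ) (F : Finset ι) :
    Matrix ↥(V \ F) ↥(V \ F) ℝ :=
  M.submatrix (coarse V F) (coarse V F) -
    M.submatrix (coarse V F) (fine V F) * (blockFF M F)⁻¹ *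
      M.submatrix (fine V F) (coarse V F)

/-! ### Vertex sparsifier chains -/

/-- The data of a chain other than the matrices: the number `d` of matrices
`M⁽¹⁾, …, M⁽ᵈ⁾`, the eliminated sets `F₁, …, F_{d-1}`, and the parameters
`α₁, …, α_{d-1}` and `ε₀, …, ε_{d-1}`. Values of `F`, `α`, `ε` at other indices are irrelevant. -/
structure ChainShape (n : ℕ) where
  d : ℕ
  F : ℕ → Finset (Fin n)
  α : ℕ → ℝ
  ε : ℕ → ℝ

/-- The index set of `M⁽ⁱ⁾`: all of `Fin n` for `i = 0, 1`, and the set of rows that remain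
after the elimination of `Fᵢ` for `i + 1`. -/
def ChainShape.vertices {n : ℕ} (σ : ChainShape n) : ℕ → Finset (Fin n)
  | 0 => univ
  | 1 => univ
  | i + 2 => σ.vertices (i + 1) \ σ.F (i + 1)

/-- The matrices of a chain; `M i` is `M⁽ⁱ⁾`, and only `1 ≤ i ≤ d` is relevant. -/
abbrev ChainMatrices {n : ℕ} (σ : ChainShape n) : Type :=
  (i : ℕ) → Matrix (σ.vertices i) (σ.vertices i) ℝ

/-- A vertex sparsifier chain of the SDDM matrix `A`. The bound `s` on the size of the last
matrix makes `size O(1)` explicit. -/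
structure IsVertexSparsifierChain {n : ℕ} (s : ℕ) (A : Matrix (Fin n) (Fin n) ℝ)
    (σ : ChainShape n) (M : ChainMatrices σ) : Prop where
  sddm_input : IsSDDM A
  one_le_d : 1 ≤ σ.d
  four_le_α : ∀ i, 1 ≤ i → i < σ.d → 4 ≤ σ.α i
  ε_pos : ∀ i < σ.d, 0 < σ.ε i
  ε_le : ∀ i < σ.d, σ.ε i ≤ 1 / 2
  sddm : ∀ i, 1 ≤ i → i ≤ σ.d → IsSDDM (M i)
  F_subset : ∀ i, 1 ≤ i → i < σ.d → σ.F i ⊆ σ.vertices i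
  approx_input : Approx (σ.ε 0) ((M 1).submatrix (fun v => ⟨v, mem_univ v⟩)
    (fun v => ⟨v, mem_univ v⟩)) A
  approx_schur : ∀ i, i + 1 < σ.d →
    Approx (σ.ε (i + 1)) (M (i + 2)) (schur (M (i + 1)) (σ.F (i + 1)))
  stronglyDD : ∀ i, 1 ≤ i → i < σ.d → IsStronglyDD (σ.α i) (blockFF (M i) (σ.F i))
  size_last : #(σ.vertices σ.d) ≤ s

/-- The work `∑_{i=1}^{d-1} mᵢ log_{αᵢ} εᵢ⁻¹` of a chain. -/
def chainWork {n : ℕ} (σ : ChainShape n) (M : ChainMatrices σ) : ℝ :=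
  ∑ i ∈ Ico 1 σ.d, (nnz (M i) : ℝ) * Real.logb (σ.α i) (σ.ε i)⁻¹

/-- The depth `∑_{i=1}^{d-1} (log n) log_{αᵢ} εᵢ⁻¹` of a chain. -/
def chainDepth {n : ℕ} (σ : ChainShape n) : ℝ :=
  ∑ i ∈ Ico 1 σ.d, Real.log n * Real.logb (σ.α i) (σ.ε i)⁻¹

/-- An `η`-vertex sparsifier chain of `A` of depth `D` and work `W`. -/
structure IsVertexSparsifierChainWith {n : ℕ} (η D W : ℝ) (s : ℕ)
    (A : Matrix (Fin n) (Fin n) ℝ) (σ : ChainShape n) (M : ChainMatrices σ) : Prop where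
  chain : IsVertexSparsifierChain s A σ M
  error : 2 * ∑ i ∈ range σ.d, σ.ε i ≤ η
  work : chainWork σ M ≤ W
  depth : chainDepth σ ≤ D

/-! ### Arithmetic circuits: work and depth -/

/-- The four arithmetic operations. -/
inductive ArithOp
  | add | sub | mul | div

/-- The result of an arithmetic operation. -/
def ArithOp.eval : ArithOp → ℝ → ℝ → ℝ
  | add, x, y => x + y
  | sub, x, y => x - y
  | mul, x, y => x * y
  | div, x, y => x / y

/-- An operand: an input, a rational constant, or the result of one of the first `k` gates. -/
inductive Operand (I : Type) (k : ℕ)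
  | input (i : I)
  | const (q : ℚ)
  | gate (j : Fin k)

/-- The value of an operand, given the inputs and the results of the first `k` gates. -/
def Operand.eval {I : Type} {k : ℕ} (x : I → ℝ) (g : Fin k → ℝ) : Operand I k → ℝ
  | input i => x i
  | const q => q
  | gate j => g j

/-- The depth of an operand, given the depths of the first `k` gates. -/
def Operand.depth {I : Type} {k : ℕ} (g : Fin k → ℕ) : Operand I k → ℕ
  | input _ => 0
  | const _ => 0
  | gate j => g j

/-- A sequence of `k` gates with two operands each (which may be used any number of times). The
work is the number `k` of arithmetic operations. -/
inductive Gates (I : Type) : ℕ → Type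
  | nil : Gates I 0
  | snoc {k : ℕ} (c : Gates I k) (op : ArithOp) (a b : Operand I k) : Gates I (k + 1)

/-- The results of the gates on the input `x`. -/
def Gates.eval {I : Type} (x : I → ℝ) : {k : ℕ} → Gates I k → Fin k → ℝ
  | _, nil => Fin.elim0
  | _, snoc c op a b =>
      Fin.snoc (α := fun _ => ℝ) (c.eval x)
        (op.eval (a.eval x (c.eval x)) (b.eval x (c.eval x)))

/-- The depths of the gates: the length of the longest path from an input. -/
def Gates.depths {I : Type} : {k : ℕ} → Gates I k → Fin k → ℕ
  | _, nil => Fin.elim0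
  | _, snoc c _ a b =>
      Fin.snoc (α := fun _ => ℕ) c.depths (max (a.depth c.depths) (b.depth c.depths) + 1)

/-- On the input `x` no gate divides by zero. -/
def Gates.Defined {I : Type} (x : I → ℝ) : {k : ℕ} → Gates I k → Prop
  | _, nil => True
  | _, snoc c op _ b => c.Defined x ∧ (op = ArithOp.div → b.eval x (c.eval x) ≠ 0)

/-- An arithmetic circuit with inputs `I` and outputs `O`. -/
structure Circuit (I O : Type) where
  work : ℕ
  gates : Gates I work
  output : O → Operand I work

/-- The depth of a circuit: the largest depth of a gate. -/
def Circuit.depth {I O : Type} (c : Circuit I O) : ℕ :=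
  univ.sup c.gates.depths

/-- The outputs of a circuit. -/
def Circuit.eval {I O : Type} (c : Circuit I O) (x : I → ℝ) (o : O) : ℝ :=
  (c.output o).eval x (c.gates.eval x)

/-- The inputs of a solver that is given a chain: the entries of the right-hand side, of the
matrix of the system, and of the matrices of the chain. -/
inductive SolverInput {n : ℕ} (σ : ChainShape n) : Type
  | rhs (v : Fin n)
  | system (u v : Fin n)
  | chain (i : ℕ) (u v : σ.vertices i)

/-- The numerical values of the inputs. -/
def solverInput {n : ℕ} {σ : ChainShape n} (A : Matrix (Fin n) (Fin n) ℝ)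
    (M : ChainMatrices σ) (b : Fin n → ℝ) : SolverInput σ → ℝ
  | .rhs v => b v
  | .system u v => A u v
  | .chain i u v => M i u v

/-- `max(1, log x)`: the logarithm as it is meant inside an `O`-bound that is to hold for all
values of the parameters. -/
def lg (x : ℝ) : ℝ := max 1 (Real.log x)

end SparseChol

end

/-! Existence of chains is proved without an algorithm. Each level eliminates a fixed fraction of
the rows and then replaces the Schur complement by a sparse approximation. For the rows, take a
colouring with five colours that minimizes the total monochromatic weight: no vertex sends more than
a fifth of its weight into its own class, so every class is a 4-strongly dominant block, and the
largest class has at least a fifth of the rows (`IsSDDM.exists_large_block`). The Schur complement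
is again SDDM, because the inverse of the eliminated block preserves nonnegative vectors
(`isSDDM_schur_of_fromBlocks`). Sparsification is the barrier method of Batson, Spielman and
Srivastava: rank-one terms of a decomposition of the identity are added one at a time, each chosen
by averaging so that the spectrum stays between two moving barriers (`Between.step`). It needs
O(size / ε²) nonzero entries for accuracy ε. The errors 1/(2(i+1)(i+2)) have sum below 1/2, while
their inverses grow only polynomially. Sizes shrink by 4/5 per level, so the work is n times a
convergent series. There are O(log n) levels, each contributing O(log n log log n) to the depth.

The solver uses the chain for approximate block elimination. The eliminated block is X + L, with X
the diagonal of its row sums and L a Laplacian. Strong dominance gives L ≼ (2/α) X, so about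
log_α(1/ε) Jacobi steps suffice. An even number of them applies the exact inverse of some Y ≽ X + L
whose excess is at most a small multiple of L (`exists_jacobi_operator`). As L is also at most the
full matrix, using Y costs only ε relative to the whole form, whatever the size of X
(`approx_fromBlocks`). With the error of the next matrix each level loses 2εᵢ
(`exists_level_operator`), and recursion down to a matrix of bounded size, inverted by Cramer's
rule, gives the inverse of an N ≈₁ A. Iterative refinement with this preconditioner contracts the
energy error by 9/10 per step (`isApproxSolution_richardson`).

Costs are counted by the relation `Reach` between sets of functions on the space of all instances
with the same shape and sparsity pattern. A gate list that computes such functions serves all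
instances simultaneously, which is the uniformity claimed for the circuit. -/

namespace SparseChol

open Finset Matrix

set_option linter.unusedSectionVars false

/-! ### Quadratic forms of real matrices -/

section QuadraticForms

variable {ι κ : Type} [Fintype ι] [Fintype κ]

/-- The quadratic form `xᵀ A x`. -/
def qf (A : Matrix ι ι ℝ) (x : ι → ℝ) : ℝ := x ⬝ᵥ A *ᵥ x

theorem qf_add (A B : Matrix ι ι ℝ) (x : ι → ℝ) : qf (A + B) x = qf A x + qf B x := by
  simp [qf, add_mulVec, dotProduct_add]

theorem qf_sub (A B : Matrix ι ι ℝ) (x : ι → ℝ) : qf (A - B) x = qf A x - qf B x := by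
  simp [qf, sub_mulVec, dotProduct_sub]

theorem qf_smul (c : ℝ) (A : Matrix ι ι ℝ) (x : ι → ℝ) : qf (c • A) x = c * qf A x := by
  simp [qf, smul_mulVec, dotProduct_smul]

theorem qf_zero_vec (A : Matrix ι ι ℝ) : qf A 0 = 0 := by simp [qf]

theorem qf_conj (A : Matrix ι ι ℝ) (T : Matrix ι κ ℝ) (x : κ → ℝ) :
    qf (Tᵀ * A * T) x = qf A (T *ᵥ x) := by
  simp only [qf, ← mulVec_mulVec]
  rw [dotProduct_mulVec, vecMul_transpose]

theorem qf_diagonal [DecidableEq ι] (d x : ι → ℝ) : qf (diagonal d) x = ∑ i, d i * x i ^ 2 := by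
  simp only [qf, mulVec_diagonal, dotProduct]
  exact sum_congr rfl fun i _ => by ring

theorem qf_eq_sum (A : Matrix ι ι ℝ) (x : ι → ℝ) : qf A x = ∑ i, ∑ j, A i j * (x i * x j) := by
  simp only [qf, mulVec, dotProduct, mul_sum]
  exact sum_congr rfl fun i _ => sum_congr rfl fun j _ => by ring

theorem isHermitian_iff_isSymm (A : Matrix ι ι ℝ) : A.IsHermitian ↔ A.IsSymm := by
  simp [Matrix.IsHermitian, Matrix.IsSymm, conjTranspose_eq_transpose_of_trivial]

theorem posSemidef_iff_qf {A : Matrix ι ι ℝ} : A.PosSemidef ↔ A.IsSymm ∧ ∀ x, 0 ≤ qf A x := by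
  rw [posSemidef_iff_dotProduct_mulVec, isHermitian_iff_isSymm]
  simp [qf]

theorem posDef_iff_qf {A : Matrix ι ι ℝ} :
    A.PosDef ↔ A.IsSymm ∧ ∀ x, x ≠ 0 → 0 < qf A x := by
  rw [posDef_iff_dotProduct_mulVec, isHermitian_iff_isSymm]
  simp [qf]

theorem PosDef.isSymm {A : Matrix ι ι ℝ} (h : A.PosDef) : A.IsSymm := (posDef_iff_qf.1 h).1

theorem PosDef.qf_pos {A : Matrix ι ι ℝ} (h : A.PosDef) {x : ι → ℝ} (hx : x ≠ 0) : 0 < qf A x :=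
  (posDef_iff_qf.1 h).2 x hx

theorem PosDef.qf_nonneg {A : Matrix ι ι ℝ} (h : A.PosDef) (x : ι → ℝ) : 0 ≤ qf A x :=
  (posSemidef_iff_qf.1 h.posSemidef).2 x

theorem PosDef.det_isUnit [DecidableEq ι] {A : Matrix ι ι ℝ} (h : A.PosDef) : IsUnit A.det :=
  (isUnit_iff_isUnit_det A).1 h.isUnit

theorem approx_iff_qf {ε : ℝ} {A B : Matrix ι ι ℝ} (hA : A.IsSymm) (hB : B.IsSymm) :
    Approx ε A B ↔ ∀ x, qf A x ≤ Real.exp ε * qf B x ∧ Real.exp (-ε) * qf B x ≤ qf A x := by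
  have h1 : (Real.exp ε • B - A).IsSymm := (hB.smul _).sub hA
  have h2 : (A - Real.exp (-ε) • B).IsSymm := hA.sub (hB.smul _)
  simp only [Approx, posSemidef_iff_qf, h1, h2, true_and, qf_sub, qf_smul, sub_nonneg,
    forall_and]

theorem exists_orthogonal_diagonalization [DecidableEq ι] {N : Matrix ι ι ℝ} (hN : N.IsSymm) :
    ∃ (U : Matrix ι ι ℝ) (d : ι → ℝ), U * Uᵀ = 1 ∧ N = U * diagonal d * Uᵀ := by
  have hNs : N.IsHermitian := (isHermitian_iff_isSymm N).2 hN
  refine ⟨hNs.eigenvectorUnitary, hNs.eigenvalues, ?_, ?_⟩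
  · have := Unitary.coe_mul_star_self hNs.eigenvectorUnitary
    rwa [Unitary.coe_star, star_eq_conjTranspose, conjTranspose_eq_transpose_of_trivial] at this
  · have hspec := hNs.spectral_theorem
    rwa [Unitary.conjStarAlgAut_apply, star_eq_conjTranspose,
      conjTranspose_eq_transpose_of_trivial] at hspec

open scoped MatrixOrder in
/-- Two quadratic forms, the first of them positive definite, have a common orthogonal basis. -/
theorem exists_simultaneous_diagonalization [DecidableEq ι] {X L : Matrix ι ι ℝ}
    (hX : X.PosDef) (hL : L.IsSymm) :
    ∃ (T : Matrix ι ι ℝ) (d : ι → ℝ), IsUnit T.det ∧ X = Tᵀ * T ∧ L = Tᵀ * diagonal d * T := by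
  obtain ⟨R, hR, hXR⟩ : ∃ R : Matrix ι ι ℝ, IsUnit R.det ∧ X = Rᵀ * R := by
    obtain ⟨R, hR⟩ :=
      CStarAlgebra.nonneg_iff_eq_star_mul_self.1 hX.posSemidef.nonneg
    rw [star_eq_conjTranspose, conjTranspose_eq_transpose_of_trivial] at hR
    refine ⟨R, ?_, hR⟩
    have := PosDef.det_isUnit hX
    rw [hR, det_mul] at this
    exact isUnit_of_mul_isUnit_right this
  obtain ⟨U, d, hUU, hN⟩ := exists_orthogonal_diagonalization (N := R⁻¹ᵀ * L * R⁻¹) (by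
    simp [Matrix.IsSymm, transpose_mul, hL.eq, Matrix.mul_assoc])
  have h1 : R⁻¹ * R = 1 := nonsing_inv_mul _ hR
  have h2 : Rᵀ * R⁻¹ᵀ = 1 := by rw [← transpose_mul, h1, transpose_one]
  refine ⟨Uᵀ * R, d, ?_, ?_, ?_⟩
  · rw [det_mul]
    refine IsUnit.mul ?_ hR
    have := congrArg det hUU
    rw [det_mul, det_one] at this
    exact IsUnit.of_mul_eq_one_right _ this
  · rw [transpose_mul, transpose_transpose, Matrix.mul_assoc, ← Matrix.mul_assoc U, hUU,
      Matrix.one_mul, hXR]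
  · calc L = (Rᵀ * R⁻¹ᵀ) * L * (R⁻¹ * R) := by rw [h1, h2]; simp
      _ = Rᵀ * (R⁻¹ᵀ * L * R⁻¹) * R := by simp only [Matrix.mul_assoc]
      _ = _ := by
        rw [hN]
        simp only [transpose_mul, transpose_transpose, Matrix.mul_assoc]

end QuadraticForms

/-! ### SDDM matrices -/

section SDDM

variable {ι : Type} [Fintype ι] [DecidableEq ι]

/-- A quadratic form as a weighted Laplacian plus a diagonal form of row sums. -/
theorem qf_eq_laplacian {A : Matrix ι ι ℝ} (hA : A.IsSymm) (x : ι → ℝ) :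
    qf A x = ∑ i, (∑ j, A i j) * x i ^ 2 + ∑ i, ∑ j, (-A i j) / 2 * (x i - x j) ^ 2 := by
  have h1 : ∑ i, ∑ j, A i j * x j ^ 2 = ∑ i, (∑ j, A i j) * x i ^ 2 := by
    rw [sum_comm]
    refine sum_congr rfl fun i _ => ?_
    rw [sum_mul]
    exact sum_congr rfl fun j _ => by rw [hA.apply]
  have h2 : ∑ i, ∑ j, A i j * x i ^ 2 = ∑ i, (∑ j, A i j) * x i ^ 2 :=
    sum_congr rfl fun i _ => by rw [sum_mul]
  have h3 : ∑ i, ∑ j, (-A i j) / 2 * (x i - x j) ^ 2 =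
      ∑ i, ∑ j, A i j * (x i * x j) - (∑ i, ∑ j, A i j * x i ^ 2) / 2
        - (∑ i, ∑ j, A i j * x j ^ 2) / 2 := by
    simp only [sum_div, ← sum_sub_distrib]
    exact sum_congr rfl fun i _ => sum_congr rfl fun j _ => by ring
  rw [h3, h1, h2, qf_eq_sum]
  ring

theorem sum_abs_erase {A : Matrix ι ι ℝ} (h : ∀ i j, i ≠ j → A i j ≤ 0) (i : ι) :
    ∑ j ∈ univ.erase i, |A i j| = A i i - ∑ j, A i j := by
  rw [← add_sum_erase univ (A i) (mem_univ i), sub_add_cancel_left, ← sum_neg_distrib]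
  exact sum_congr rfl fun j hj => abs_of_nonpos (h i j (ne_of_mem_erase hj).symm)

theorem IsSDDM.rowSum_nonneg {A : Matrix ι ι ℝ} (h : IsSDDM A) (i : ι) : 0 ≤ ∑ j, A i j := by
  have := h.dominant i
  rw [sum_abs_erase h.offDiag_nonpos] at this
  linarith

theorem laplacian_nonneg {A : Matrix ι ι ℝ} (h : ∀ i j, i ≠ j → A i j ≤ 0) (x : ι → ℝ) (i j : ι) :
    0 ≤ (-A i j) / 2 * (x i - x j) ^ 2 := by
  by_cases hij : i = j
  · simp [hij]
  · have := h i j hij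
    exact mul_nonneg (by linarith) (sq_nonneg _)

/-- The Laplacian expression of the form has only nonnegative terms, and a semidefinite nonsingular
matrix is definite. -/
theorem IsSDDM.posDef {A : Matrix ι ι ℝ} (h : IsSDDM A) : A.PosDef := by
  have hs : A.PosSemidef := by
    refine posSemidef_iff_qf.2 ⟨h.symm, fun x => ?_⟩
    rw [qf_eq_laplacian h.symm]
    exact add_nonneg (sum_nonneg fun i _ => mul_nonneg (h.rowSum_nonneg i) (sq_nonneg _))
      (sum_nonneg fun i _ => sum_nonneg fun j _ => laplacian_nonneg h.offDiag_nonpos x i j)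
  exact hs.posDef_iff_isUnit.2 ((isUnit_iff_isUnit_det A).2 h.nonsingular)

theorem isSDDM_of_posDef {A : Matrix ι ι ℝ} (h : A.PosDef) (h₁ : ∀ i j, i ≠ j → A i j ≤ 0)
    (h₂ : ∀ i, 0 ≤ ∑ j, A i j) : IsSDDM A where
  symm := PosDef.isSymm h
  dominant i := by rw [sum_abs_erase h₁]; linarith [h₂ i]
  offDiag_nonpos := h₁
  nonsingular := PosDef.det_isUnit h

/-- The inverse of a positive definite matrix with nonpositive off-diagonal entries preserves
nonnegative vectors. -/
theorem nonneg_of_mulVec_nonneg {A : Matrix ι ι ℝ} (h : A.PosDef)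
    (h₁ : ∀ i j, i ≠ j → A i j ≤ 0) {x : ι → ℝ} (hx : ∀ i, 0 ≤ (A *ᵥ x) i) (i : ι) : 0 ≤ x i := by
  -- Test against the negative part y of x: yᵀAy ≤ -yᵀAx ≤ 0 forces y = 0.
  set y : ι → ℝ := fun i => max (-x i) 0 with hy
  have hle : qf A y ≤ - (y ⬝ᵥ A *ᵥ x) := by
    simp only [qf, dotProduct, mulVec, mul_sum, ← sum_neg_distrib]
    refine sum_le_sum fun i _ => sum_le_sum fun j _ => ?_
    by_cases hij : i = j
    · subst hij
      simp only [hy]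
      rcases le_total (-x i) 0 with h0 | h0
      · simp [max_eq_right h0]
      · rw [max_eq_left h0]; nlinarith
    · have h0 : 0 ≤ y i := le_max_right _ _
      have h1 : -x j ≤ y j := le_max_left _ _
      have h2 := mul_nonneg h0 (sub_nonneg.2 (h₁ i j hij))
      nlinarith
  have hnn : 0 ≤ y ⬝ᵥ A *ᵥ x := sum_nonneg fun i _ => mul_nonneg (le_max_right _ _) (hx i)
  have hy0 : y = 0 := by
    by_contra hne
    linarith [PosDef.qf_pos h hne]
  have := congrFun hy0 i
  simp only [hy, Pi.zero_apply] at this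
  have := le_max_left (-x i) 0
  linarith

end SDDM

/-! ### Linear-size spectral sparsification by barrier functions -/

section Barrier

variable {ι P : Type} [Fintype ι] [DecidableEq ι] [Fintype P]

theorem PosDef.sq_dotProduct_le {Q : Matrix ι ι ℝ} (hQ : Q.PosDef) (x y : ι → ℝ) :
    (x ⬝ᵥ Q *ᵥ y) ^ 2 ≤ qf Q x * qf Q y := by
  obtain ⟨T, d, -, hT, -⟩ := exists_simultaneous_diagonalization hQ hQ.isHermitian
  have key : ∀ a b, a ⬝ᵥ Q *ᵥ b = (T *ᵥ a) ⬝ᵥ (T *ᵥ b) := fun a b => by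
    rw [hT, ← mulVec_mulVec, dotProduct_mulVec, vecMul_transpose]
  simp only [qf, key]
  simp only [dotProduct]
  refine (sum_mul_sq_le_sq_mul_sq _ _ _).trans_eq ?_
  simp only [sq]

/-- The **Sherman-Morrison formula** for symmetric matrices. -/
theorem inv_sub_smul_vecMulVec {Q : Matrix ι ι ℝ} (hs : Q.IsSymm) (hQ : IsUnit Q.det)
    (v : ι → ℝ) {t : ℝ} (ht : 1 - t * (v ⬝ᵥ Q⁻¹ *ᵥ v) ≠ 0) :
    (Q - t • vecMulVec v v)⁻¹ = Q⁻¹ +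
      (t / (1 - t * (v ⬝ᵥ Q⁻¹ *ᵥ v))) • vecMulVec (Q⁻¹ *ᵥ v) (Q⁻¹ *ᵥ v) := by
  set w := Q⁻¹ *ᵥ v with hw
  set c := v ⬝ᵥ w
  have hQw : Q *ᵥ w = v := by rw [hw, mulVec_mulVec, mul_nonsing_inv _ hQ, one_mulVec]
  have hvQ : v ᵥ* Q⁻¹ = w := by
    rw [hw, ← mulVec_transpose, transpose_nonsing_inv, hs.eq]
  apply inv_eq_right_inv
  rw [Matrix.mul_add, Matrix.sub_mul, Matrix.sub_mul, mul_nonsing_inv _ hQ]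
  simp only [Matrix.mul_smul, Matrix.smul_mul, mul_vecMulVec, vecMulVec_mul, hQw, hvQ,
    smul_mulVec, vecMulVec_mulVec]
  ext i j
  simp only [Matrix.add_apply, Matrix.sub_apply, Matrix.smul_apply, vecMulVec_apply, smul_eq_mul, Pi.smul_apply,
    MulOpposite.smul_eq_mul_unop, MulOpposite.unop_op]
  change _ - t * (v i * w j) + (_ - _ * (t * (v i * c) * w j)) = _
  field_simp
  ring

theorem qf_vecMulVec (v x : ι → ℝ) : qf (vecMulVec v v) x = (v ⬝ᵥ x) ^ 2 := by
  rw [qf, vecMulVec_mulVec, dotProduct_smul, dotProduct_comm x v]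
  simp [sq]

theorem isSymm_vecMulVec (v : ι → ℝ) : (vecMulVec v v).IsSymm := by
  ext i j; simp [vecMulVec_apply, mul_comm]

theorem trace_vecMulVec_self (v : ι → ℝ) : (vecMulVec v v).trace = v ⬝ᵥ v := by
  simp [trace, vecMulVec_apply, dotProduct]

/-- Cauchy–Schwarz for the form Q with w = Q⁻¹v gives (v·x)² ≤ (xᵀQx)(vᵀQ⁻¹v). -/
theorem PosDef.sub_smul_vecMulVec {Q : Matrix ι ι ℝ} (hQ : Q.PosDef) (v : ι → ℝ) {t : ℝ}
    (h0 : 0 ≤ t) (ht : t * (v ⬝ᵥ Q⁻¹ *ᵥ v) < 1) : (Q - t • vecMulVec v v).PosDef := by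
  refine posDef_iff_qf.2 ⟨(PosDef.isSymm hQ).sub ((isSymm_vecMulVec v).smul t), fun x hx => ?_⟩
  rw [qf_sub, qf_smul, qf_vecMulVec]
  set w := Q⁻¹ *ᵥ v with hw
  have hQw : Q *ᵥ w = v := by
    rw [hw, mulVec_mulVec, mul_nonsing_inv _ (PosDef.det_isUnit hQ), one_mulVec]
  have hcs := PosDef.sq_dotProduct_le hQ x w
  have hqw : qf Q w = v ⬝ᵥ w := by rw [qf, hQw, dotProduct_comm]
  rw [hQw, hqw, dotProduct_comm x v] at hcs
  have hpos := PosDef.qf_pos hQ hx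
  nlinarith [mul_le_mul_of_nonneg_left hcs h0]

/-- Comparison of the traces of the resolvents `P⁻¹` and `(P + δ)⁻¹`. -/
theorem trace_inv_shift {A B : Matrix ι ι ℝ} {δ : ℝ} (hδ : 0 ≤ δ) (hA : A.PosDef)
    (hB : B.PosDef) (hAB : B = A + δ • 1) :
    δ * (B⁻¹ * B⁻¹).trace ≤ A⁻¹.trace - B⁻¹.trace ∧
      A⁻¹.trace - B⁻¹.trace ≤ δ * (A⁻¹ * A⁻¹).trace := by
  have hA' := PosDef.det_isUnit hA
  have hB' := PosDef.det_isUnit hB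
  -- The resolvent identity, in both orders. A second application compares the trace of A⁻¹B⁻¹ with
  -- those of B⁻² and A⁻².
  have h1 : A⁻¹ - B⁻¹ = δ • (A⁻¹ * B⁻¹) := by
    have : A⁻¹ * (B - A) * B⁻¹ = A⁻¹ - B⁻¹ := by
      rw [Matrix.mul_sub, Matrix.sub_mul, nonsing_inv_mul _ hA', Matrix.mul_assoc,
        mul_nonsing_inv _ hB', Matrix.mul_one, Matrix.one_mul]
    rw [← this, hAB]; simp
  have h2 : A⁻¹ - B⁻¹ = δ • (B⁻¹ * A⁻¹) := by
    have : B⁻¹ * (B - A) * A⁻¹ = A⁻¹ - B⁻¹ := by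
      rw [Matrix.mul_sub, Matrix.sub_mul, nonsing_inv_mul _ hB', Matrix.mul_assoc,
        mul_nonsing_inv _ hA', Matrix.mul_one, Matrix.one_mul]
    rw [← this, hAB]; simp
  have ht : A⁻¹.trace - B⁻¹.trace = δ * (A⁻¹ * B⁻¹).trace := by
    rw [← trace_sub, h1, trace_smul, smul_eq_mul]
  have h3 : (A⁻¹ * B⁻¹).trace - (B⁻¹ * B⁻¹).trace = δ * (B⁻¹ * A⁻¹ * B⁻¹).trace := by
    rw [← trace_sub, ← Matrix.sub_mul, h2, Matrix.smul_mul, trace_smul, smul_eq_mul]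
  have h4 : (A⁻¹ * A⁻¹).trace - (A⁻¹ * B⁻¹).trace = δ * (A⁻¹ * B⁻¹ * A⁻¹).trace := by
    rw [← trace_sub, ← Matrix.mul_sub, h2, Matrix.mul_smul, trace_smul, smul_eq_mul,
      Matrix.mul_assoc]
  have h5 : 0 ≤ (B⁻¹ * A⁻¹ * B⁻¹).trace := by
    have := hA.inv.posSemidef.conjTranspose_mul_mul_same B⁻¹
    rw [hB.inv.isHermitian.eq] at this
    exact this.trace_nonneg
  have h6 : 0 ≤ (A⁻¹ * B⁻¹ * A⁻¹).trace := by
    have := hB.inv.posSemidef.conjTranspose_mul_mul_same A⁻¹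
    rw [hA.inv.isHermitian.eq] at this
    exact this.trace_nonneg
  rw [ht]
  constructor
  · exact mul_le_mul_of_nonneg_left (by nlinarith [mul_nonneg hδ h5]) hδ
  · exact mul_le_mul_of_nonneg_left (by nlinarith [mul_nonneg hδ h6]) hδ

theorem trace_mul_self_pos [Nonempty ι] {A : Matrix ι ι ℝ} (hA : A.PosDef) :
    0 < (A⁻¹ * A⁻¹).trace := by
  have h : (A⁻¹ * A⁻¹).PosDef := by
    have := PosDef.conjTranspose_mul_self A⁻¹
      (mulVec_injective_iff_isUnit.2 hA.inv.isUnit)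
    rwa [hA.inv.isHermitian.eq] at this
  exact h.trace_pos

/-- If the trace of `P⁻¹` is at most `1/2` then `P - 1` is positive definite, and its inverse has
at most twice the trace. -/
theorem posDef_sub_one {A : Matrix ι ι ℝ} (hA : A.PosDef) (h : A⁻¹.trace ≤ 1 / 2) :
    (A - 1).PosDef ∧ (A - 1)⁻¹.trace ≤ 2 * A⁻¹.trace := by
  obtain ⟨U, d, hU, hd⟩ := exists_orthogonal_diagonalization (PosDef.isSymm hA)
  have hU' : Uᵀ * U = 1 := mul_eq_one_comm.1 hU
  have hpos : ∀ i, 0 < d i := by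
    have : (Uᵀ * A * U).PosDef := by
      have := hA.conjTranspose_mul_mul_same (B := U)
        (mulVec_injective_iff_isUnit.2 (IsUnit.of_mul_eq_one _ hU))
      rwa [conjTranspose_eq_transpose_of_trivial] at this
    have h2 : Uᵀ * A * U = diagonal d := by
      rw [hd]
      calc Uᵀ * (U * diagonal d * Uᵀ) * U = (Uᵀ * U) * diagonal d * (Uᵀ * U) := by
            simp only [Matrix.mul_assoc]
        _ = _ := by rw [hU']; simp
    rw [h2] at this
    exact posDef_diagonal_iff.1 this
  have hinv : ∀ e : ι → ℝ, (∀ i, e i ≠ 0) →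
      (U * diagonal e * Uᵀ)⁻¹ = U * diagonal (fun i => (e i)⁻¹) * Uᵀ := fun e he => by
    apply inv_eq_right_inv
    calc U * diagonal e * Uᵀ * (U * diagonal (fun i => (e i)⁻¹) * Uᵀ)
        = U * (diagonal e * (Uᵀ * U) * diagonal (fun i => (e i)⁻¹)) * Uᵀ := by
          simp only [Matrix.mul_assoc]
      _ = _ := by
        rw [hU', Matrix.mul_one, diagonal_mul_diagonal]
        simp [he, hU]
  have htr : ∀ e : ι → ℝ, (U * diagonal e * Uᵀ).trace = ∑ i, e i := fun e => by
    rw [trace_mul_comm, ← Matrix.mul_assoc, hU', Matrix.one_mul, trace_diagonal]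
  have h1 : A⁻¹.trace = ∑ i, (d i)⁻¹ := by
    rw [hd, hinv d fun i => (hpos i).ne', htr]
  -- Each 1/dᵢ is at most the trace, so dᵢ ≥ 2; then 1/(dᵢ - 1) ≤ 2/dᵢ.
  have hge : ∀ i, 2 ≤ d i := fun i => by
    have : (d i)⁻¹ ≤ 1 / 2 := by
      refine le_trans ?_ (h1 ▸ h)
      exact single_le_sum (f := fun i => (d i)⁻¹) (fun j _ => (inv_pos.2 (hpos j)).le) (mem_univ i)
    rw [one_div] at this
    exact (inv_le_inv₀ (hpos i) two_pos).1 this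
  have hsub : A - 1 = U * diagonal (fun i => d i - 1) * Uᵀ := by
    have : diagonal (fun i => d i - 1) = diagonal d - (1 : Matrix ι ι ℝ) := by
      rw [← diagonal_one, diagonal_sub]
    rw [this, Matrix.mul_sub, Matrix.sub_mul, Matrix.mul_one, hU, hd]
  constructor
  · rw [hsub]
    have hD : (diagonal fun i => d i - 1).PosDef :=
      posDef_diagonal_iff.2 fun i => by linarith [hge i]
    have := hD.mul_mul_conjTranspose_same (B := U)
      (vecMul_injective_iff_isUnit.2 (IsUnit.of_mul_eq_one _ hU))
    rwa [conjTranspose_eq_transpose_of_trivial] at this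
  · rw [hsub, hinv _ fun i => by linarith [hge i], htr, h1, mul_sum]
    refine sum_le_sum fun i _ => ?_
    have := hge i
    rw [← div_eq_mul_inv, inv_eq_one_div, div_le_div_iff₀ (by linarith) (by linarith)]
    linarith

/-- A and B are the gaps to the upper barrier before and after it rises by δ. The rise lowers the
potential by at least δ tr B⁻², and the rank-one update raises it by t|B⁻¹v|²/(1 - t vᵀB⁻¹v); `ht`
says that the gain pays for the loss. -/
theorem upper_barrier_step [Nonempty ι] {A B : Matrix ι ι ℝ} {δ t : ℝ} (hδ : 0 < δ)
    (hA : A.PosDef) (hB : B.PosDef) (hAB : B = A + δ • 1) (v : ι → ℝ) (h0 : 0 < t)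
    (ht : t * (((B⁻¹ *ᵥ v) ⬝ᵥ (B⁻¹ *ᵥ v)) / (δ * (B⁻¹ * B⁻¹).trace) + v ⬝ᵥ B⁻¹ *ᵥ v) < 1) :
    (B - t • vecMulVec v v).PosDef ∧ (B - t • vecMulVec v v)⁻¹.trace ≤ A⁻¹.trace := by
  set τ := (B⁻¹ * B⁻¹).trace
  have hτ : 0 < τ := trace_mul_self_pos hB
  set q := (B⁻¹ *ᵥ v) ⬝ᵥ (B⁻¹ *ᵥ v)
  set c := v ⬝ᵥ B⁻¹ *ᵥ v
  have hq : 0 ≤ q := sum_nonneg fun i _ => mul_self_nonneg _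
  have hqd : 0 ≤ q / (δ * τ) := by positivity
  have hc : t * c < 1 := by nlinarith [mul_nonneg h0.le hqd]
  refine ⟨PosDef.sub_smul_vecMulVec hB v h0.le hc, ?_⟩
  rw [inv_sub_smul_vecMulVec (PosDef.isSymm hB) (PosDef.det_isUnit hB) v (by linarith), trace_add,
    trace_smul, trace_vecMulVec_self, smul_eq_mul]
  have h1 := (trace_inv_shift hδ.le hA hB hAB).1
  have h2 : t / (1 - t * c) * q ≤ δ * τ := by
    rw [div_mul_eq_mul_div, div_le_iff₀ (by linarith)]
    have : t * (q / (δ * τ)) ≤ 1 - t * c := by linarith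
    rw [← mul_div_assoc, div_le_iff₀ (by positivity)] at this
    linarith
  change _ + t / (1 - t * c) * q ≤ _
  linarith

/-- Here B and A are the gaps to the lower barrier before and after it rises by 1. The rise costs at
most tr A⁻² of potential, and `ht` makes the update regain at least that much. -/
theorem lower_barrier_step [Nonempty ι] {A B : Matrix ι ι ℝ} {t : ℝ}
    (hA : A.PosDef) (hB : B.PosDef) (hAB : B = A + (1 : ℝ) • 1) (v : ι → ℝ) (h0 : 0 < t)
    (ht : 1 ≤ t * (((A⁻¹ *ᵥ v) ⬝ᵥ (A⁻¹ *ᵥ v)) / (A⁻¹ * A⁻¹).trace - v ⬝ᵥ A⁻¹ *ᵥ v)) :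
    (A + t • vecMulVec v v).PosDef ∧ (A + t • vecMulVec v v)⁻¹.trace ≤ B⁻¹.trace := by
  set τ := (A⁻¹ * A⁻¹).trace
  have hτ : 0 < τ := trace_mul_self_pos hA
  set q := (A⁻¹ *ᵥ v) ⬝ᵥ (A⁻¹ *ᵥ v)
  have hc : 0 ≤ v ⬝ᵥ A⁻¹ *ᵥ v := PosDef.qf_nonneg hA.inv v
  have heq : A + t • vecMulVec v v = A - (-t) • vecMulVec v v := by simp
  refine ⟨hA.add_posSemidef (posSemidef_iff_qf.2 ⟨(isSymm_vecMulVec v).smul t, fun x => ?_⟩), ?_⟩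
  · rw [qf_smul, qf_vecMulVec]; positivity
  have hne : 0 < 1 - (-t) * (v ⬝ᵥ A⁻¹ *ᵥ v) := by nlinarith [mul_nonneg h0.le hc]
  rw [heq, inv_sub_smul_vecMulVec (PosDef.isSymm hA) (PosDef.det_isUnit hA) v hne.ne', trace_add,
    trace_smul, trace_vecMulVec_self, smul_eq_mul]
  have h1 := (trace_inv_shift zero_le_one hA hB hAB).2
  set c := v ⬝ᵥ A⁻¹ *ᵥ v
  have h2 : τ ≤ t / (1 - (-t) * c) * q := by
    rw [div_mul_eq_mul_div, le_div_iff₀ hne]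
    have : 1 + t * c ≤ t * (q / τ) := by linarith
    rw [← mul_div_assoc, le_div_iff₀ hτ] at this
    linarith
  change _ + -t / (1 - (-t) * c) * q ≤ _
  rw [neg_div, neg_mul]
  linarith

/-- The averaging principle: it turns the barrier conditions, summed over all candidate vectors,
into traces. -/
theorem sum_dotProduct_mulVec {v : P → ι → ℝ} (hv : ∑ p, vecMulVec (v p) (v p) = 1)
    (B : Matrix ι ι ℝ) : ∑ p, v p ⬝ᵥ B *ᵥ v p = B.trace := by
  have : B.trace = (B * ∑ p, vecMulVec (v p) (v p)).trace := by rw [hv, Matrix.mul_one]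
  rw [this, Matrix.mul_sum, trace_sum]
  refine sum_congr rfl fun p _ => ?_
  rw [mul_vecMulVec, trace_vecMulVec, dotProduct_comm]

/-- `A` lies strictly between the barriers `l` and `u`, and both potentials are at most `e`. -/
structure Between (A : Matrix ι ι ℝ) (l u e : ℝ) : Prop where
  upper : (u • 1 - A).PosDef
  lower : (A - l • 1).PosDef
  upper_trace : (u • 1 - A)⁻¹.trace ≤ e
  lower_trace : (A - l • 1)⁻¹.trace ≤ e

/-- The upper barrier allows weight t on vₚ if t f(p) < 1, the lower one if t g(p) ≥ 1. Summed over
p, f gives at most 1/(1+θ) + θ/8 and g at least 1 - θ/4, which is larger; so f(p) < g(p) for some p,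
and t = 1/g(p) serves both barriers. -/
theorem Between.step [Nonempty ι] {v : P → ι → ℝ} (hv : ∑ p, vecMulVec (v p) (v p) = 1)
    {θ : ℝ} (h0 : 0 < θ) (h1 : θ ≤ 1) {A : Matrix ι ι ℝ} {l u : ℝ} (h : Between A l u (θ / 8)) :
    ∃ (p : P) (t : ℝ), 0 < t ∧ Between (A + t • vecMulVec (v p) (v p)) (l + 1) (u + (1 + θ)) (θ / 8) := by
  have hδ : 0 < 1 + θ := by linarith
  set B : Matrix ι ι ℝ := (u + (1 + θ)) • 1 - A with hBdef
  have hBA : B = (u • 1 - A) + (1 + θ) • 1 := by rw [hBdef, add_smul]; abel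
  have hB : B.PosDef := by
    rw [hBA]; exact h.upper.add (PosDef.one.smul hδ)
  -- The raised lower barrier is still below the spectrum, with potential at most 2 · θ/8 = θ/4.
  obtain ⟨hR, hRt⟩ := posDef_sub_one h.lower (by linarith [h.lower_trace])
  set R : Matrix ι ι ℝ := A - l • 1 - 1 with hRdef
  have hRA : A - l • 1 = R + (1 : ℝ) • 1 := by rw [hRdef]; simp
  have hτB := trace_mul_self_pos hB
  have hτR := trace_mul_self_pos hR
  have hsq : ∀ {Q : Matrix ι ι ℝ}, Q.PosDef → ∀ x : ι → ℝ,
      (Q⁻¹ *ᵥ x) ⬝ᵥ (Q⁻¹ *ᵥ x) = x ⬝ᵥ (Q⁻¹ * Q⁻¹) *ᵥ x := fun hQ x => by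
    rw [← mulVec_mulVec, dotProduct_mulVec x, ← mulVec_transpose, (PosDef.isSymm hQ.inv).eq]
  set f : P → ℝ := fun p => ((B⁻¹ *ᵥ v p) ⬝ᵥ (B⁻¹ *ᵥ v p)) / ((1 + θ) * (B⁻¹ * B⁻¹).trace) +
    v p ⬝ᵥ B⁻¹ *ᵥ v p with hf
  set g : P → ℝ := fun p => ((R⁻¹ *ᵥ v p) ⬝ᵥ (R⁻¹ *ᵥ v p)) / (R⁻¹ * R⁻¹).trace -
    v p ⬝ᵥ R⁻¹ *ᵥ v p with hg
  have hfs : ∑ p, f p ≤ 1 / (1 + θ) + θ / 8 := by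
    simp only [hf, hsq hB, sum_add_distrib, ← sum_div, sum_dotProduct_mulVec hv]
    refine add_le_add (le_of_eq ?_) ?_
    · field_simp
    · have := (trace_inv_shift hδ.le h.upper hB hBA).1
      have h2 := mul_pos hδ hτB
      linarith [h.upper_trace]
  have hgs : 1 - θ / 4 ≤ ∑ p, g p := by
    simp only [hg, hsq hR, sum_sub_distrib, ← sum_div, sum_dotProduct_mulVec hv]
    rw [div_self hτR.ne']
    linarith [h.lower_trace]
  have hlt : ∑ p, f p < ∑ p, g p := by
    refine hfs.trans_lt (lt_of_lt_of_le ?_ hgs)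
    rw [div_add' _ _ _ hδ.ne', div_lt_iff₀ hδ]
    nlinarith
  obtain ⟨p, -, hp⟩ := exists_lt_of_sum_lt hlt
  have hf0 : 0 ≤ f p := by
    refine add_nonneg (div_nonneg (sum_nonneg fun i _ => mul_self_nonneg _) ?_)
      (PosDef.qf_nonneg hB.inv _)
    positivity
  have hgp : 0 < g p := hf0.trans_lt hp
  have hu := upper_barrier_step hδ h.upper hB hBA (v p) (inv_pos.2 hgp)
    (by change (g p)⁻¹ * f p < 1; rwa [inv_mul_lt_one₀ hgp])
  have hl := lower_barrier_step hR h.lower hRA (v p) (inv_pos.2 hgp)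
    (by change 1 ≤ (g p)⁻¹ * g p; rw [inv_mul_cancel₀ hgp.ne'])
  have e1 : (u + (1 + θ)) • (1 : Matrix ι ι ℝ) - (A + (g p)⁻¹ • vecMulVec (v p) (v p)) =
      B - (g p)⁻¹ • vecMulVec (v p) (v p) := by rw [hBdef]; abel
  have e2 : A + (g p)⁻¹ • vecMulVec (v p) (v p) - (l + 1) • 1 =
      R + (g p)⁻¹ • vecMulVec (v p) (v p) := by rw [hRdef, add_smul, one_smul]; abel
  refine ⟨p, (g p)⁻¹, inv_pos.2 hgp, ?_, ?_, ?_, ?_⟩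
  · rw [e1]; exact hu.1
  · rw [e2]; exact hl.1
  · rw [e1]; exact hu.2.trans h.upper_trace
  · rw [e2]; exact hl.2.trans h.lower_trace

theorem Between.iterate [Nonempty ι] {v : P → ι → ℝ}
    (hv : ∑ p, vecMulVec (v p) (v p) = 1) {θ : ℝ} (h0 : 0 < θ) (h1 : θ ≤ 1) {l u : ℝ}
    (h : Between (0 : Matrix ι ι ℝ) l u (θ / 8)) (k : ℕ) :
    ∃ s : P → ℝ, (∀ p, 0 ≤ s p) ∧ #{p | s p ≠ 0} ≤ k ∧
      Between (∑ p, s p • vecMulVec (v p) (v p)) (l + k) (u + k * (1 + θ)) (θ / 8) := by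
  classical
  induction k with
  | zero => exact ⟨0, by simp, by simp, by simpa using h⟩
  | succ k ih =>
    obtain ⟨s, hs, hk, hb⟩ := ih
    obtain ⟨p, t, ht, hb'⟩ := hb.step hv h0 h1
    refine ⟨s + Pi.single p t, fun q => add_nonneg (hs q) ?_, ?_, ?_⟩
    · by_cases hq : q = p
      · subst hq; simp [ht.le]
      · simp [hq]
    · refine (card_le_card (t := insert p ({p | s p ≠ 0} : Finset P)) fun q hq => ?_).trans
        ((card_insert_le _ _).trans (by omega))
      by_cases hqp : q = p
      · simp [hqp]
      · simpa [hqp] using hq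
    · have e : ∑ q, (s + Pi.single p t : P → ℝ) q • vecMulVec (v q) (v q) =
          ∑ q, s q • vecMulVec (v q) (v q) + t • vecMulVec (v p) (v p) := by
        simp only [Pi.add_apply, add_smul, sum_add_distrib]
        congr 1
        rw [sum_eq_single p]
        · simp
        · intro q _ hq; simp [hq]
        · simp
      rw [e]
      convert hb' using 1 <;> push_cast <;> ring

theorem between_zero [Nonempty ι] {e : ℝ} (he : 0 < e) :
    Between (0 : Matrix ι ι ℝ) (-(Fintype.card ι / e)) (Fintype.card ι / e) e := by
  have hn : (0 : ℝ) < Fintype.card ι := by exact_mod_cast Fintype.card_pos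
  have hc : (0 : ℝ) < Fintype.card ι / e := by positivity
  have hp : ((Fintype.card ι / e : ℝ) • (1 : Matrix ι ι ℝ)).PosDef := PosDef.one.smul hc
  have ht : ((Fintype.card ι / e : ℝ) • (1 : Matrix ι ι ℝ))⁻¹.trace ≤ e := by
    rw [inv_eq_right_inv (B := (Fintype.card ι / e : ℝ)⁻¹ • (1 : Matrix ι ι ℝ))
      (by rw [Matrix.smul_mul, Matrix.one_mul, smul_smul, mul_inv_cancel₀ hc.ne', one_smul])]
    rw [trace_smul, trace_one, smul_eq_mul, inv_div, div_mul_cancel₀ _ hn.ne']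
  have e1 : (0 : Matrix ι ι ℝ) - (-(Fintype.card ι / e : ℝ)) • 1 = (Fintype.card ι / e : ℝ) • 1 := by
    simp
  exact ⟨by rwa [sub_zero], by rwa [e1], by rwa [sub_zero], by rwa [e1]⟩

/-- Linear-size sparsification of a decomposition of the identity. -/
theorem exists_sparse_weights_of_isotropic [Nonempty ι] {v : P → ι → ℝ}
    (hv : ∑ p, vecMulVec (v p) (v p) = 1) {N : ℕ} (hN : 0 < N) :
    ∃ s : P → ℝ, (∀ p, 0 ≤ s p) ∧ #{p | s p ≠ 0} ≤ 16 * Fintype.card ι * N ^ 2 ∧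
      ∀ x : ι → ℝ, x ⬝ᵥ x ≤ ∑ p, s p * (v p ⬝ᵥ x) ^ 2 ∧
        ∑ p, s p * (v p ⬝ᵥ x) ^ 2 ≤ (1 + 4 / N) * (x ⬝ᵥ x) := by
  have hN' : (1 : ℝ) ≤ N := by exact_mod_cast hN
  have hn : (0 : ℝ) < Fintype.card ι := by exact_mod_cast Fintype.card_pos
  have hθ : (0 : ℝ) < 1 / N := by positivity
  -- With θ = 1/N and n the dimension, the barriers start at ∓8nN. After 16nN² steps they are
  -- 8nN(2N-1) and 8nN(2N+3), with ratio 1 + 4/(2N-1) ≤ 1 + 4/N. Division by the lower one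
  -- normalizes the weights.
  obtain ⟨s, hs, hk, hb⟩ := (between_zero (ι := ι) (e := 1 / N / 8) (by positivity)).iterate hv hθ
    (by rw [div_le_one (by linarith)]; exact hN') (16 * Fintype.card ι * N ^ 2)
  set n : ℝ := (Fintype.card ι : ℝ) with hndef
  have hl : -(n / (1 / N / 8)) + (16 * Fintype.card ι * N ^ 2 : ℕ) = 8 * n * N * (2 * N - 1) := by
    push_cast; rw [← hndef]; field_simp; ring
  have hu : n / (1 / N / 8) + (16 * Fintype.card ι * N ^ 2 : ℕ) * (1 + 1 / N) =
      8 * n * N * (2 * N + 3) := by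
    push_cast; rw [← hndef]; field_simp; ring
  rw [hl, hu] at hb
  set l := 8 * n * N * (2 * N - 1)
  have hlpos : 0 < l := by
    have : (0 : ℝ) < 2 * N - 1 := by linarith
    positivity
  refine ⟨fun p => l⁻¹ * s p, fun p => mul_nonneg (inv_pos.2 hlpos).le (hs p), ?_, fun x => ?_⟩
  · refine (card_le_card fun p hp => ?_).trans hk
    simp only [mem_filter, mem_univ, true_and] at hp ⊢
    exact right_ne_zero_of_mul hp
  · have hq : qf (∑ p, s p • vecMulVec (v p) (v p)) x = ∑ p, s p * (v p ⬝ᵥ x) ^ 2 := by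
      have : ∀ S : Finset P, qf (∑ p ∈ S, s p • vecMulVec (v p) (v p)) x =
          ∑ p ∈ S, s p * (v p ⬝ᵥ x) ^ 2 := fun S => by
        classical
        induction S using Finset.induction_on with
        | empty => simp [qf]
        | insert p S hp ih => rw [sum_insert hp, sum_insert hp, qf_add, ih, qf_smul, qf_vecMulVec]
      exact this univ
    have h1 : qf (1 : Matrix ι ι ℝ) x = x ⬝ᵥ x := by simp [qf]
    have hlo := PosDef.qf_nonneg hb.lower x
    have hup := PosDef.qf_nonneg hb.upper x
    rw [qf_sub, qf_smul, hq, h1] at hlo hup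
    simp only [mul_assoc, ← mul_sum]
    rw [inv_mul_eq_div, le_div_iff₀ hlpos, div_le_iff₀ hlpos]
    refine ⟨by linarith, ?_⟩
    have hxx : 0 ≤ x ⬝ᵥ x := sum_nonneg fun i _ => mul_self_nonneg _
    have hcmp : 8 * n * N * (2 * N + 3) ≤ (1 + 4 / N) * l := by
      have : (1 + 4 / N) * l = 8 * n * ((N + 4) * (2 * N - 1)) := by
        simp only [l]; field_simp
      rw [this, mul_assoc (8 * n)]
      refine mul_le_mul_of_nonneg_left ?_ (by positivity)
      nlinarith
    nlinarith [mul_le_mul_of_nonneg_right hcmp hxx]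

/-- Linear-size sparsification of a decomposition of a positive definite form into squares. -/
theorem exists_sparse_weights {A : Matrix ι ι ℝ} (hA : A.PosDef) {a : P → ι → ℝ}
    (ha : ∀ x, qf A x = ∑ p, (a p ⬝ᵥ x) ^ 2) {N : ℕ} (hN : 0 < N) :
    ∃ s : P → ℝ, (∀ p, 0 ≤ s p) ∧ #{p | s p ≠ 0} ≤ 16 * Fintype.card ι * N ^ 2 ∧
      ∀ x : ι → ℝ, qf A x ≤ ∑ p, s p * (a p ⬝ᵥ x) ^ 2 ∧
        ∑ p, s p * (a p ⬝ᵥ x) ^ 2 ≤ (1 + 4 / N) * qf A x := by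
  rcases isEmpty_or_nonempty ι with hι | hι
  · exact ⟨0, by simp, by simp, fun x => by simp [qf]⟩
  obtain ⟨T, d, hT, hAT, -⟩ := exists_simultaneous_diagonalization hA (PosDef.isSymm hA)
  have hq : ∀ x, qf A x = (T *ᵥ x) ⬝ᵥ (T *ᵥ x) := fun x => by
    rw [qf, hAT, ← mulVec_mulVec, dotProduct_mulVec, vecMul_transpose]
  -- The coordinates T turn A = TᵀT into the identity, so by polarization the transformed vectors
  -- decompose the identity.
  set v : P → ι → ℝ := fun p => a p ᵥ* T⁻¹ with hv
  have hva : ∀ p x, v p ⬝ᵥ (T *ᵥ x) = a p ⬝ᵥ x := fun p x => by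
    rw [hv, ← dotProduct_mulVec, mulVec_mulVec, nonsing_inv_mul _ hT, one_mulVec]
  have hsurj : ∀ y : ι → ℝ, ∃ x, T *ᵥ x = y := fun y =>
    ⟨T⁻¹ *ᵥ y, by rw [mulVec_mulVec, mul_nonsing_inv _ hT, one_mulVec]⟩
  have hsum : ∑ p, vecMulVec (v p) (v p) = 1 := by
    have hform : ∀ y, ∑ p, (v p ⬝ᵥ y) ^ 2 = y ⬝ᵥ y := fun y => by
      obtain ⟨x, rfl⟩ := hsurj y
      simp only [hva, ← ha, hq]
    have hpol : ∀ y z, ∑ p, (v p ⬝ᵥ y) * (v p ⬝ᵥ z) = y ⬝ᵥ z := fun y z => by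
      have h1 := hform (y + z)
      simp only [dotProduct_add, add_dotProduct, add_sq, sum_add_distrib, hform] at h1
      rw [dotProduct_comm z y] at h1
      have h2 : ∑ p, 2 * (v p ⬝ᵥ y) * (v p ⬝ᵥ z) = 2 * ∑ p, (v p ⬝ᵥ y) * (v p ⬝ᵥ z) := by
        rw [mul_sum]; exact sum_congr rfl fun p _ => by ring
      linarith
    ext i j
    have := hpol (Pi.single i 1) (Pi.single j 1)
    simp only [dotProduct_single, mul_one] at this
    rw [Matrix.sum_apply]
    simp only [vecMulVec_apply, this]
    rw [Matrix.one_apply, Pi.single_apply]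
    simp only [eq_comm]
  obtain ⟨s, hs, hk, hb⟩ := exists_sparse_weights_of_isotropic hsum hN
  refine ⟨s, hs, hk, fun x => ?_⟩
  have := hb (T *ᵥ x)
  simpa only [hva, ← hq] using this

end Barrier

/-! ### Sparsification of SDDM matrices -/

section Sparsify

variable {ι : Type} [Fintype ι] [DecidableEq ι]

/-- The SDDM matrix obtained from `A` by scaling its diagonal excess at `i` by `s (i, i)`, and its
entry at `(i, j)` by the mean of `s (i, j)` and `s (j, i)`. -/
noncomputable def reweight (A : Matrix ι ι ℝ) (s : ι × ι → ℝ) : Matrix ι ι ℝ := fun i j =>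
  if i = j then s (i, i) * ∑ k, A i k - ∑ k ∈ univ.erase i, A i k * ((s (i, k) + s (k, i)) / 2)
  else A i j * ((s (i, j) + s (j, i)) / 2)

theorem reweight_isSymm {A : Matrix ι ι ℝ} (hA : A.IsSymm) (s : ι × ι → ℝ) :
    (reweight A s).IsSymm := by
  ext i j
  by_cases h : i = j
  · subst h; rfl
  · simp only [transpose_apply, reweight, h, Ne.symm h, if_false, hA.apply i j, add_comm]

/-- The diagonal of `reweight` is chosen to make this hold, so nonnegative weights preserve diagonal
dominance. -/
theorem reweight_rowSum (A : Matrix ι ι ℝ) (s : ι × ι → ℝ) (i : ι) :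
    ∑ j, reweight A s i j = s (i, i) * ∑ k, A i k := by
  rw [← add_sum_erase univ _ (mem_univ i)]
  have : ∑ j ∈ univ.erase i, reweight A s i j =
      ∑ k ∈ univ.erase i, A i k * ((s (i, k) + s (k, i)) / 2) :=
    sum_congr rfl fun j hj => by simp [reweight, (ne_of_mem_erase hj).symm]
  rw [this]
  simp [reweight]

theorem qf_reweight {A : Matrix ι ι ℝ} (hA : A.IsSymm) (s : ι × ι → ℝ) (x : ι → ℝ) :
    qf (reweight A s) x = ∑ i, s (i, i) * (∑ k, A i k) * x i ^ 2 +
      ∑ i, ∑ j, s (i, j) * ((-A i j) / 2 * (x i - x j) ^ 2) := by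
  rw [qf_eq_laplacian (reweight_isSymm hA s)]
  simp only [reweight_rowSum]
  congr 1
  have h1 : ∀ i j, -reweight A s i j / 2 * (x i - x j) ^ 2 =
      s (i, j) * ((-A i j) / 2 * (x i - x j) ^ 2) / 2 +
        s (j, i) * ((-A j i) / 2 * (x j - x i) ^ 2) / 2 := fun i j => by
    by_cases h : i = j
    · subst h; simp
    · rw [hA.apply i j]
      simp only [reweight, h, if_false]
      ring
  simp only [h1, sum_add_distrib]
  rw [sum_comm (f := fun i j => s (j, i) * ((-A j i) / 2 * (x j - x i) ^ 2) / 2)]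
  simp only [← sum_div]
  ring

/-- The form is a sum of squares indexed by pairs: (i, i) carries the row sum at i, and (i, j) half
of the edge between i and j. Any nonnegative reweighting of these squares is again of SDDM shape.
Each nonzero weight accounts for at most two off-diagonal entries. -/
theorem IsSDDM.exists_sparsifier {A : Matrix ι ι ℝ} (hA : IsSDDM A) {N : ℕ} (hN : 0 < N) :
    ∃ B : Matrix ι ι ℝ, IsSDDM B ∧
      (∀ x, qf A x ≤ qf B x ∧ qf B x ≤ (1 + 4 / N) * qf A x) ∧
      nnz B ≤ Fintype.card ι + 2 * (16 * Fintype.card ι * N ^ 2) := by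
  set a : ι × ι → ι → ℝ := fun p => if p.1 = p.2 then √(∑ k, A p.1 k) • Pi.single p.1 1
    else √((-A p.1 p.2) / 2) • (Pi.single p.1 1 - Pi.single p.2 1) with ha
  have hap : ∀ (s : ι × ι → ℝ) x,
      ∑ p, s p * (a p ⬝ᵥ x) ^ 2 = qf (reweight A s) x := fun s x => by
    rw [qf_reweight hA.symm, Fintype.sum_prod_type, ← sum_add_distrib]
    refine sum_congr rfl fun i _ => ?_
    rw [← add_sum_erase univ _ (mem_univ i),
      ← add_sum_erase univ (fun j => s (i, j) * (-A i j / 2 * (x i - x j) ^ 2)) (mem_univ i),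
      ← add_assoc]
    congr 1
    · simp only [ha, if_true, smul_dotProduct, single_dotProduct, one_mul, smul_eq_mul, mul_pow,
        Real.sq_sqrt (hA.rowSum_nonneg i)]
      ring
    · refine sum_congr rfl fun j hj => ?_
      have hij : i ≠ j := (ne_of_mem_erase hj).symm
      have h0 : 0 ≤ -A i j / 2 := by linarith [hA.offDiag_nonpos i j hij]
      simp only [ha, hij, if_false, smul_dotProduct, sub_dotProduct, single_dotProduct, one_mul,
        smul_eq_mul, mul_pow, Real.sq_sqrt h0]
  have hone : reweight A 1 = A := by
    ext i j
    by_cases h : i = j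
    · subst h
      simp only [reweight, if_true, Pi.one_apply, one_mul]
      rw [← add_sum_erase univ _ (mem_univ i)]
      simp
    · simp [reweight, h]
  obtain ⟨s, hs, hk, hb⟩ := exists_sparse_weights hA.posDef (a := a) (fun x => by
    have := hap 1 x
    rw [hone] at this
    simpa using this.symm) hN
  simp only [hap] at hb
  refine ⟨reweight A s, isSDDM_of_posDef ?_ (fun i j hij => ?_) fun i => ?_, hb, ?_⟩
  · exact posDef_iff_qf.2 ⟨reweight_isSymm hA.symm s, fun x hx =>
      (PosDef.qf_pos hA.posDef hx).trans_le (hb x).1⟩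
  · simp only [reweight, hij, if_false]
    have := hA.offDiag_nonpos i j hij
    have h1 := hs (i, j)
    have h2 := hs (j, i)
    exact mul_nonpos_of_nonpos_of_nonneg this (by linarith)
  · rw [reweight_rowSum]; exact mul_nonneg (hs _) (hA.rowSum_nonneg i)
  · set S : Finset (ι × ι) := {p | s p ≠ 0}
    have hsub : ({p : ι × ι | reweight A s p.1 p.2 ≠ 0} : Finset _) ⊆
        univ.image (fun i => (i, i)) ∪ (S ∪ S.image Prod.swap) := by
      rintro ⟨i, j⟩ hp
      simp only [mem_filter, mem_univ, true_and] at hp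
      by_cases h : i = j
      · simp [h]
      · simp only [reweight, h, if_false] at hp
        have : s (i, j) ≠ 0 ∨ s (j, i) ≠ 0 := by
          by_contra! h0
          simp [h0.1, h0.2] at hp
        rcases this with h | h
        · simp [S, h]
        · refine mem_union_right _ (mem_union_right _ (mem_image.2 ⟨(j, i), by simp [S, h], rfl⟩))
    refine (card_le_card hsub).trans ?_
    have h1 : #(univ.image fun i : ι => (i, i)) ≤ Fintype.card ι := card_image_le
    have h2 : #(S.image Prod.swap) ≤ #S := card_image_le
    have h3 := card_union_le (univ.image fun i : ι => (i, i)) (S ∪ S.image Prod.swap)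
    have h4 := card_union_le S (S.image Prod.swap)
    have h5 : #S ≤ _ := hk
    omega

theorem IsSDDM.exists_approx {A : Matrix ι ι ℝ} (hA : IsSDDM A) {ε : ℝ} (h0 : 0 < ε)
    (h1 : ε ≤ 1) :
    ∃ B : Matrix ι ι ℝ, IsSDDM B ∧ Approx ε B A ∧ (nnz B : ℝ) ≤ 801 * Fintype.card ι / ε ^ 2 := by
  -- N ≥ 4/ε makes the distortion at most 1 + ε ≤ e^ε, and N ≤ 5/ε gives 801 = 1 + 2 · 16 · 5².
  obtain ⟨B, hB, hq, hn⟩ := hA.exists_sparsifier (N := ⌈4 / ε⌉₊) (Nat.ceil_pos.2 (by positivity))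
  have hN : (4 : ℝ) / ⌈4 / ε⌉₊ ≤ ε := by
    rw [div_le_iff₀ (Nat.cast_pos.2 (Nat.ceil_pos.2 (by positivity))), ← div_le_iff₀' h0]
    exact Nat.le_ceil _
  have hN2 : (⌈4 / ε⌉₊ : ℝ) ≤ 5 / ε := by
    have h2 := (Nat.ceil_lt_add_one (a := 4 / ε) (by positivity)).le
    have h3 : 1 ≤ 1 / ε := by rwa [one_le_div h0]
    have h4 : 5 / ε = 4 / ε + 1 / ε := by ring
    linarith
  refine ⟨B, hB, (approx_iff_qf hB.symm hA.symm).2 fun x => ?_, ?_⟩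
  · have hx := PosDef.qf_nonneg hA.posDef x
    refine ⟨(hq x).2.trans (mul_le_mul_of_nonneg_right ?_ hx), ?_⟩
    · linarith [Real.add_one_le_exp ε]
    · refine le_trans ?_ (hq x).1
      exact mul_le_of_le_one_left hx (Real.exp_le_one_iff.2 (by linarith))
  · have h2 : (nnz B : ℝ) ≤ Fintype.card ι + 2 * (16 * Fintype.card ι * (⌈4 / ε⌉₊ : ℝ) ^ 2) := by
      exact_mod_cast hn
    have h3 : (⌈4 / ε⌉₊ : ℝ) ^ 2 ≤ (5 / ε) ^ 2 := pow_le_pow_left₀ (Nat.cast_nonneg _) hN2 2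
    have h4 : (1 : ℝ) ≤ 1 / ε ^ 2 := by
      rw [one_le_div (by positivity)]; exact pow_le_one₀ h0.le h1
    have hc : (0 : ℝ) ≤ Fintype.card ι := Nat.cast_nonneg _
    have h5 : 801 * (Fintype.card ι : ℝ) / ε ^ 2 =
        Fintype.card ι * (1 / ε ^ 2) + 2 * (16 * Fintype.card ι * (5 / ε) ^ 2) := by
      ring
    rw [h5]
    nlinarith [mul_le_mul_of_nonneg_left h3 hc, mul_le_mul_of_nonneg_left h4 hc]

end Sparsify

/-! ### Large strongly diagonally dominant blocks -/

section Coloring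

variable {ι : Type} [Fintype ι] [DecidableEq ι]

/-- A colouring that minimizes the total weight of the monochromatic pairs has, at every vertex,
at most the average weight in the colour of that vertex. -/
theorem exists_coloring {C : Type} [Fintype C] [DecidableEq C] [Nonempty C] (w : ι → ι → ℝ)
    (hw : ∀ i j, w i j = w j i) : ∃ f : ι → C, ∀ i,
      Fintype.card C * ∑ j ∈ univ.erase i, (if f i = f j then w i j else 0) ≤
        ∑ j ∈ univ.erase i, w i j := by
  set Φ : (ι → C) → ℝ := fun f => ∑ i, ∑ j ∈ univ.erase i, if f i = f j then w i j else 0 with hΦ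
  obtain ⟨f, hf⟩ := Finite.exists_min Φ
  refine ⟨f, fun i => ?_⟩
  set own : (ι → C) → ℝ := fun g => ∑ j ∈ univ.erase i, if g i = g j then w i j else 0 with hown
  -- Only the pairs containing i, each counted twice in Φ, depend on the colour of i.
  have hsplit : ∀ g : ι → C, Φ g = 2 * own g +
      ∑ a ∈ univ.erase i, ∑ b ∈ (univ.erase a).erase i, if g a = g b then w a b else 0 :=
    fun g => by
    have h1 : ∀ a ∈ univ.erase i, ∑ b ∈ univ.erase a, (if g a = g b then w a b else 0) =
        (if g i = g a then w i a else 0) +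
          ∑ b ∈ (univ.erase a).erase i, if g a = g b then w a b else 0 := fun a ha => by
      rw [← add_sum_erase (univ.erase a) _
        (mem_erase.2 ⟨(ne_of_mem_erase ha).symm, mem_univ i⟩), hw a i]
      simp only [eq_comm]
    simp only [hΦ]
    rw [← add_sum_erase univ _ (mem_univ i), sum_congr rfl h1, sum_add_distrib]
    ring
  have hmin : ∀ c, own f ≤ ∑ j ∈ univ.erase i, if c = f j then w i j else 0 := fun c => by
    have h1 := hf (Function.update f i c)
    rw [hsplit, hsplit] at h1
    have h2 : ∑ a ∈ univ.erase i, ∑ b ∈ (univ.erase a).erase i,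
        (if Function.update f i c a = Function.update f i c b then w a b else 0) =
        ∑ a ∈ univ.erase i, ∑ b ∈ (univ.erase a).erase i, if f a = f b then w a b else 0 :=
      sum_congr rfl fun a ha => sum_congr rfl fun b hb => by
        rw [Function.update_of_ne (ne_of_mem_erase ha), Function.update_of_ne (ne_of_mem_erase hb)]
    have h3 : own (Function.update f i c) =
        ∑ j ∈ univ.erase i, if c = f j then w i j else 0 :=
      sum_congr rfl fun j hj => by
        rw [Function.update_self, Function.update_of_ne (ne_of_mem_erase hj)]
    rw [h2, h3] at h1
    linarith
  -- Sum over all recolourings of i: every neighbour is hit by exactly one colour.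
  have h4 := sum_le_sum fun c (_ : c ∈ (univ : Finset C)) => hmin c
  rw [sum_const, card_univ, nsmul_eq_mul, sum_comm] at h4
  exact h4.trans_eq (sum_congr rfl fun j _ => by simp)

/-- Five colours are used because 5 = 1 + α with α = 4; the block is the colour class found by
pigeonhole. -/
theorem IsSDDM.exists_large_block {A : Matrix ι ι ℝ} (hA : IsSDDM A) :
    ∃ F : Finset ι, Fintype.card ι ≤ 5 * #F ∧
      ∀ i ∈ F, 5 * ∑ j ∈ F.erase i, |A i j| ≤ A i i := by
  obtain ⟨f, hf⟩ := exists_coloring (C := Fin 5) (fun i j => |A i j|)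
    fun i j => by rw [hA.symm.apply]
  obtain ⟨c, hc⟩ : ∃ c, Fintype.card ι ≤ 5 * #{i | f i = c} := by
    by_contra! h
    have h1 : Fintype.card ι = ∑ c, #{i | f i = c} :=
      card_eq_sum_card_fiberwise fun i _ => mem_univ (f i)
    have h2 := sum_lt_sum_of_nonempty univ_nonempty fun c (_ : c ∈ (univ : Finset (Fin 5))) => h c
    rw [← mul_sum, ← h1] at h2
    simp at h2
  refine ⟨_, hc, fun i hi => ?_⟩
  have hi' : f i = c := by simpa using hi
  refine le_trans (le_of_eq ?_) ((hf i).trans (hA.dominant i))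
  simp only [Fintype.card_fin, Nat.cast_ofNat]
  rw [← sum_filter]
  congr 2
  ext j
  simp [hi', eq_comm, and_comm]

end Coloring

/-! ### Block matrices and Schur complements -/

section Schur

variable {ι κ : Type} [Fintype ι] [DecidableEq ι] [Fintype κ] [DecidableEq κ]

/-- Completing the square in x. -/
theorem qf_fromBlocks {A : Matrix ι ι ℝ} (hs : A.IsSymm) (hA : IsUnit A.det) (B : Matrix ι κ ℝ)
    (D : Matrix κ κ ℝ) (x : ι → ℝ) (y : κ → ℝ) :
    qf (fromBlocks A B Bᵀ D) (Sum.elim x y) =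
      qf A (x + A⁻¹ *ᵥ (B *ᵥ y)) + qf (D - Bᵀ * A⁻¹ * B) y := by
  have : Invertible A := invertibleOfIsUnitDet A hA
  have h := schur_complement_eq₁₁ B D x y ((isHermitian_iff_isSymm A).2 hs)
  simp only [star_trivial, conjTranspose_eq_transpose_of_trivial] at h
  simp only [← dotProduct_mulVec] at h
  rw [qf, qf, qf, mulVec_mulVec]
  exact h

theorem symm_fromBlocks {A : Matrix ι ι ℝ} {B : Matrix ι κ ℝ} {D : Matrix κ κ ℝ}
    (hA : A.IsSymm) (hD : D.IsSymm) : (fromBlocks A B Bᵀ D).IsSymm :=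
  hA.fromBlocks rfl hD

theorem posDef_of_fromBlocks {A : Matrix ι ι ℝ} {B : Matrix ι κ ℝ} {D : Matrix κ κ ℝ}
    (h : (fromBlocks A B Bᵀ D).PosDef) : A.PosDef :=
  h.submatrix (e := Sum.inl) Sum.inl_injective

theorem posDef_schur_of_fromBlocks {A : Matrix ι ι ℝ} {B : Matrix ι κ ℝ} {D : Matrix κ κ ℝ}
    (h : (fromBlocks A B Bᵀ D).PosDef) : (D - Bᵀ * A⁻¹ * B).PosDef := by
  have hA := posDef_of_fromBlocks h
  have hD : D.IsSymm := PosDef.isSymm (h.submatrix (e := Sum.inr) Sum.inr_injective)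
  refine posDef_iff_qf.2 ⟨hD.sub ?_, fun y hy => ?_⟩
  · simp [Matrix.IsSymm, transpose_mul, (PosDef.isSymm hA.inv).eq, Matrix.mul_assoc]
  · have h1 := qf_fromBlocks (PosDef.isSymm hA) (PosDef.det_isUnit hA) B D
      (-(A⁻¹ *ᵥ (B *ᵥ y))) y
    rw [neg_add_cancel, qf_zero_vec, zero_add] at h1
    rw [← h1]
    refine PosDef.qf_pos h fun h0 => hy ?_
    ext i
    simpa using congrFun h0 (Sum.inr i)

/-- Since A⁻¹ preserves nonnegative vectors, A⁻¹B ≤ 0 entrywise, so BᵀA⁻¹B ≥ 0 and off-diagonal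
entries only decrease. For the row sums, z = A⁻¹B1 satisfies A(z + 1) = B1 + A1 ≥ 0, the row sums of
the upper rows; hence z ≥ -1. -/
theorem isSDDM_schur_of_fromBlocks {A : Matrix ι ι ℝ} {B : Matrix ι κ ℝ} {D : Matrix κ κ ℝ}
    (h : IsSDDM (fromBlocks A B Bᵀ D)) : IsSDDM (D - Bᵀ * A⁻¹ * B) := by
  have hA := posDef_of_fromBlocks h.posDef
  have hoff : ∀ i j, i ≠ j → A i j ≤ 0 := fun i j hij =>
    h.offDiag_nonpos (Sum.inl i) (Sum.inl j) (by simpa using hij)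
  have hB : ∀ i j, B i j ≤ 0 := fun i j => h.offDiag_nonpos (Sum.inl i) (Sum.inr j) (by simp)
  have hAA : A * A⁻¹ = 1 := mul_nonsing_inv _ (PosDef.det_isUnit hA)
  refine isSDDM_of_posDef (posDef_schur_of_fromBlocks h.posDef) (fun i j hij => ?_) fun i => ?_
  · have hX : ∀ k, (A⁻¹ * B) k j ≤ 0 := fun k => by
      have := nonneg_of_mulVec_nonneg hA hoff (x := fun k => -(A⁻¹ * B) k j) (fun l => by
        have e : (A *ᵥ fun k => -(A⁻¹ * B) k j) l = -(A * (A⁻¹ * B)) l j := by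
          simp [mulVec, dotProduct, Matrix.mul_apply]
        rw [e, ← Matrix.mul_assoc, hAA, Matrix.one_mul]
        linarith [hB l j]) k
      linarith
    have h1 : D i j ≤ 0 := h.offDiag_nonpos (Sum.inr i) (Sum.inr j) (by simpa using hij)
    have h2 : 0 ≤ (Bᵀ * A⁻¹ * B) i j := by
      rw [Matrix.mul_assoc, Matrix.mul_apply]
      exact sum_nonneg fun k _ => mul_nonneg_of_nonpos_of_nonpos (hB k i) (hX k)
    rw [Matrix.sub_apply]
    linarith
  · set z : ι → ℝ := A⁻¹ *ᵥ (B *ᵥ 1) with hz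
    have hz1 : ∀ k, -1 ≤ z k := fun k => by
      have := nonneg_of_mulVec_nonneg hA hoff (x := z + 1) (fun l => by
        have e : A *ᵥ z = B *ᵥ 1 := by rw [hz, mulVec_mulVec, hAA, one_mulVec]
        rw [mulVec_add, e]
        have := h.rowSum_nonneg (Sum.inl l)
        rw [Fintype.sum_sum_type] at this
        simp only [fromBlocks_apply₁₁, fromBlocks_apply₁₂] at this
        simp only [Pi.add_apply, mulVec, dotProduct, Pi.one_apply, mul_one]
        linarith) k
      simp only [Pi.add_apply, Pi.one_apply] at this
      linarith
    have e1 : ∑ j, (D - Bᵀ * A⁻¹ * B) i j = ∑ j, D i j - ∑ k, B k i * z k := by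
      have : ∑ j, (Bᵀ * A⁻¹ * B) i j = (Bᵀ *ᵥ z) i := by
        rw [hz, mulVec_mulVec, mulVec_mulVec]
        simp [mulVec, dotProduct]
      simp only [Matrix.sub_apply, sum_sub_distrib, this]
      simp [mulVec, dotProduct]
    have e2 : ∑ k, B k i * z k ≤ ∑ k, -B k i :=
      sum_le_sum fun k _ => by nlinarith [hB k i, hz1 k]
    have := h.rowSum_nonneg (Sum.inr i)
    rw [Fintype.sum_sum_type] at this
    simp only [fromBlocks_apply₂₁, fromBlocks_apply₂₂, transpose_apply] at this
    rw [sum_neg_distrib] at e2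
    rw [e1]
    linarith

theorem IsSDDM.submatrix_equiv {A : Matrix ι ι ℝ} (h : IsSDDM A) (e : κ ≃ ι) :
    IsSDDM (A.submatrix e e) := by
  refine isSDDM_of_posDef (h.posDef.submatrix e.injective) (fun i j hij => ?_) fun i => ?_
  · exact h.offDiag_nonpos _ _ (e.injective.ne hij)
  · exact (h.rowSum_nonneg (e i)).trans_eq (Equiv.sum_comp e (fun j => A (e i) j)).symm

end Schur

/-! ### Splitting the rows into eliminated and remaining ones -/

section Split

variable {ι : Type} [DecidableEq ι]

/-- The rows of a matrix indexed by `V`, split into those in `F` and those in `V \ F`. -/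
def splitEquiv (V F : Finset ι) : {v : ↥V // (v : ι) ∈ F} ⊕ ↥(V \ F) ≃ ↥V where
  toFun := Sum.elim (fine V F) (coarse V F)
  invFun v := if h : (v : ι) ∈ F then Sum.inl ⟨v, h⟩ else Sum.inr ⟨v, mem_sdiff.2 ⟨v.2, h⟩⟩
  left_inv := by
    rintro (v | v)
    · simp [fine, v.2]
    · have := (mem_sdiff.1 v.2).2
      simp [coarse, this]
  right_inv v := by
    by_cases h : (v : ι) ∈ F <;> simp [h, fine, coarse]

theorem submatrix_splitEquiv {V : Finset ι} {M : Matrix V V ℝ} (hM : M.IsSymm) (F : Finset ι) :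
    M.submatrix (splitEquiv V F) (splitEquiv V F) =
      fromBlocks (blockFF M F) (M.submatrix (fine V F) (coarse V F))
        (M.submatrix (fine V F) (coarse V F))ᵀ (M.submatrix (coarse V F) (coarse V F)) := by
  ext (i | i) (j | j)
  · rfl
  · rfl
  · exact hM.apply _ _
  · rfl

theorem schur_eq {V : Finset ι} {M : Matrix V V ℝ} (hM : M.IsSymm) (F : Finset ι) :
    schur M F = M.submatrix (coarse V F) (coarse V F) -
      (M.submatrix (fine V F) (coarse V F))ᵀ * (blockFF M F)⁻¹ *
        M.submatrix (fine V F) (coarse V F) := by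
  rw [schur, transpose_submatrix, hM.eq]

theorem IsSDDM.schur {V : Finset ι} {M : Matrix V V ℝ} (hM : IsSDDM M) (F : Finset ι) :
    IsSDDM (schur M F) := by
  rw [schur_eq hM.symm]
  apply isSDDM_schur_of_fromBlocks
  rw [← submatrix_splitEquiv hM.symm]
  exact hM.submatrix_equiv _

theorem IsSDDM.exists_stronglyDD {V : Finset ι} {M : Matrix V V ℝ} (hM : IsSDDM M) :
    ∃ F ⊆ V, #V ≤ 5 * #F ∧ IsStronglyDD 4 (blockFF M F) := by
  obtain ⟨F, hc, hF⟩ := hM.exists_large_block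
  refine ⟨F.map (Function.Embedding.subtype _), fun i hi => ?_, by simpa using hc, ?_, ?_⟩
  · obtain ⟨v, -, rfl⟩ := mem_map.1 hi
    exact v.2
  · exact hM.symm.submatrix _
  · rintro ⟨i, hi⟩
    have hmem : ∀ v : ↥V, (v : ι) ∈ F.map (Function.Embedding.subtype _) ↔ v ∈ F := fun v => by
      simp
    have h := hF i ((hmem i).1 hi)
    have hsum : ∑ v ∈ univ.erase ⟨i, hi⟩,
        |blockFF M (F.map (Function.Embedding.subtype _)) ⟨i, hi⟩ v| =
          ∑ j ∈ F.erase i, |M i j| := ?_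
    · rw [hsum]; norm_num; exact h
    refine sum_bij (fun v _ => v.1) (fun v hv => ?_) (fun v _ w _ h => Subtype.ext h)
      (fun v hv => ?_) fun v _ => rfl
    · refine mem_erase.2 ⟨fun h => (ne_of_mem_erase hv) (Subtype.ext h), (hmem v.1).1 v.2⟩
    · refine ⟨⟨v, (hmem v).2 (mem_of_mem_erase hv)⟩, mem_erase.2 ⟨fun h => ?_, mem_univ _⟩, rfl⟩
      exact ne_of_mem_erase hv (congrArg Subtype.val h)

end Split

/-! ### Existence of good chains -/

section Existence

variable {n : ℕ}

/-- The principal submatrix with rows in `V`. -/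
def restrict (N : Matrix (Fin n) (Fin n) ℝ) (V : Finset (Fin n)) : Matrix V V ℝ :=
  N.submatrix Subtype.val Subtype.val

/-- Extension by zero lets all levels be stored as matrices on `Fin n`, so the recursion runs in a
fixed type. -/
theorem exists_restrict_eq {V : Finset (Fin n)} (B : Matrix V V ℝ) :
    ∃ N : Matrix (Fin n) (Fin n) ℝ, restrict N V = B :=
  ⟨fun i j => if h : i ∈ V ∧ j ∈ V then B ⟨i, h.1⟩ ⟨j, h.2⟩ else 0, by
    ext i j
    exact dif_pos ⟨i.2, j.2⟩⟩

/-- A set of rows and a matrix that is SDDM on those rows. -/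
abbrev ChainState (n : ℕ) : Type :=
  {p : Finset (Fin n) × Matrix (Fin n) (Fin n) ℝ // IsSDDM (restrict p.2 p.1)}

/-- One level of the greedy construction. The approximation is stated on `st.1.1 \ F` rather than on
the equal set `st'.1.1` so that its type matches that of the Schur complement. -/
theorem ChainState.exists_next (st : ChainState n) {ε : ℝ} (h0 : 0 < ε) (h1 : ε ≤ 1) :
    ∃ (F : Finset (Fin n)) (st' : ChainState n), F ⊆ st.1.1 ∧ st'.1.1 = st.1.1 \ F ∧
      #st.1.1 ≤ 5 * #F ∧ IsStronglyDD 4 (blockFF (restrict st.1.2 st.1.1) F) ∧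
      Approx ε (restrict st'.1.2 (st.1.1 \ F)) (schur (restrict st.1.2 st.1.1) F) ∧
      (nnz (restrict st'.1.2 st'.1.1) : ℝ) ≤ 801 * #st'.1.1 / ε ^ 2 := by
  obtain ⟨F, hFV, hc, hdd⟩ := st.2.exists_stronglyDD
  obtain ⟨B, hB, hap, hn⟩ := (st.2.schur F).exists_approx h0 h1
  obtain ⟨N, hN⟩ := exists_restrict_eq B
  exact ⟨F, ⟨(st.1.1 \ F, N), by rwa [hN]⟩, hFV, rfl, hc, hdd, by simpa only [hN] using hap,
    by simpa only [hN, Fintype.card_coe] using hn⟩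

/-- The errors of the chain. -/
noncomputable def chainError (i : ℕ) : ℝ := 1 / (2 * (i + 1) * (i + 2))

theorem chainError_pos (i : ℕ) : 0 < chainError i := by unfold chainError; positivity

theorem chainError_le (i : ℕ) : chainError i ≤ 1 / 4 := by
  unfold chainError
  have : (0 : ℝ) ≤ i := Nat.cast_nonneg i
  exact one_div_le_one_div_of_le (by norm_num) (by nlinarith)

/-- The sum telescopes. Its total below 1/2 is what a 1-chain requires, for any length d. -/
theorem sum_chainError (d : ℕ) : ∑ i ∈ range d, chainError i = 1 / 2 - 1 / (2 * (d + 1)) := by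
  induction d with
  | zero => simp
  | succ d ih =>
    rw [sum_range_succ, ih, chainError]
    have h1 : (d : ℝ) + 1 ≠ 0 := by positivity
    have h2 : (d : ℝ) + 2 ≠ 0 := by positivity
    have h3 : (d : ℝ) + 1 + 1 ≠ 0 := by positivity
    push_cast
    field_simp
    ring

theorem chainError_inv (i : ℕ) : (chainError i)⁻¹ = 2 * (i + 1) * (i + 2) := by
  simp [chainError]

theorem one_le_log_four : (1 : ℝ) ≤ Real.log 4 := by
  rw [Real.le_log_iff_exp_le (by norm_num)]
  linarith [Real.exp_one_lt_d9]

theorem logb_four_le {x : ℝ} (hx : 1 ≤ x) : Real.logb 4 x ≤ Real.log x := by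
  have := one_le_log_four
  exact div_le_self (Real.log_nonneg hx) this

theorem one_le_chainError_inv (i : ℕ) : 1 ≤ (chainError i)⁻¹ := by
  have := chainError_le i
  exact (one_le_inv₀ (chainError_pos i)).2 (by linarith)

theorem one_le_logb_chainError (i : ℕ) : 1 ≤ Real.logb 4 (chainError i)⁻¹ := by
  rw [Real.le_logb_iff_rpow_le (by norm_num) (inv_pos.2 (chainError_pos i)), Real.rpow_one,
    chainError_inv]
  have : (0 : ℝ) ≤ i := Nat.cast_nonneg i
  nlinarith

/-- A chain of arbitrary length whose errors are summable and whose sizes decrease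
geometrically. -/
theorem exists_chain {A : Matrix (Fin n) (Fin n) ℝ} (hA : IsSDDM A) (d : ℕ) (hd : 1 ≤ d) {s : ℕ}
    (hs : (4 / 5 : ℝ) ^ (d - 1) * n ≤ s) :
    ∃ (σ : ChainShape n) (M : ChainMatrices σ), σ.d = d ∧ (∀ i, σ.α i = 4) ∧
      σ.ε = chainError ∧ IsVertexSparsifierChain s A σ M ∧
      ∀ i, (nnz (M (i + 1)) : ℝ) ≤ 801 * ((4 / 5 : ℝ) ^ i * n) / chainError i ^ 2 := by
  have hε1 : ∀ i, chainError i ≤ 1 := fun i => (chainError_le i).trans (by norm_num)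
  obtain ⟨B, hB, hBA, hBn⟩ := hA.exists_approx (chainError_pos 0) (hε1 0)
  have hBs : IsSDDM (restrict B univ) :=
    hB.submatrix_equiv (Equiv.subtypeUnivEquiv (p := fun x => x ∈ univ) mem_univ)
  choose F next hF hV hcard hdd hap hnnz using fun (i : ℕ) (st : ChainState n) =>
    st.exists_next (chainError_pos (i + 1)) (hε1 (i + 1))
  set seq : ℕ → ChainState n := fun i => Nat.rec ⟨(univ, B), hBs⟩ next i with hseq
  have hsucc : ∀ i, seq (i + 1) = next i (seq i) := fun i => rfl
  -- State i of the sequence is matrix i + 1 of the chain; the truncated value at index 0 is never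
  -- used.
  set σ : ChainShape n := ⟨d, fun i => F (i - 1) (seq (i - 1)), fun _ => 4, chainError⟩ with hσ
  have hvert : ∀ i, σ.vertices (i + 1) = (seq i).1.1 := fun i => by
    induction i with
    | zero => rfl
    | succ i ih =>
      rw [hsucc, hV, ← ih]
      rfl
  have hcardV : ∀ i, (#(seq i).1.1 : ℝ) ≤ (4 / 5 : ℝ) ^ i * n := fun i => by
    induction i with
    | zero => simp [hseq]
    | succ i ih =>
      rw [hsucc, hV, card_sdiff_of_subset (hF i _), Nat.cast_sub (card_le_card (hF i _)), pow_succ]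
      have : (#(seq i).1.1 : ℝ) ≤ 5 * #(F i (seq i)) := by exact_mod_cast hcard i (seq i)
      linarith
  have hn : ∀ i, (nnz (restrict (seq i).1.2 (seq i).1.1) : ℝ) ≤
      801 * #(seq i).1.1 / chainError i ^ 2 := fun i => by
    cases i with
    | zero =>
      have : nnz (restrict B univ) = nnz B := by
        refine card_bij (fun p _ => (p.1.1, p.2.1)) (fun p hp => ?_) (fun p _ q _ h => ?_)
          fun p hp => ⟨(⟨p.1, mem_univ _⟩, ⟨p.2, mem_univ _⟩), ?_, rfl⟩
        · exact mem_filter.2 ⟨mem_univ _, (mem_filter.1 hp).2⟩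
        · exact Prod.ext (Subtype.ext (congrArg Prod.fst h)) (Subtype.ext (congrArg Prod.snd h))
        · exact mem_filter.2 ⟨mem_univ _, (mem_filter.1 hp).2⟩
      change (nnz (restrict B univ) : ℝ) ≤ 801 * #(univ : Finset (Fin n)) / chainError 0 ^ 2
      rwa [this]
    | succ i => exact hnnz i (seq i)
  -- The restriction is to `σ.vertices i`, as the type of a chain demands; rewriting with `hvert`
  -- then turns each condition into a fact about the sequence.
  refine ⟨σ, fun i => restrict (seq (i - 1)).1.2 (σ.vertices i), rfl, fun _ => rfl, rfl, ?_,
    fun i => ?_⟩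
  · refine ⟨hA, hd, fun _ _ _ => le_rfl, fun i _ => chainError_pos i,
      fun i _ => (chainError_le i).trans (by norm_num), fun i h1 _ => ?_, fun i h1 _ => ?_, hBA,
      fun i _ => ?_, fun i h1 _ => ?_, ?_⟩
    · obtain ⟨i, rfl⟩ := Nat.exists_eq_add_of_le' h1
      rw [hvert]
      exact (seq i).2
    · obtain ⟨i, rfl⟩ := Nat.exists_eq_add_of_le' h1
      rw [hvert]
      exact hF i _
    · change Approx (chainError (i + 1)) (restrict (seq (i + 1)).1.2
        (σ.vertices (i + 1) \ F i (seq i)))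
        (schur (restrict (seq i).1.2 (σ.vertices (i + 1))) (F i (seq i)))
      rw [hvert]
      exact hap i (seq i)
    · obtain ⟨i, rfl⟩ := Nat.exists_eq_add_of_le' h1
      change IsStronglyDD 4 (blockFF (restrict (seq i).1.2 (σ.vertices (i + 1))) (F i (seq i)))
      rw [hvert]
      exact hdd i _
    · change #(σ.vertices d) ≤ s
      obtain ⟨i, rfl⟩ := Nat.exists_eq_add_of_le' hd
      rw [hvert]
      have := (hcardV i).trans hs
      exact_mod_cast this
  · change (nnz (restrict (seq i).1.2 (σ.vertices (i + 1))) : ℝ) ≤ _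
    rw [hvert]
    refine (hn i).trans ?_
    have := chainError_pos i
    gcongr
    exact hcardV i

/-- Bounds the work per row: two factors of the cube dominate the ε⁻² of the sparsifier, the third
dominates log ε⁻¹ for the next error. -/
theorem summable_chain_work :
    Summable fun i : ℕ => (4 / 5 : ℝ) ^ i * (2 * (i + 2) * (i + 3)) ^ 3 := by
  have h := (summable_nat_add_iff 3).2
    (summable_pow_mul_geometric_of_norm_lt_one 6 (r := (4 / 5 : ℝ)) (by norm_num))
  refine Summable.of_nonneg_of_le (fun i => by positivity) (fun i => ?_)
    (h.mul_left (8 * (5 / 4) ^ 3))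
  have hi : (0 : ℝ) ≤ i := Nat.cast_nonneg i
  have h1 : (2 * ((i : ℝ) + 2) * (i + 3)) ^ 3 ≤ (2 * (i + 3) * (i + 3)) ^ 3 := by
    gcongr; norm_num
  calc (4 / 5 : ℝ) ^ i * (2 * (i + 2) * (i + 3)) ^ 3
      ≤ (4 / 5 : ℝ) ^ i * (2 * (i + 3) * (i + 3)) ^ 3 := by gcongr
    _ = _ := by push_cast; ring

/-- The product of the number of levels, log n, and a logarithm of a quadratic polynomial in the
number of levels. The last factor is the source of log log n. -/
theorem chain_depth_bound (n : ℕ) :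
    (⌈Real.log n / Real.log (5 / 4)⌉₊ : ℝ) * (Real.log n *
      Real.log (2 * (⌈Real.log n / Real.log (5 / 4)⌉₊ + 1) *
        (⌈Real.log n / Real.log (5 / 4)⌉₊ + 2))) ≤
      7 * (Real.log 242 + 2) * (lg n ^ 2 * lg (Real.log n)) := by
  have hlgn : 1 ≤ lg n := le_max_left _ _
  have hlgl : 1 ≤ lg (Real.log n) := le_max_left _ _
  have h242 : 0 ≤ Real.log 242 := Real.log_nonneg (by norm_num)
  rcases Nat.lt_or_ge n 2 with hn | hn
  · have : Real.log n = 0 := by interval_cases n <;> simp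
    rw [this]
    simp only [zero_div, Nat.ceil_zero, CharP.cast_eq_zero, zero_mul]
    rw [this] at hlgl
    positivity
  · set L := Real.log n with hL
    have hL2 : 1 / 2 ≤ L := by
      have : Real.log 2 ≤ L := Real.log_le_log two_pos (by exact_mod_cast hn)
      linarith [Real.log_two_gt_d9]
    have hLpos : 0 < L := by linarith
    have h54 : (1 / 5 : ℝ) ≤ Real.log (5 / 4) := by
      have := Real.one_sub_inv_le_log_of_pos (x := 5 / 4) (by norm_num)
      norm_num at this ⊢
      linarith
    have hdiv : L / Real.log (5 / 4) ≤ 5 * L := by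
      rw [div_le_iff₀ (by linarith)]; nlinarith
    set k : ℝ := (⌈L / Real.log (5 / 4)⌉₊ : ℝ) with hk
    have hk0 : 0 ≤ k := Nat.cast_nonneg _
    have hk1 : k ≤ 5 * L + 1 := by
      have := (Nat.ceil_lt_add_one (a := L / Real.log (5 / 4))
        (div_nonneg hLpos.le (by linarith))).le
      linarith
    have hlog : Real.log (2 * (k + 1) * (k + 2)) ≤ (Real.log 242 + 2) * lg L := by
      -- As k ≤ 5L + 1 and L ≥ 1/2, both factors are at most 11L, and 242 = 2 · 11².
      have h1 : 2 * (k + 1) * (k + 2) ≤ 242 * L ^ 2 := by nlinarith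
      calc Real.log (2 * (k + 1) * (k + 2)) ≤ Real.log (242 * L ^ 2) :=
            Real.log_le_log (by positivity) h1
        _ = Real.log 242 + 2 * Real.log L := by
            rw [Real.log_mul (by norm_num) (by positivity), Real.log_pow]; norm_num
        _ ≤ _ := by
            have h3 : Real.log L ≤ lg L := le_max_right _ _
            nlinarith
    have hlgL : L ≤ lg n := le_max_right _ _
    have hk7 : k ≤ 7 * L := by linarith
    have hc : 0 ≤ (Real.log 242 + 2) * lg L := by positivity
    calc k * (L * Real.log (2 * (k + 1) * (k + 2)))
        ≤ k * (L * ((Real.log 242 + 2) * lg L)) := by gcongr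
      _ ≤ 7 * lg n * (lg n * ((Real.log 242 + 2) * lg L)) := by
          gcongr
          linarith
      _ = _ := by ring

/-- Every SDDM matrix has a good chain. -/
theorem exists_good_chain : ∃ (s : ℕ) (κ c₁ c₂ : ℝ), 0 < κ ∧
    ∀ (n : ℕ) (A : Matrix (Fin n) (Fin n) ℝ), IsSDDM A →
      ∃ (σ : ChainShape n) (M : ChainMatrices σ),
        IsVertexSparsifierChainWith 1 (c₁ * (lg n ^ 2 * lg (Real.log n))) (c₂ * n) s A σ M ∧
        ∀ i, 1 ≤ i → i < σ.d → κ ≤ Real.logb (σ.α i) (σ.ε i)⁻¹ := by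
  refine ⟨1, 1, 7 * (Real.log 242 + 2),
    801 * ∑' i : ℕ, (4 / 5 : ℝ) ^ i * (2 * (i + 2) * (i + 3)) ^ 3, one_pos, fun n A hA => ?_⟩
  set k := ⌈Real.log n / Real.log (5 / 4)⌉₊ with hk
  have hlog54 : 0 < Real.log (5 / 4) := Real.log_pos (by norm_num)
  have hsize : (4 / 5 : ℝ) ^ (k + 1 - 1) * n ≤ (1 : ℕ) := by
    rw [Nat.add_sub_cancel]
    rcases Nat.eq_zero_or_pos n with rfl | hn
    · simp
    have hn' : (0 : ℝ) < n := by exact_mod_cast hn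
    have h1 : Real.log n ≤ Real.log ((5 / 4 : ℝ) ^ k) := by
      rw [Real.log_pow, ← div_le_iff₀ hlog54]
      exact Nat.le_ceil _
    have h2 : (n : ℝ) ≤ (5 / 4 : ℝ) ^ k := (Real.log_le_log_iff hn' (by positivity)).1 h1
    calc (4 / 5 : ℝ) ^ k * n ≤ (4 / 5 : ℝ) ^ k * (5 / 4 : ℝ) ^ k := by gcongr
      _ = (1 : ℕ) := by rw [← mul_pow]; norm_num
  obtain ⟨σ, M, hd, hα, hε, hchain, hn⟩ := exists_chain hA (k + 1) (by omega) hsize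
  refine ⟨σ, M, ⟨hchain, ?_, ?_, ?_⟩, fun i _ _ => ?_⟩
  · rw [hε, sum_chainError]
    have : 0 ≤ 1 / (2 * ((σ.d : ℝ) + 1)) := by positivity
    linarith
  · rw [chainWork, hd, sum_Ico_eq_sum_range]
    simp only [hα, hε]
    refine (sum_le_sum (g := fun i : ℕ => 801 * ((4 / 5 : ℝ) ^ i *
      (2 * (i + 2) * (i + 3)) ^ 3) * n) fun i _ => ?_).trans ?_
    · have h1 := hn i
      have h2 : Real.logb 4 (chainError (1 + i))⁻¹ ≤ 2 * (i + 2) * (i + 3) := by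
        refine (logb_four_le (one_le_chainError_inv _)).trans
          ((Real.log_le_self (inv_nonneg.2 (chainError_pos _).le)).trans_eq ?_)
        rw [chainError_inv]; push_cast; ring
      have h0 : 0 ≤ Real.logb 4 (chainError (1 + i))⁻¹ :=
        zero_le_one.trans (one_le_logb_chainError _)
      rw [add_comm 1 i] at h2 h0 ⊢
      calc (nnz (M (i + 1)) : ℝ) * Real.logb 4 (chainError (i + 1))⁻¹
          ≤ 801 * ((4 / 5 : ℝ) ^ i * n) / chainError i ^ 2 * (2 * (i + 2) * (i + 3)) := by
            gcongr
        _ = 801 * ((4 / 5 : ℝ) ^ i * n) * ((2 * (i + 1) * (i + 2)) ^ 2 *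
              (2 * (i + 2) * (i + 3))) := by
            rw [div_eq_mul_inv, ← inv_pow, chainError_inv]; ring
        _ ≤ 801 * ((4 / 5 : ℝ) ^ i * n) * ((2 * (i + 2) * (i + 3)) ^ 2 *
              (2 * (i + 2) * (i + 3))) := by
            gcongr <;> norm_num
        _ = _ := by ring
    · rw [← sum_mul, ← mul_sum]
      gcongr
      exact summable_chain_work.sum_le_tsum _ fun i _ => by positivity
  · rw [chainDepth, hd]
    refine le_trans ?_ (chain_depth_bound n)
    simp only [hα, hε]
    have hlogn : 0 ≤ Real.log n := Real.log_natCast_nonneg n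
    refine (sum_le_card_nsmul _ _ (Real.log n * Real.log (2 * ((k : ℝ) + 1) * (k + 2)))
      fun i hi => ?_).trans_eq ?_
    · refine mul_le_mul_of_nonneg_left ?_ hlogn
      refine (logb_four_le (one_le_chainError_inv i)).trans ?_
      have hik : (i : ℝ) ≤ k := by exact_mod_cast (Nat.lt_succ_iff.1 (mem_Ico.1 hi).2)
      rw [chainError_inv]
      refine Real.log_le_log (by positivity) (by gcongr)
    · simp [← hk]
  · rw [hα, hε]
    exact one_le_logb_chainError i

end Existence

/-! ### Building circuits

`Ω` is a set of instances on which a circuit has to work, and `inp ω` are the inputs of the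
instance `ω`. Circuits are described by the functions `Ω → ℝ` that they compute. -/

section Circuits

variable {I Ω : Type} (inp : Ω → I → ℝ)

/-- The function `f` is the value of an operand of depth at most `D`. -/
def Avail {k : ℕ} (g : Gates I k) (D : ℕ) (f : Ω → ℝ) : Prop :=
  ∃ o : Operand I k, (∀ ω, o.eval (inp ω) (g.eval (inp ω)) = f ω) ∧ o.depth g.depths ≤ D

/-- Given the functions in `S`, those in `T` can be computed by `w` gates in additional depth
`δ`. -/
def Reach (w δ : ℕ) (S T : Set (Ω → ℝ)) : Prop :=
  ∀ (k : ℕ) (g : Gates I k) (D : ℕ), (∀ ω, g.Defined (inp ω)) → (∀ f ∈ S, Avail inp g D f) →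
    ∃ (k' : ℕ) (g' : Gates I k'), k' ≤ k + w ∧ (∀ ω, g'.Defined (inp ω)) ∧
      (∀ E f, Avail inp g E f → Avail inp g' E f) ∧ (∀ f ∈ T, Avail inp g' (D + δ) f) ∧
      ∀ B, D + δ ≤ B → (∀ j, g.depths j ≤ B) → ∀ j, g'.depths j ≤ B

/-- The inputs and the rational constants. -/
def Free : Set (Ω → ℝ) :=
  Set.range (fun i ω => inp ω i) ∪ Set.range fun (q : ℚ) _ => (q : ℝ)

theorem input_mem_free (i : I) : (fun ω => inp ω i) ∈ Free inp := Or.inl ⟨i, rfl⟩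

theorem const_mem_free (q : ℚ) : (fun _ => (q : ℝ)) ∈ Free inp := Or.inr ⟨q, rfl⟩

theorem zero_mem_free : (fun _ => (0 : ℝ)) ∈ Free inp := by
  simpa using const_mem_free inp 0

theorem one_mem_free : (fun _ => (1 : ℝ)) ∈ Free inp := by
  simpa using const_mem_free inp 1

variable {inp}

theorem Avail.mono {k : ℕ} {g : Gates I k} {D D' : ℕ} {f : Ω → ℝ} (h : Avail inp g D f)
    (hD : D ≤ D') : Avail inp g D' f := by
  obtain ⟨o, h1, h2⟩ := h
  exact ⟨o, h1, h2.trans hD⟩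

theorem avail_of_mem_free {k : ℕ} (g : Gates I k) (D : ℕ) {f : Ω → ℝ} (h : f ∈ Free inp) :
    Avail inp g D f := by
  rcases h with ⟨i, rfl⟩ | ⟨q, rfl⟩
  · exact ⟨.input i, fun _ => rfl, Nat.zero_le _⟩
  · exact ⟨.const q, fun _ => rfl, Nat.zero_le _⟩

theorem Reach.mono {w w' δ δ' : ℕ} {S S' T T' : Set (Ω → ℝ)} (h : Reach inp w δ S T)
    (hw : w ≤ w') (hδ : δ ≤ δ') (hS : S ⊆ S') (hT : T' ⊆ T) : Reach inp w' δ' S' T' := by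
  intro k g D hg hA
  obtain ⟨k', g', h1, h2, h3, h4, h5⟩ := h k g D hg fun f hf => hA f (hS hf)
  exact ⟨k', g', by omega, h2, h3, fun f hf => (h4 f (hT hf)).mono (by omega),
    fun B hB => h5 B (by omega)⟩

theorem Reach.mono_cost {w w' δ δ' : ℕ} {S T : Set (Ω → ℝ)} (h : Reach inp w δ S T)
    (hw : w ≤ w') (hδ : δ ≤ δ') : Reach inp w' δ' S T :=
  h.mono hw hδ subset_rfl subset_rfl

theorem reach_of_subset {S T : Set (Ω → ℝ)} (h : T ⊆ S) (w δ : ℕ) : Reach inp w δ S T := by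
  intro k g D hg hA
  exact ⟨k, g, by omega, hg, fun _ _ h => h, fun f hf => (hA f (h hf)).mono (by omega),
    fun _ _ h => h⟩

/-- Gates are only appended and earlier values keep their depth, so sequential composition adds work
and depth and may reuse S. -/
theorem Reach.trans {w w' δ δ' : ℕ} {S T U : Set (Ω → ℝ)} (h : Reach inp w δ S T)
    (h' : Reach inp w' δ' (S ∪ T) U) : Reach inp (w + w') (δ + δ') S U := by
  intro k g D hg hA
  obtain ⟨k₁, g₁, h1, h2, h3, h4, h5⟩ := h k g D hg hA
  obtain ⟨k₂, g₂, h1', h2', h3', h4', h5'⟩ := h' k₁ g₁ (D + δ) h2 (by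
    rintro f (hf | hf)
    · exact (h3 _ _ (hA f hf)).mono (by omega)
    · exact h4 f hf)
  exact ⟨k₂, g₂, by omega, h2', fun E f hf => h3' _ _ (h3 _ _ hf),
    fun f hf => (h4' f hf).mono (by omega),
    fun B hB hB' => h5' B (by omega) (h5 B (by omega) hB')⟩

/-- Parallel composition: the second part starts from S at its original depth, so only the work adds
up. -/
theorem Reach.union {w w' δ : ℕ} {S T T' : Set (Ω → ℝ)} (h : Reach inp w δ S T)
    (h' : Reach inp w' δ S T') : Reach inp (w + w') δ S (T ∪ T') := by
  intro k g D hg hA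
  obtain ⟨k₁, g₁, h1, h2, h3, h4, h5⟩ := h k g D hg hA
  obtain ⟨k₂, g₂, h1', h2', h3', h4', h5'⟩ := h' k₁ g₁ D h2 fun f hf => h3 _ _ (hA f hf)
  refine ⟨k₂, g₂, by omega, h2', fun E f hf => h3' _ _ (h3 _ _ hf), ?_,
    fun B hB hB' => h5' B hB (h5 B hB hB')⟩
  rintro f (hf | hf)
  · exact h3' _ _ (h4 f hf)
  · exact h4' f hf

theorem reach_biUnion {J : Type} (s : Finset J) {w : J → ℕ} {δ : ℕ} {S : Set (Ω → ℝ)}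
    {T : J → Set (Ω → ℝ)} (h : ∀ j ∈ s, Reach inp (w j) δ S (T j)) :
    Reach inp (∑ j ∈ s, w j) δ S (⋃ j ∈ s, T j) := by
  classical
  induction s using Finset.induction_on with
  | empty => exact reach_of_subset (by simp) _ _
  | insert a s ha ih =>
    rw [sum_insert ha, set_biUnion_insert]
    exact (h a (mem_insert_self a s)).union (ih fun j hj => h j (mem_insert_of_mem hj))

theorem reach_range {J : Type} [Fintype J] {w : J → ℕ} {δ : ℕ} {S : Set (Ω → ℝ)}
    {f : J → Ω → ℝ} (h : ∀ j, Reach inp (w j) δ S {f j}) :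
    Reach inp (∑ j, w j) δ S (Set.range f) := by
  refine (reach_biUnion univ fun j _ => h j).mono le_rfl le_rfl subset_rfl ?_
  rintro _ ⟨j, rfl⟩
  simp

theorem reach_op (op : ArithOp) {S : Set (Ω → ℝ)} {a b : Ω → ℝ} (ha : a ∈ S) (hb : b ∈ S)
    (hdiv : op = ArithOp.div → ∀ ω, b ω ≠ 0) :
    Reach inp 1 1 S {fun ω => op.eval (a ω) (b ω)} := by
  intro k g D hg hA
  obtain ⟨o, ho, ho'⟩ := hA a ha
  obtain ⟨p, hp, hp'⟩ := hA b hb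
  refine ⟨k + 1, .snoc g op o p, le_rfl, fun ω => ⟨hg ω, fun h => ?_⟩, ?_, ?_, ?_⟩
  · rw [hp]; exact hdiv h ω
  · rintro E f ⟨q, hq, hq'⟩
    cases q with
    | input i => exact ⟨.input i, hq, hq'⟩
    | const c => exact ⟨.const c, hq, hq'⟩
    | gate j =>
      refine ⟨.gate j.castSucc, fun ω => ?_, ?_⟩
      · rw [← hq ω]
        simp [Operand.eval, Gates.eval]
      · simpa [Operand.depth, Gates.depths] using hq'
  · rintro f rfl
    refine ⟨.gate (Fin.last k), fun ω => ?_, ?_⟩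
    · change (Gates.snoc g op o p).eval (inp ω) (Fin.last k) = _
      simp only [Gates.eval, Fin.snoc_last, ho, hp]
    · change (Gates.snoc g op o p).depths (Fin.last k) ≤ _
      simp only [Gates.depths, Fin.snoc_last]
      omega
  · intro B hB hB' j
    refine Fin.lastCases ?_ (fun j => ?_) j
    · simp only [Gates.depths, Fin.snoc_last]
      omega
    · simpa [Gates.depths] using hB' j

theorem reach_add {S : Set (Ω → ℝ)} {a b : Ω → ℝ} (ha : a ∈ S) (hb : b ∈ S) :
    Reach inp 1 1 S {fun ω => a ω + b ω} := reach_op .add ha hb nofun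

theorem reach_sub {S : Set (Ω → ℝ)} {a b : Ω → ℝ} (ha : a ∈ S) (hb : b ∈ S) :
    Reach inp 1 1 S {fun ω => a ω - b ω} := reach_op .sub ha hb nofun

theorem reach_mul {S : Set (Ω → ℝ)} {a b : Ω → ℝ} (ha : a ∈ S) (hb : b ∈ S) :
    Reach inp 1 1 S {fun ω => a ω * b ω} := reach_op .mul ha hb nofun

theorem reach_div {S : Set (Ω → ℝ)} {a b : Ω → ℝ} (ha : a ∈ S) (hb : b ∈ S)
    (h : ∀ ω, b ω ≠ 0) : Reach inp 1 1 S {fun ω => a ω / b ω} := reach_op .div ha hb fun _ => h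

/-- Summation along a balanced binary tree. -/
theorem reach_sum {J : Type} {S : Set (Ω → ℝ)} (hS : Free inp ⊆ S) {f : J → Ω → ℝ} (r : ℕ) :
    ∀ s : Finset J, (∀ j ∈ s, f j ∈ S) → #s ≤ 2 ^ r →
      Reach inp (#s - 1) r S {fun ω => ∑ j ∈ s, f j ω} := by
  classical
  induction r with
  | zero =>
    intro s hs hc
    refine reach_of_subset ?_ _ _
    rw [Set.singleton_subset_iff]
    rcases Nat.lt_or_ge 0 #s with h | h
    · obtain ⟨j, rfl⟩ := card_eq_one.1 (le_antisymm hc h)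
      simpa using hs j
    · obtain rfl := card_eq_zero.1 (Nat.le_zero.1 h)
      simpa using hS (zero_mem_free inp)
  | succ r ih =>
    intro s hs hc
    by_cases h0 : #s ≤ 1
    · exact (ih s hs (h0.trans Nat.one_le_two_pow)).mono_cost le_rfl (Nat.le_succ r)
    -- Split into two nonempty halves; their additions plus one make #s - 1.
    obtain ⟨t, hts, ht⟩ := exists_subset_card_eq (s := s) (n := #s / 2) (by omega)
    have hpow : 2 ^ (r + 1) = 2 * 2 ^ r := by ring
    have hcard : #(s \ t) = #s - #s / 2 := by rw [card_sdiff_of_subset hts, ht]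
    have h1 := ih t (fun j hj => hs j (hts hj)) (by omega)
    have h2 := ih (s \ t) (fun j hj => hs j (mem_sdiff.1 hj).1) (by omega)
    have h3 := (h1.union h2).trans (reach_add
      (a := fun ω => ∑ j ∈ t, f j ω) (b := fun ω => ∑ j ∈ s \ t, f j ω)
      (Or.inr (Or.inl rfl)) (Or.inr (Or.inr rfl)))
    refine h3.mono (by omega) le_rfl subset_rfl ?_
    rw [Set.singleton_subset_iff, Set.mem_singleton_iff]
    funext ω
    rw [add_comm, sum_sdiff hts]

/-- A product in sequence is enough, being needed only for determinants of bounded size. -/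
theorem reach_prod {J : Type} {S : Set (Ω → ℝ)} (hS : Free inp ⊆ S) {f : J → Ω → ℝ}
    (s : Finset J) (hs : ∀ j ∈ s, f j ∈ S) :
    Reach inp (#s) (#s) S {fun ω => ∏ j ∈ s, f j ω} := by
  classical
  induction s using Finset.induction_on with
  | empty =>
    refine reach_of_subset ?_ _ _
    simpa using hS (one_mem_free inp)
  | insert a s ha ih =>
    rw [card_insert_of_notMem ha]
    simp only [prod_insert ha]
    exact (ih fun j hj => hs j (mem_insert_of_mem hj)).trans
      (reach_mul (Or.inl (hs a (mem_insert_self a s))) (Or.inr rfl))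

/-! ### Vector operations and sparse matrix-vector products -/

section Vectors

variable {J K : Type} [Fintype J] [Fintype K]

theorem reach_vec_add {S : Set (Ω → ℝ)} {x y : J → Ω → ℝ} (hx : Set.range x ⊆ S)
    (hy : Set.range y ⊆ S) : Reach inp (Fintype.card J) 1 S (Set.range fun j ω => x j ω + y j ω) := by
  simpa using reach_range fun j => reach_add (hx ⟨j, rfl⟩) (hy ⟨j, rfl⟩)

theorem reach_vec_sub {S : Set (Ω → ℝ)} {x y : J → Ω → ℝ} (hx : Set.range x ⊆ S)
    (hy : Set.range y ⊆ S) : Reach inp (Fintype.card J) 1 S (Set.range fun j ω => x j ω - y j ω) := by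
  simpa using reach_range fun j => reach_sub (hx ⟨j, rfl⟩) (hy ⟨j, rfl⟩)

theorem reach_vec_div {S : Set (Ω → ℝ)} {x y : J → Ω → ℝ} (hx : Set.range x ⊆ S)
    (hy : Set.range y ⊆ S) (h : ∀ j ω, y j ω ≠ 0) :
    Reach inp (Fintype.card J) 1 S (Set.range fun j ω => x j ω / y j ω) := by
  simpa using reach_range fun j => reach_div (hx ⟨j, rfl⟩) (hy ⟨j, rfl⟩) (h j)

theorem reach_vec_smul {S : Set (Ω → ℝ)} (hS : Free inp ⊆ S) (q : ℚ) {x : J → Ω → ℝ}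
    (hx : Set.range x ⊆ S) :
    Reach inp (Fintype.card J) 1 S (Set.range fun j ω => (q : ℝ) * x j ω) := by
  simpa using reach_range fun j => reach_mul (hS (const_mem_free inp q)) (hx ⟨j, rfl⟩)

/-- Row sums of a sparse matrix. -/
theorem reach_rowSum {S : Set (Ω → ℝ)} (hS : Free inp ⊆ S) {M : Ω → Matrix J K ℝ}
    (P : Finset (J × K)) (hP : ∀ p ∈ P, (fun ω => M ω p.1 p.2) ∈ S)
    (hP0 : ∀ ω j k, (j, k) ∉ P → M ω j k = 0) {r : ℕ} (hr : Fintype.card K ≤ 2 ^ r) :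
    Reach inp (#P) r S (Set.range fun j ω => ∑ k, M ω j k) := by
  classical
  have h : ∀ j, Reach inp (#{p ∈ P | p.1 = j}) r S {fun ω => ∑ k, M ω j k} := fun j => by
    set s : Finset K := {k | (j, k) ∈ P}
    have hs : #s = #{p ∈ P | p.1 = j} := by
      refine card_bij (fun k _ => (j, k)) (fun k hk => ?_) (fun k _ l _ h => (Prod.ext_iff.1 h).2)
        fun p hp => ⟨p.2, ?_, ?_⟩
      · simpa [s] using hk
      · obtain ⟨h1, rfl⟩ := mem_filter.1 hp
        simpa [s] using h1
      · obtain ⟨h1, rfl⟩ := mem_filter.1 hp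
        rfl
    have h1 := reach_sum hS (f := fun k ω => M ω j k) r s
      (fun k hk => hP (j, k) (by simpa [s] using hk)) ((card_le_univ s).trans hr)
    refine h1.mono (by omega) le_rfl subset_rfl ?_
    rw [Set.singleton_subset_iff, Set.mem_singleton_iff]
    funext ω
    exact (sum_subset (subset_univ s) fun k _ hk => hP0 ω j k (by simpa [s] using hk)).symm
  have h2 := reach_range h
  have h3 : #P = ∑ j, #{p ∈ P | p.1 = j} := card_eq_sum_card_fiberwise fun p _ => mem_univ p.1
  rwa [← h3] at h2

/-- Multiplication of a sparse matrix by a vector. -/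
theorem reach_mulVec {S : Set (Ω → ℝ)} (hS : Free inp ⊆ S) {M : Ω → Matrix J K ℝ}
    (P : Finset (J × K)) (hP : ∀ p ∈ P, (fun ω => M ω p.1 p.2) ∈ S)
    (hP0 : ∀ ω j k, (j, k) ∉ P → M ω j k = 0) {r : ℕ} (hr : Fintype.card K ≤ 2 ^ r)
    {x : K → Ω → ℝ} (hx : Set.range x ⊆ S) :
    Reach inp (2 * #P) (r + 1) S (Set.range fun j ω => (M ω *ᵥ fun k => x k ω) j) := by
  have h1 : Reach inp (∑ p ∈ P, 1) 1 S (⋃ p ∈ P, {fun ω => M ω p.1 p.2 * x p.2 ω}) :=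
    reach_biUnion P fun p hp => reach_mul (hP p hp) (hx ⟨p.2, rfl⟩)
  have h2 := h1.trans (reach_rowSum
    (S := S ∪ ⋃ p ∈ P, {fun ω => M ω p.1 p.2 * x p.2 ω}) (M := fun ω j k => M ω j k * x k ω)
    (hS.trans Set.subset_union_left) P
    (fun p hp => Or.inr (Set.mem_iUnion₂.2 ⟨p, hp, rfl⟩))
    (fun ω j k h => by rw [hP0 ω j k h, zero_mul]) hr)
  refine h2.mono (by simp; omega) (by omega) subset_rfl subset_rfl

end Vectors

theorem Gates.depths_le {k : ℕ} (g : Gates I k) (j : Fin k) : g.depths j ≤ k := by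
  induction g with
  | nil => exact j.elim0
  | @snoc k c op a b ih =>
    have h : ∀ o : Operand I k, o.depth c.depths ≤ k := fun o => by
      cases o with
      | input i => exact Nat.zero_le _
      | const q => exact Nat.zero_le _
      | gate j => exact ih j
    refine Fin.lastCases ?_ (fun j => ?_) j
    · simp only [Gates.depths, Fin.snoc_last]
      have := h a
      have := h b
      omega
    · simp only [Gates.depths, Fin.snoc_castSucc]
      exact (ih j).trans (Nat.le_succ k)

/-- Serves dimension 1, where log n = 0 makes the depth bound of a chain empty. -/
theorem Circuit.depth_le_work {O : Type} (c : Circuit I O) : c.depth ≤ c.work :=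
  Finset.sup_le fun j _ => c.gates.depths_le j

theorem Reach.exists_circuit {O : Type} {w δ : ℕ} {f : O → Ω → ℝ}
    (h : Reach inp w δ (Free inp) (Set.range f)) :
    ∃ c : Circuit I O, c.work ≤ w ∧ c.depth ≤ δ ∧
      ∀ ω, c.gates.Defined (inp ω) ∧ c.eval (inp ω) = fun o => f o ω := by
  obtain ⟨k, g, h1, h2, -, h4, h5⟩ := h 0 .nil 0 (fun _ => trivial)
    fun f hf => avail_of_mem_free _ _ hf
  choose o ho _ using fun j => h4 (f j) ⟨j, rfl⟩
  refine ⟨⟨k, g, o⟩, by simpa using h1, Finset.sup_le fun j _ => ?_, fun ω => ⟨h2 ω, funext fun j => ho j ω⟩⟩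
  exact h5 δ (by omega) (fun j => j.elim0) j

/-- The solution of a nonsingular linear system by Cramer's rule. -/
theorem reach_inv_mulVec {V : Type} [Fintype V] [DecidableEq V] {S : Set (Ω → ℝ)}
    (hS : Free inp ⊆ S) {M : Ω → Matrix V V ℝ} (hM : ∀ u v, (fun ω => M ω u v) ∈ S)
    (hdet : ∀ ω, IsUnit (M ω).det) {b : V → Ω → ℝ} (hb : Set.range b ⊆ S) {s : ℕ}
    (hs : Fintype.card V ≤ s) :
    Reach inp ((s + 1) * (s.factorial * (s + 1) + s.factorial) + s)
      ((s + 1) + s.factorial + 1) S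
      (Set.range fun v ω => ((M ω)⁻¹ *ᵥ fun u => b u ω) v) := by
  -- Determinants by the Leibniz expansion, without division. The only division is the final one by
  -- det M, nonzero on every instance, so no pivoting is needed.
  have hdetR : ∀ {N : Ω → Matrix V V ℝ}, (∀ u v, (fun ω => N ω u v) ∈ S) →
      Reach inp (s.factorial * (s + 1) + s.factorial) ((s + 1) + s.factorial) S
        {fun ω => (N ω).det} := fun {N} hN => by
    have hfac : Fintype.card (Equiv.Perm V) ≤ s.factorial := by
      rw [Fintype.card_perm]; exact Nat.factorial_le hs
    have h1 : ∀ σ : Equiv.Perm V, Reach inp (s + 1) (s + 1) S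
        {fun ω => ((Equiv.Perm.sign σ : ℤ) : ℝ) * ∏ i, N ω (σ i) i} := fun σ => by
      have h2 := (reach_prod hS (f := fun i ω => N ω (σ i) i) univ fun i _ => hN _ _).trans
        (reach_mul (a := fun _ => ((Equiv.Perm.sign σ : ℤ) : ℝ))
          (Or.inl (hS (by simpa using const_mem_free inp ((Equiv.Perm.sign σ : ℤ) : ℚ))))
          (Or.inr rfl))
      exact h2.mono_cost (by simpa using hs) (by simpa using hs)
    have h3 := (reach_range h1).trans (reach_sum (hS.trans Set.subset_union_left)
      (f := fun σ ω => ((Equiv.Perm.sign σ : ℤ) : ℝ) * ∏ i, N ω (σ i) i) s.factorial univ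
      (fun σ _ => Or.inr ⟨σ, rfl⟩) (by rw [card_univ]; exact hfac.trans Nat.lt_two_pow_self.le))
    refine h3.mono ?_ le_rfl subset_rfl ?_
    · rw [sum_const, card_univ, smul_eq_mul]
      exact add_le_add (Nat.mul_le_mul_right _ hfac) ((Nat.sub_le _ _).trans hfac)
    · rw [Set.singleton_subset_iff, Set.mem_singleton_iff]
      funext ω
      rw [det_apply']
  have hcr : ∀ v, Reach inp (s.factorial * (s + 1) + s.factorial) ((s + 1) + s.factorial) S
      {fun ω => ((M ω).updateCol v fun u => b u ω).det} := fun v => by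
    refine hdetR fun u w => ?_
    by_cases h : w = v
    · subst h; simpa using hb ⟨u, rfl⟩
    · simpa [h] using hM u w
  have h4 := ((reach_range hcr).union (hdetR hM)).trans (reach_vec_div (J := V)
    (x := fun v ω => ((M ω).updateCol v fun u => b u ω).det) (y := fun _ ω => (M ω).det)
    (fun f hf => Or.inr (Or.inl hf))
    (by rintro _ ⟨v, rfl⟩; exact Or.inr (Or.inr rfl)) fun _ ω => (hdet ω).ne_zero)
  refine h4.mono ?_ le_rfl subset_rfl ?_
  · rw [sum_const, card_univ, smul_eq_mul, ← Nat.succ_mul]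
    exact add_le_add (Nat.mul_le_mul_right _ (Nat.succ_le_succ hs)) hs
  · refine subset_of_eq (congrArg Set.range ?_)
    funext v ω
    have h5 : (M ω) *ᵥ ((M ω).det⁻¹ • (M ω).cramer fun u => b u ω) = fun u => b u ω := by
      rw [mulVec_smul, mulVec_cramer, smul_smul, inv_mul_cancel₀ (hdet ω).ne_zero, one_smul]
    rw [← h5, mulVec_mulVec, nonsing_inv_mul _ (hdet ω), one_mulVec, h5, Pi.smul_apply,
      cramer_apply, smul_eq_mul, inv_mul_eq_div]

end Circuits

/-! ### Jacobi iteration -/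

section Jacobi

variable {ι : Type} [Fintype ι] [DecidableEq ι]

/-- The `k`-th iterate of `y ↦ y + x⁻¹ (b - B y)`, started at `0`. -/
noncomputable def jacobi (B : Matrix ι ι ℝ) (x b : ι → ℝ) : ℕ → ι → ℝ
  | 0 => 0
  | k + 1 => fun i => jacobi B x b k i + (b i - (B *ᵥ jacobi B x b k) i) / x i

/-- The coefficients of the Jacobi iteration in a basis of eigenvectors. -/
def jacobiCoeff (l : ℝ) : ℕ → ℝ
  | 0 => 0
  | k + 1 => 1 - l * jacobiCoeff l k

/-- The coefficients are partial sums of the geometric series of 1/(1 + l). -/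
theorem jacobiCoeff_mul (l : ℝ) (k : ℕ) : (1 + l) * jacobiCoeff l k = 1 - (-l) ^ k := by
  induction k with
  | zero => simp [jacobiCoeff]
  | succ k ih =>
    have : (1 + l) * jacobiCoeff l (k + 1) = 1 + l - l * ((1 + l) * jacobiCoeff l k) := by
      simp only [jacobiCoeff]; ring
    rw [this, ih]
    ring

/-- For even k the coefficient is (1 - lᵏ)/(1 + l), below 1/(1 + l), so its inverse errs upwards
only. The excess (1 + l) lᵏ/(1 - lᵏ) is at most (3/2)/(3/4) · lᵏ = 2lᵏ; one factor l is kept so that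
the error is measured against L and not against X. -/
theorem jacobiCoeff_bounds {l β : ℝ} (h0 : 0 ≤ l) (hl : l ≤ β) (hβ : β ≤ 1 / 2) {k : ℕ}
    (hk : Even k) (hk2 : 2 ≤ k) :
    0 < jacobiCoeff l k ∧ 0 ≤ (jacobiCoeff l k)⁻¹ - (1 + l) ∧
      (jacobiCoeff l k)⁻¹ - (1 + l) ≤ 2 * β ^ (k - 1) * l := by
  have h1 := jacobiCoeff_mul l k
  rw [hk.neg_pow] at h1
  have hlk : l ^ k ≤ 1 / 4 := by
    calc l ^ k ≤ l ^ 2 := pow_le_pow_of_le_one h0 (by linarith) hk2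
      _ ≤ (1 / 2) ^ 2 := by gcongr; linarith
      _ = 1 / 4 := by norm_num
  have hlk0 : 0 ≤ l ^ k := pow_nonneg h0 k
  have hg : jacobiCoeff l k = (1 - l ^ k) / (1 + l) := by
    rw [eq_div_iff (by linarith), mul_comm, h1]
  have hd : 0 < 1 - l ^ k := by linarith
  have he : (jacobiCoeff l k)⁻¹ - (1 + l) = (1 + l) * l ^ k / (1 - l ^ k) := by
    rw [hg, inv_div]; field_simp; ring
  refine ⟨by rw [hg]; exact div_pos hd (by linarith), ?_, ?_⟩
  · rw [he]; positivity
  · rw [he, div_le_iff₀ hd]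
    have h2 : l ^ k = l ^ (k - 1) * l := by rw [← pow_succ]; congr 1; omega
    have h3 : l ^ (k - 1) ≤ β ^ (k - 1) := pow_le_pow_left₀ h0 hl _
    have h4 : l ^ k ≤ β ^ (k - 1) * l := by rw [h2]; gcongr
    have hβ0 : 0 ≤ β := h0.trans hl
    have h5 : 0 ≤ β ^ (k - 1) * l := by positivity
    nlinarith [mul_le_mul_of_nonneg_left h4 (by linarith : 0 ≤ 1 + l)]

/-- The Jacobi iteration for `X + L` with `0 ≼ L ≼ β X` applies the inverse of a matrix `Y` with
`0 ≼ Y - (X + L) ≼ 2 β ^ (k - 1) L`. -/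
theorem exists_jacobi_operator {x : ι → ℝ} (hx : ∀ i, 0 < x i) {L : Matrix ι ι ℝ} (hL : L.IsSymm)
    {β : ℝ} (hβ : β ≤ 1 / 2) (hL0 : ∀ y, 0 ≤ qf L y)
    (hL1 : ∀ y, qf L y ≤ β * qf (diagonal x) y) {k : ℕ} (hk : Even k) (hk2 : 2 ≤ k) :
    ∃ Y : Matrix ι ι ℝ, Y.IsSymm ∧ (∀ y, qf (diagonal x + L) y ≤ qf Y y) ∧
      (∀ y, qf Y y ≤ qf (diagonal x + L) y + 2 * β ^ (k - 1) * qf L y) ∧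
      ∀ b, Y *ᵥ jacobi (diagonal x + L) x b k = b := by
  obtain ⟨T, l, hT, hXT, hLT⟩ :=
    exists_simultaneous_diagonalization (posDef_diagonal_iff.2 hx) hL
  have hTT : T * T⁻¹ = 1 := mul_nonsing_inv _ hT
  have hX : ∀ y, qf (diagonal x) y = ∑ i, (T *ᵥ y) i ^ 2 := fun y => by
    rw [hXT, ← Matrix.mul_one Tᵀ, qf_conj, ← diagonal_one, qf_diagonal]; simp
  have hLq : ∀ y, qf L y = ∑ i, l i * (T *ᵥ y) i ^ 2 := fun y => by
    rw [hLT, qf_conj, qf_diagonal]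
  have hbasis : ∀ i, T *ᵥ (T⁻¹ *ᵥ Pi.single i 1) = Pi.single i 1 := fun i => by
    rw [mulVec_mulVec, hTT, one_mulVec]
  have hl0 : ∀ i, 0 ≤ l i := fun i => by
    have := hL0 (T⁻¹ *ᵥ Pi.single i 1)
    rw [hLq, hbasis, sum_eq_single i] at this
    · simpa using this
    · intro j _ hj; simp [hj]
    · simp
  have hl1 : ∀ i, l i ≤ β := fun i => by
    have := hL1 (T⁻¹ *ᵥ Pi.single i 1)
    rw [hLq, hX, hbasis, sum_eq_single i, sum_eq_single i] at this
    · simpa using this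
    · intro j _ hj; simp [hj]
    · simp
    · intro j _ hj; simp [hj]
    · simp
  have hB : diagonal x + L = Tᵀ * diagonal (fun i => 1 + l i) * T := by
    have : diagonal (fun i => 1 + l i) = 1 + diagonal l := by
      rw [← diagonal_one, diagonal_add]
    rw [this, Matrix.mul_add, Matrix.add_mul, Matrix.mul_one, ← hXT, ← hLT]
  have hBq : ∀ y, qf (diagonal x + L) y = ∑ i, (1 + l i) * (T *ᵥ y) i ^ 2 := fun y => by
    rw [hB, qf_conj, qf_diagonal]
  set g : ι → ℝ := fun i => jacobiCoeff (l i) k with hg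
  have hgb := fun i => jacobiCoeff_bounds (hl0 i) (hl1 i) hβ hk hk2
  set Y : Matrix ι ι ℝ := Tᵀ * diagonal (fun i => (g i)⁻¹) * T with hY
  have hYq : ∀ y, qf Y y = ∑ i, (g i)⁻¹ * (T *ᵥ y) i ^ 2 := fun y => by
    rw [hY, qf_conj, qf_diagonal]
  refine ⟨Y, ?_, fun y => ?_, fun y => ?_, fun b => ?_⟩
  · rw [Matrix.IsSymm, hY]
    simp [transpose_mul, Matrix.mul_assoc]
  · rw [hBq, hYq]
    exact sum_le_sum fun i _ => mul_le_mul_of_nonneg_right (by linarith [(hgb i).2.1]) (sq_nonneg _)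
  · rw [hBq, hYq, hLq, mul_sum, ← sum_add_distrib]
    refine sum_le_sum fun i _ => ?_
    rw [← mul_assoc, ← add_mul]
    exact mul_le_mul_of_nonneg_right (by linarith [(hgb i).2.2]) (sq_nonneg _)
  · set c : ι → ℝ := T⁻¹ᵀ *ᵥ b with hc
    have hTc : Tᵀ *ᵥ c = b := by
      rw [hc, mulVec_mulVec, ← transpose_mul, nonsing_inv_mul _ hT, transpose_one, one_mulVec]
    have hinj : ∀ u : ι → ℝ, T⁻¹ᵀ *ᵥ (diagonal x *ᵥ u) = T *ᵥ u := fun u => by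
      rw [hXT, mulVec_mulVec, ← Matrix.mul_assoc, ← transpose_mul, hTT, transpose_one,
        Matrix.one_mul]
    -- In the common basis X is the identity and L is diagonal, so the iteration decouples into
    -- scalar recursions.
    have hiter : ∀ m i, (T *ᵥ jacobi (diagonal x + L) x b m) i = jacobiCoeff (l i) m * c i := by
      intro m
      induction m with
      | zero => intro i; simp [jacobi, jacobiCoeff]
      | succ m ih =>
        intro i
        set y := jacobi (diagonal x + L) x b m with hy
        set u : ι → ℝ := fun i => (b i - ((diagonal x + L) *ᵥ y) i) / x i with hu
        have e1 : jacobi (diagonal x + L) x b (m + 1) = y + u := rfl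
        have e2 : diagonal x *ᵥ u = b - (diagonal x + L) *ᵥ y := by
          ext i
          rw [mulVec_diagonal, hu, Pi.sub_apply]
          field_simp [(hx i).ne']
        have e3 : T⁻¹ᵀ *ᵥ ((diagonal x + L) *ᵥ y) = diagonal (fun i => 1 + l i) *ᵥ (T *ᵥ y) := by
          rw [hB, mulVec_mulVec, mulVec_mulVec, Matrix.mul_assoc Tᵀ, ← Matrix.mul_assoc T⁻¹ᵀ,
            ← transpose_mul, hTT, transpose_one, Matrix.one_mul]
        rw [e1, mulVec_add, ← hinj u, e2, mulVec_sub, e3, Pi.add_apply, Pi.sub_apply,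
          mulVec_diagonal, ih, jacobiCoeff]
        change _ + (c i - _) = _
        ring
    rw [hY, ← mulVec_mulVec, ← mulVec_mulVec]
    rw [← hTc]
    congr 1
    ext i
    rw [mulVec_diagonal, hTc, hiter, ← mul_assoc]
    change (jacobiCoeff (l i) k)⁻¹ * _ * _ = _
    rw [inv_mul_cancel₀ (hgb i).1.ne', one_mul]

end Jacobi

/-! ### One level of a chain -/

section Level

variable {ι κ : Type} [Fintype ι] [DecidableEq ι] [Fintype κ] [DecidableEq κ]

/-- Replacing the block `A` by a matrix `Y ≽ A` with `Y - A ≼ ε K` and the Schur complement by an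
approximation. -/
theorem approx_fromBlocks {A Y : Matrix ι ι ℝ} {B : Matrix ι κ ℝ} {D S' : Matrix κ κ ℝ}
    {ε η : ℝ} (hε : 0 ≤ ε) (hη : 0 ≤ η) (hK : (fromBlocks A B Bᵀ D).PosDef) (hY : Y.IsSymm)
    (hAY : ∀ x, qf A x ≤ qf Y x)
    (hYA : ∀ x y, qf Y x ≤ qf A x + ε * qf (fromBlocks A B Bᵀ D) (Sum.elim x y))
    (hS' : S'.PosDef)
    (hS1 : ∀ y, qf S' y ≤ Real.exp (η + ε) * qf (D - Bᵀ * A⁻¹ * B) y)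
    (hS2 : ∀ y, Real.exp (-(η + ε)) * qf (D - Bᵀ * A⁻¹ * B) y ≤ qf S' y) :
    (fromBlocks Y B Bᵀ (S' + Bᵀ * Y⁻¹ * B)).PosDef ∧
      Approx (η + 2 * ε) (fromBlocks Y B Bᵀ (S' + Bᵀ * Y⁻¹ * B)) (fromBlocks A B Bᵀ D) := by
  have hA := posDef_of_fromBlocks hK
  have hYp : Y.PosDef := posDef_iff_qf.2 ⟨hY, fun x hx => (PosDef.qf_pos hA hx).trans_le (hAY x)⟩
  have hYd := PosDef.det_isUnit hYp
  have hAd := PosDef.det_isUnit hA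
  have hAs := PosDef.isSymm hA
  set K := fromBlocks A B Bᵀ D with hKdef
  set S := D - Bᵀ * A⁻¹ * B
  set R := D - Bᵀ * Y⁻¹ * B
  set K' := fromBlocks Y B Bᵀ (S' + Bᵀ * Y⁻¹ * B)
  have hK' : ∀ x y, qf K' (Sum.elim x y) = qf Y (x + Y⁻¹ *ᵥ (B *ᵥ y)) + qf S' y := fun x y => by
    rw [qf_fromBlocks hY hYd, add_sub_cancel_right]
  -- The intermediate matrix replaces A by Y but keeps D. Its Schur complement R lies between S and
  -- (1 + ε) S, by evaluating this identity at the minimizers for Y and for A.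
  have hmid : ∀ x y, qf Y (x + Y⁻¹ *ᵥ (B *ᵥ y)) + qf R y =
      qf K (Sum.elim x y) + (qf Y x - qf A x) := fun x y => by
    rw [← qf_fromBlocks hY hYd]
    have : fromBlocks Y B Bᵀ D = K + fromBlocks (Y - A) 0 0 0 := by
      rw [hKdef, fromBlocks_add]; simp
    rw [this, qf_add, ← qf_sub]
    congr 1
    simp [qf, fromBlocks_mulVec]
  have hSR : ∀ y, qf S y ≤ qf R y := fun y => by
    have h1 := hmid (-(Y⁻¹ *ᵥ (B *ᵥ y))) y
    rw [neg_add_cancel, qf_zero_vec, zero_add] at h1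
    rw [h1, qf_fromBlocks hAs hAd]
    linarith [hAY (-(Y⁻¹ *ᵥ (B *ᵥ y))), PosDef.qf_nonneg hA (-(Y⁻¹ *ᵥ (B *ᵥ y)) + A⁻¹ *ᵥ (B *ᵥ y))]
  have hRS : ∀ y, qf R y ≤ (1 + ε) * qf S y := fun y => by
    have h1 := hmid (-(A⁻¹ *ᵥ (B *ᵥ y))) y
    have h2 := hYA (-(A⁻¹ *ᵥ (B *ᵥ y))) y
    rw [qf_fromBlocks hAs hAd, neg_add_cancel, qf_zero_vec, zero_add] at h1 h2
    linarith [PosDef.qf_nonneg hYp (-(A⁻¹ *ᵥ (B *ᵥ y)) + Y⁻¹ *ᵥ (B *ᵥ y))]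
  have hSp : ∀ y, 0 ≤ qf S y := PosDef.qf_nonneg (posDef_schur_of_fromBlocks hK)
  have hsymm : K'.IsSymm := by
    refine symm_fromBlocks hY ((PosDef.isSymm hS').add ?_)
    simp [Matrix.IsSymm, transpose_mul, (PosDef.isSymm hYp.inv).eq, Matrix.mul_assoc]
  have hE1 : 1 + ε ≤ Real.exp ε := by linarith [Real.add_one_le_exp ε]
  have hE2 : 1 ≤ Real.exp (η + ε) := Real.one_le_exp (by linarith)
  have hEE : Real.exp (η + 2 * ε) = Real.exp (η + ε) * Real.exp ε := by
    rw [← Real.exp_add]; ring_nf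
  have hEE' : Real.exp (-(η + 2 * ε)) = Real.exp (-(η + ε)) * Real.exp (-ε) := by
    rw [← Real.exp_add]; ring_nf
  have hEp := Real.exp_pos ε
  have hbound : ∀ z, qf K' z ≤ Real.exp (η + 2 * ε) * qf K z ∧
      Real.exp (-(η + 2 * ε)) * qf K z ≤ qf K' z := fun z => by
    obtain ⟨x, y, rfl⟩ : ∃ x y, z = Sum.elim x y :=
      ⟨z ∘ Sum.inl, z ∘ Sum.inr, (Sum.elim_comp_inl_inr z).symm⟩
    have hm := hmid x y
    set q := qf Y (x + Y⁻¹ *ᵥ (B *ᵥ y))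
    have hq : 0 ≤ q := PosDef.qf_nonneg hYp _
    have hKn : 0 ≤ qf K (Sum.elim x y) := PosDef.qf_nonneg hK _
    rw [hK']
    constructor
    · rw [hEE, mul_assoc]
      have h1 : qf S' y ≤ Real.exp (η + ε) * qf R y :=
        (hS1 y).trans (mul_le_mul_of_nonneg_left (hSR y) (by linarith))
      have h2 : q + qf R y ≤ Real.exp ε * qf K (Sum.elim x y) := by
        have := mul_le_mul_of_nonneg_right hE1 hKn
        linarith [hYA x y]
      calc q + qf S' y ≤ Real.exp (η + ε) * (q + qf R y) := by nlinarith
        _ ≤ _ := mul_le_mul_of_nonneg_left h2 (by linarith)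
    · have h1 : Real.exp (-(η + 2 * ε)) * qf R y ≤ qf S' y := by
        refine le_trans ?_ (hS2 y)
        rw [hEE', mul_assoc]
        refine mul_le_mul_of_nonneg_left ?_ (Real.exp_pos _).le
        rw [Real.exp_neg, inv_mul_le_iff₀ hEp]
        exact (hRS y).trans (mul_le_mul_of_nonneg_right hE1 (hSp y))
      have h2 : Real.exp (-(η + 2 * ε)) * q ≤ q :=
        mul_le_of_le_one_left hq (Real.exp_le_one_iff.2 (by linarith))
      have h3 : Real.exp (-(η + 2 * ε)) * qf K (Sum.elim x y) ≤
          Real.exp (-(η + 2 * ε)) * (q + qf R y) :=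
        mul_le_mul_of_nonneg_left (by linarith [hAY x]) (Real.exp_pos _).le
      linarith
  refine ⟨posDef_iff_qf.2 ⟨hsymm, fun z hz => ?_⟩,
    (approx_iff_qf hsymm (PosDef.isSymm hK)).2 hbound⟩
  exact lt_of_lt_of_le (mul_pos (Real.exp_pos _) (PosDef.qf_pos hK hz)) (hbound z).2

/-- The row sums of a strongly diagonally dominant principal block are positive, and dominate its
Laplacian. -/
theorem stronglyDD_laplacian {A : Matrix ι ι ℝ} (hA : A.PosDef) (hoff : ∀ i j, i ≠ j → A i j ≤ 0)
    {α : ℝ} (hα : 4 ≤ α) (hdd : IsStronglyDD α A) :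
    (∀ i, 0 < ∑ j, A i j) ∧ ∀ y : ι → ℝ, ∑ i, ∑ j, (-A i j) / 2 * (y i - y j) ^ 2 ≤
      2 / α * ∑ i, (∑ j, A i j) * y i ^ 2 := by
  have hrow : ∀ i, α * ∑ j ∈ univ.erase i, |A i j| ≤ ∑ j, A i j := fun i => by
    have h1 := hdd.2 i
    have h2 := sum_abs_erase hoff i
    linarith
  constructor
  · intro i
    have h1 := hrow i
    have h2 := sum_abs_erase hoff i
    have h3 : 0 < A i i := hA.diag_pos
    have h4 : 0 ≤ ∑ j ∈ univ.erase i, |A i j| := sum_nonneg fun j _ => abs_nonneg _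
    rcases h4.eq_or_lt with h | h
    · linarith
    · nlinarith
  · intro y
    set w : ι → ι → ℝ := fun i j => if i = j then 0 else |A i j| with hw
    have hws : ∀ i j, w i j = w j i := fun i j => by
      simp only [hw, eq_comm, (PosDef.isSymm hA).apply i j]
    -- This is (a - b)² ≤ 2a² + 2b². Each row of w sums to at most 1/α of the row sum of A.
    have h1 : ∀ i j, (-A i j) / 2 * (y i - y j) ^ 2 ≤ w i j * y i ^ 2 + w j i * y j ^ 2 := by
      intro i j
      by_cases h : i = j
      · subst h; simp [hw]
      · rw [← hws i j]
        simp only [hw, h, if_false]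
        rw [abs_of_nonpos (hoff i j h)]
        have := hoff i j h
        nlinarith [sq_nonneg (y i + y j)]
    have h2 : ∑ i, ∑ j, (-A i j) / 2 * (y i - y j) ^ 2 ≤ 2 * ∑ i, (∑ j, w i j) * y i ^ 2 := by
      refine (sum_le_sum fun i _ => sum_le_sum fun j _ => h1 i j).trans_eq ?_
      simp only [sum_add_distrib]
      rw [sum_comm (f := fun i j => w j i * y j ^ 2)]
      simp only [sum_mul]
      ring
    refine h2.trans ?_
    rw [div_mul_eq_mul_div, le_div_iff₀ (by linarith), mul_assoc, sum_mul]
    refine mul_le_mul_of_nonneg_left (sum_le_sum fun i _ => ?_) two_pos.le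
    have h3 : ∑ j, w i j = ∑ j ∈ univ.erase i, |A i j| := by
      rw [← add_sum_erase univ _ (mem_univ i)]
      have : ∑ j ∈ univ.erase i, w i j = ∑ j ∈ univ.erase i, |A i j| :=
        sum_congr rfl fun j hj => by simp [hw, (ne_of_mem_erase hj).symm]
      rw [this]
      simp [hw]
    rw [h3, mul_right_comm]
    refine mul_le_mul_of_nonneg_right ?_ (sq_nonneg _)
    rw [mul_comm]
    exact hrow i

end Level

/-! ### Approximate block elimination -/

section LevelSolve

variable {ι : Type} [DecidableEq ι] {V : Finset ι}

/-- An approximation of `M_{FF}⁻¹ c`. -/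
noncomputable def fineSolve (M : Matrix V V ℝ) (F : Finset ι) (k : ℕ)
    (c : {v : ↥V // (v : ι) ∈ F} → ℝ) : {v : ↥V // (v : ι) ∈ F} → ℝ :=
  jacobi (blockFF M F) (fun i => ∑ j, blockFF M F i j) c k

/-- Approximate block elimination of `F`, given an approximate inverse `W` of the Schur
complement. -/
noncomputable def levelSolve (M : Matrix V V ℝ) (F : Finset ι) (k : ℕ)
    (W : Matrix ↥(V \ F) ↥(V \ F) ℝ) (b : V → ℝ) : V → ℝ :=
  let y := fineSolve M F k (b ∘ fine V F)
  let z := W *ᵥ (b ∘ coarse V F - M.submatrix (coarse V F) (fine V F) *ᵥ y)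
  Sum.elim (y - fineSolve M F k (M.submatrix (fine V F) (coarse V F) *ᵥ z)) z ∘
    (splitEquiv V F).symm

theorem approx_submatrix {κ κ' : Type} [Fintype κ] [Fintype κ'] {ε : ℝ} {A B : Matrix κ κ ℝ}
    (h : Approx ε A B) (e : κ' → κ) : Approx ε (A.submatrix e e) (B.submatrix e e) :=
  ⟨h.1.submatrix e, h.2.submatrix e⟩

/-- Approximate elimination is exact elimination for the block matrix with Y in place of the
eliminated block and Schur complement S'. One ε pays for M' against the Schur complement, the other
for Y. -/
theorem exists_level_operator {M : Matrix V V ℝ} (hM : IsSDDM M) {F : Finset ι} {α ε η : ℝ}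
    (hα : 4 ≤ α) (hε : 0 ≤ ε) (hη : 0 ≤ η) (hdd : IsStronglyDD α (blockFF M F)) {k : ℕ}
    (hk : Even k) (hk2 : 2 ≤ k) (hkε : 2 * (2 / α) ^ (k - 1) ≤ ε)
    {S' M' : Matrix ↥(V \ F) ↥(V \ F) ℝ} (hS' : S'.PosDef) (hM' : IsSDDM M')
    (h1 : Approx η S' M') (h2 : Approx ε M' (schur M F)) :
    ∃ N : Matrix V V ℝ, N.PosDef ∧ Approx (η + 2 * ε) N M ∧
      ∀ b, N⁻¹ *ᵥ b = levelSolve M F k S'⁻¹ b := by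
  set e := splitEquiv V F with he
  set A := blockFF M F with hAdef
  set B := M.submatrix (fine V F) (coarse V F) with hBdef
  set D := M.submatrix (coarse V F) (coarse V F)
  have hMe : M.submatrix e e = fromBlocks A B Bᵀ D := submatrix_splitEquiv hM.symm F
  have hK : IsSDDM (fromBlocks A B Bᵀ D) := hMe ▸ hM.submatrix_equiv e
  have hA := posDef_of_fromBlocks hK.posDef
  have hoff : ∀ i j, i ≠ j → A i j ≤ 0 := fun i j hij =>
    hK.offDiag_nonpos (Sum.inl i) (Sum.inl j) (by simpa using hij)
  obtain ⟨hx, hlap⟩ := stronglyDD_laplacian hA hoff hα hdd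
  set x : {v : ↥V // (v : ι) ∈ F} → ℝ := fun i => ∑ j, A i j with hxdef
  set L := A - diagonal x with hL
  have hAL : diagonal x + L = A := by rw [hL]; abel
  have hLq : ∀ y, qf L y = ∑ i, ∑ j, (-A i j) / 2 * (y i - y j) ^ 2 := fun y => by
    rw [hL, qf_sub, qf_eq_laplacian (PosDef.isSymm hA), qf_diagonal]
    ring
  have hL0 : ∀ y, 0 ≤ qf L y := fun y => by
    rw [hLq]
    exact sum_nonneg fun i _ => sum_nonneg fun j _ => laplacian_nonneg hoff y i j
  have hβ : 2 / α ≤ 1 / 2 := by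
    rw [div_le_div_iff₀ (by linarith) two_pos]; linarith
  obtain ⟨Y, hY, hY1, hY2, hY3⟩ := exists_jacobi_operator hx
    ((PosDef.isSymm hA).sub (isSymm_diagonal _)) hβ hL0
    (fun y => by rw [hLq, qf_diagonal]; exact hlap y) hk hk2
  rw [hAL] at hY1 hY2 hY3
  -- The edges of L are among the edges of the whole matrix, whose other terms are nonnegative.
  have hLK : ∀ u v, qf L u ≤ qf (fromBlocks A B Bᵀ D) (Sum.elim u v) := fun u v => by
    have hnn : ∀ i, 0 ≤ ∑ j, -fromBlocks A B Bᵀ D i j / 2 *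
        (Sum.elim u v i - Sum.elim u v j) ^ 2 := fun i =>
      sum_nonneg fun j _ => laplacian_nonneg hK.offDiag_nonpos _ i j
    have h3 : 0 ≤ ∑ i, (∑ j, fromBlocks A B Bᵀ D i j) * Sum.elim u v i ^ 2 :=
      sum_nonneg fun i _ => mul_nonneg (hK.rowSum_nonneg i) (sq_nonneg _)
    have h4 : qf L u ≤ ∑ i, ∑ j, -fromBlocks A B Bᵀ D i j / 2 *
        (Sum.elim u v i - Sum.elim u v j) ^ 2 := by
      rw [Fintype.sum_sum_type, hLq]
      refine le_add_of_le_of_nonneg (sum_le_sum fun i _ => ?_) (sum_nonneg fun i _ => hnn _)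
      rw [Fintype.sum_sum_type]
      refine le_add_of_le_of_nonneg (le_of_eq rfl) (sum_nonneg fun j _ => ?_)
      exact laplacian_nonneg hK.offDiag_nonpos (Sum.elim u v) (Sum.inl i) (Sum.inr j)
    rw [qf_eq_laplacian hK.symm]
    linarith
  have hSs := (hM.schur F).symm
  rw [approx_iff_qf (PosDef.isSymm hS') hM'.symm] at h1
  rw [approx_iff_qf hM'.symm hSs] at h2
  rw [schur_eq hM.symm] at h2
  obtain ⟨hP, hap⟩ := approx_fromBlocks (S' := S') hε hη hK.posDef hY hY1 (fun u v => by
      refine (hY2 u).trans (add_le_add_right ?_ _)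
      exact mul_le_mul hkε (hLK u v) (hL0 u) hε) hS'
    (fun y => by
      rw [Real.exp_add, mul_assoc]
      exact (h1 y).1.trans (mul_le_mul_of_nonneg_left (h2 y).1 (Real.exp_pos _).le))
    (fun y => by
      rw [neg_add, Real.exp_add, mul_assoc]
      exact (mul_le_mul_of_nonneg_left (h2 y).2 (Real.exp_pos _).le).trans (h1 y).2)
  set K' := fromBlocks Y B Bᵀ (S' + Bᵀ * Y⁻¹ * B) with hK'
  have hN : (K'.submatrix e.symm e.symm).PosDef := hP.submatrix e.symm.injective
  refine ⟨K'.submatrix e.symm e.symm, hN, ?_, fun b => ?_⟩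
  · have h3 := approx_submatrix hap e.symm
    rwa [← hMe, submatrix_submatrix, e.self_comp_symm, submatrix_id_id] at h3
  · have hYd : IsUnit Y.det := PosDef.det_isUnit (posDef_of_fromBlocks hP)
    suffices h : K'.submatrix e.symm e.symm *ᵥ levelSolve M F k S'⁻¹ b = b by
      conv_lhs => rw [← h]
      rw [mulVec_mulVec, nonsing_inv_mul _ (PosDef.det_isUnit hN), one_mulVec]
    set y := fineSolve M F k (b ∘ fine V F) with hy
    set z := S'⁻¹ *ᵥ (b ∘ coarse V F - M.submatrix (coarse V F) (fine V F) *ᵥ y) with hz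
    have hYy : Y *ᵥ y = b ∘ fine V F := hY3 _
    have hYz : Y *ᵥ fineSolve M F k (B *ᵥ z) = B *ᵥ z := hY3 _
    have hYY : ∀ w, Y⁻¹ *ᵥ (Y *ᵥ w) = w := fun w => by
      rw [mulVec_mulVec, nonsing_inv_mul _ hYd, one_mulVec]
    have hz' : fineSolve M F k (B *ᵥ z) = Y⁻¹ *ᵥ (B *ᵥ z) :=
      (hYY _).symm.trans (congrArg (Y⁻¹ *ᵥ ·) hYz)
    have hBt : M.submatrix (coarse V F) (fine V F) = Bᵀ := by
      rw [hBdef, transpose_submatrix, hM.symm.eq]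
    have hSz : S' *ᵥ z = b ∘ coarse V F - Bᵀ *ᵥ y := by
      rw [hz, mulVec_mulVec, mul_nonsing_inv _ (PosDef.det_isUnit hS'), one_mulVec, hBt]
    have hsol : K' *ᵥ Sum.elim (y - fineSolve M F k (B *ᵥ z)) z = b ∘ e := by
      rw [hK', fromBlocks_mulVec]
      simp only [Sum.elim_comp_inl, Sum.elim_comp_inr]
      have e1 : Y *ᵥ (y - fineSolve M F k (B *ᵥ z)) + B *ᵥ z = b ∘ fine V F := by
        rw [mulVec_sub, hYz, hYy, sub_add_cancel]
      have e2 : Bᵀ *ᵥ (y - fineSolve M F k (B *ᵥ z)) + (S' + Bᵀ * Y⁻¹ * B) *ᵥ z =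
          b ∘ coarse V F := by
        rw [mulVec_sub, add_mulVec, hSz, hz', ← mulVec_mulVec, ← mulVec_mulVec]
        abel
      rw [e1, e2]
      ext (v | v) <;> rfl
    rw [submatrix_mulVec_equiv, e.symm_symm]
    have hls : levelSolve M F k S'⁻¹ b ∘ e = Sum.elim (y - fineSolve M F k (B *ᵥ z)) z := by
      change (_ ∘ e.symm) ∘ e = _
      rw [Function.comp_assoc, e.symm_comp_self, Function.comp_id]
    rw [hls, hsol, Function.comp_assoc, e.self_comp_symm, Function.comp_id]

end LevelSolve

/-! ### Preconditioned iterative refinement -/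

section Richardson

variable {ι : Type} [Fintype ι] [DecidableEq ι]

/-- Iterative refinement with step size `1 / 3` and approximate inverse `W`. -/
noncomputable def richardson (A W : Matrix ι ι ℝ) (b : ι → ℝ) : ℕ → ι → ℝ
  | 0 => 0
  | t + 1 => fun i =>
      richardson A W b t i + ((1 / 3 : ℚ) : ℝ) * (W *ᵥ fun j => b j - (A *ᵥ richardson A W b t) j) i

/-- Where N is the identity and A is diagonal with entries l, each step multiplies an error
coordinate by 1 - l/3. From e < 3 follows 1/3 ≤ l ≤ 3, so the factor lies in [0, 8/9]. -/
theorem isApproxSolution_richardson {A N : Matrix ι ι ℝ} (hA : A.PosDef) (hN : N.PosDef)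
    (h : Approx 1 N A) (b : ι → ℝ) (t : ℕ) :
    IsApproxSolution ((9 / 10) ^ t) A b (richardson A N⁻¹ b t) := by
  rw [approx_iff_qf (PosDef.isSymm hN) (PosDef.isSymm hA)] at h
  obtain ⟨T, l, hT, hNT, hAT⟩ := exists_simultaneous_diagonalization hN (PosDef.isSymm hA)
  have hTT : T * T⁻¹ = 1 := mul_nonsing_inv _ hT
  have hTT' : T⁻¹ * T = 1 := nonsing_inv_mul _ hT
  have hNq : ∀ y, qf N y = ∑ i, (T *ᵥ y) i ^ 2 := fun y => by
    rw [hNT, ← Matrix.mul_one Tᵀ, qf_conj, ← diagonal_one, qf_diagonal]; simp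
  have hAq : ∀ y, qf A y = ∑ i, l i * (T *ᵥ y) i ^ 2 := fun y => by
    rw [hAT, qf_conj, qf_diagonal]
  have hbasis : ∀ i, T *ᵥ (T⁻¹ *ᵥ Pi.single i 1) = Pi.single i 1 := fun i => by
    rw [mulVec_mulVec, hTT, one_mulVec]
  have hl : ∀ i, 1 / 3 ≤ l i ∧ l i ≤ 3 := fun i => by
    have h1 := h (T⁻¹ *ᵥ Pi.single i 1)
    have hA1 : qf A (T⁻¹ *ᵥ Pi.single i 1) = l i := by
      rw [hAq, hbasis, sum_eq_single i] <;> simp +contextual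
    have hN1 : qf N (T⁻¹ *ᵥ Pi.single i 1) = 1 := by
      rw [hNq, hbasis, sum_eq_single i] <;> simp +contextual
    rw [hA1, hN1] at h1
    have he : Real.exp 1 < 3 := by linarith [Real.exp_one_lt_d9]
    have he0 := Real.exp_pos 1
    have hl0 : 0 < l i := by
      by_contra hneg
      nlinarith [h1.1, not_lt.1 hneg]
    rw [Real.exp_neg, inv_mul_le_iff₀ he0] at h1
    exact ⟨by nlinarith [h1.1], by linarith [h1.2]⟩
  set x := A⁻¹ *ᵥ b with hx
  have hAx : A *ᵥ x = b := by
    rw [hx, mulVec_mulVec, mul_nonsing_inv _ (PosDef.det_isUnit hA), one_mulVec]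
  have hTN : T * N⁻¹ * A = diagonal l * T := by
    have hNinv : N⁻¹ = T⁻¹ * T⁻¹ᵀ := by
      apply inv_eq_right_inv
      calc N * (T⁻¹ * T⁻¹ᵀ) = Tᵀ * (T * T⁻¹) * T⁻¹ᵀ := by rw [hNT]; simp only [Matrix.mul_assoc]
        _ = 1 := by rw [hTT, Matrix.mul_one, ← transpose_mul, hTT', transpose_one]
    calc T * N⁻¹ * A = (T * T⁻¹) * (T⁻¹ᵀ * Tᵀ) * diagonal l * T := by
          rw [hNinv, hAT]; simp only [Matrix.mul_assoc]
      _ = _ := by rw [hTT, ← transpose_mul, hTT, transpose_one, Matrix.one_mul, Matrix.one_mul]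
  have herr : ∀ i, (T *ᵥ (richardson A N⁻¹ b t - x)) i =
      -((1 - l i / 3) ^ t * (T *ᵥ x) i) := by
    induction t with
    | zero => intro i; simp [richardson, mulVec_neg]
    | succ t ih =>
      intro i
      set r := richardson A N⁻¹ b t with hr
      have e1 : richardson A N⁻¹ b (t + 1) - x =
          (r - x) - (1 / 3 : ℝ) • (N⁻¹ *ᵥ (A *ᵥ (r - x))) := by
        have e2 : (fun j => b j - (A *ᵥ r) j) = -(A *ᵥ (r - x)) := by
          rw [mulVec_sub, hAx]; ext j; simp
        ext j
        simp only [richardson, Pi.sub_apply, Pi.smul_apply, ← hr, e2, mulVec_neg, Pi.neg_apply,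
          smul_eq_mul]
        push_cast
        ring
      have e3 : T *ᵥ (N⁻¹ *ᵥ (A *ᵥ (r - x))) = diagonal l *ᵥ (T *ᵥ (r - x)) := by
        rw [mulVec_mulVec, mulVec_mulVec, hTN, ← mulVec_mulVec]
      rw [e1, mulVec_sub, mulVec_smul, e3, Pi.sub_apply, Pi.smul_apply, mulVec_diagonal, ih]
      rw [smul_eq_mul]
      ring
  have hle : qf A (richardson A N⁻¹ b t - x) ≤ ((9 / 10) ^ t) ^ 2 * qf A x := by
    rw [hAq, hAq, mul_sum]
    refine sum_le_sum fun i _ => ?_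
    have h1 : (1 - l i / 3) ^ t ≤ (9 / 10) ^ t :=
      pow_le_pow_left₀ (by linarith [(hl i).2]) (by linarith [(hl i).1]) t
    have h0 : 0 ≤ (1 - l i / 3) ^ t := pow_nonneg (by linarith [(hl i).2]) t
    have h2 : ((1 - l i / 3) ^ t) ^ 2 ≤ ((9 / 10) ^ t) ^ 2 := pow_le_pow_left₀ h0 h1 2
    have h3 : 0 ≤ l i * (T *ᵥ x) i ^ 2 := mul_nonneg (by linarith [(hl i).1]) (sq_nonneg _)
    rw [herr i]
    nlinarith [mul_le_mul_of_nonneg_right h2 h3]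
  change √(qf A _) ≤ _ * √(qf A x)
  refine (Real.sqrt_le_sqrt hle).trans_eq ?_
  rw [Real.sqrt_mul (by positivity), Real.sqrt_sq (by positivity)]

end Richardson

/-! ### The circuit of one level -/

section LevelCircuit

variable {I Ω : Type} {inp : Ω → I → ℝ}

theorem reach_jacobi {J : Type} [Fintype J] {S : Set (Ω → ℝ)} (hS : Free inp ⊆ S)
    {B : Ω → Matrix J J ℝ} (P : Finset (J × J)) (hP : ∀ p ∈ P, (fun ω => B ω p.1 p.2) ∈ S)
    (hP0 : ∀ ω i j, (i, j) ∉ P → B ω i j = 0) {r : ℕ} (hr : Fintype.card J ≤ 2 ^ r)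
    {x c : J → Ω → ℝ} (hx : Set.range x ⊆ S) (hx0 : ∀ j ω, x j ω ≠ 0) (hc : Set.range c ⊆ S)
    (k : ℕ) :
    Reach inp (k * (2 * #P + 3 * Fintype.card J)) (k * (r + 4)) S
      (Set.range fun j ω => jacobi (B ω) (fun i => x i ω) (fun i => c i ω) k j) := by
  induction k with
  | zero =>
    refine reach_of_subset ?_ _ _
    rintro _ ⟨j, rfl⟩
    exact hS (zero_mem_free inp)
  | succ k ih =>
    set y : J → Ω → ℝ := fun j ω => jacobi (B ω) (fun i => x i ω) (fun i => c i ω) k j with hy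
    set u : J → Ω → ℝ := fun j ω => (B ω *ᵥ fun i => y i ω) j with hu
    set S₁ := S ∪ Set.range y
    have hS₁ : S ⊆ S₁ := Set.subset_union_left
    have h1 : Reach inp (2 * #P) (r + 1) S₁ (Set.range u) :=
      reach_mulVec (hS.trans hS₁) P (fun p hp => hS₁ (hP p hp)) hP0 hr Set.subset_union_right
    set S₂ := S₁ ∪ Set.range u
    have hS₂ : S₁ ⊆ S₂ := Set.subset_union_left
    have h2 : Reach inp (Fintype.card J) 1 S₂ (Set.range fun j ω => c j ω - u j ω) :=
      reach_vec_sub (hc.trans (hS₁.trans hS₂)) Set.subset_union_right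
    set S₃ := S₂ ∪ Set.range fun j ω => c j ω - u j ω
    have hS₃ : S₂ ⊆ S₃ := Set.subset_union_left
    have h3 : Reach inp (Fintype.card J) 1 S₃ (Set.range fun j ω => (c j ω - u j ω) / x j ω) :=
      reach_vec_div (x := fun j ω => c j ω - u j ω) Set.subset_union_right
        (hx.trans (hS₁.trans (hS₂.trans hS₃))) hx0
    have h4 := reach_vec_add (inp := inp)
      (S := S₃ ∪ Set.range fun j ω => (c j ω - u j ω) / x j ω) (x := y)
      (y := fun j ω => (c j ω - u j ω) / x j ω)
      ((Set.subset_union_right.trans (hS₂.trans hS₃)).trans Set.subset_union_left)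
      Set.subset_union_right
    refine (ih.trans (h1.trans (h2.trans (h3.trans h4)))).mono ?_ ?_ subset_rfl subset_rfl
    · ring_nf; rfl
    · ring_nf; rfl

variable {ι : Type} [DecidableEq ι] {V : Finset ι}

/-- The diagonal is nonzero, so vector operations can be charged to the nonzero entries. -/
theorem card_le_nnz {κ : Type} [Fintype κ] {M : Matrix κ κ ℝ} (hM : M.PosDef) :
    Fintype.card κ ≤ nnz M := by
  rw [← card_univ]
  refine card_le_card_of_injOn (fun i => (i, i)) (fun i _ => ?_) fun i _ j _ h =>
    (Prod.ext_iff.1 h).1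
  have : M i i ≠ 0 := hM.diag_pos.ne'
  simpa using this

/-- The nonzero positions of a block. -/
noncomputable def blockSupport {κ κ₁ κ₂ : Type} [Fintype κ₁] [Fintype κ₂] (M : Matrix κ κ ℝ)
    (f : κ₁ → κ) (g : κ₂ → κ) : Finset (κ₁ × κ₂) := {p | M (f p.1) (g p.2) ≠ 0}

theorem card_blockSupport_le {κ κ₁ κ₂ : Type} [Fintype κ] [Fintype κ₁] [Fintype κ₂]
    (M : Matrix κ κ ℝ) {f : κ₁ → κ} {g : κ₂ → κ} (hf : f.Injective) (hg : g.Injective) :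
    #(blockSupport M f g) ≤ nnz M := by
  refine card_le_card_of_injOn (Prod.map f g) (fun p hp => ?_) (hf.prodMap hg).injOn
  simpa [blockSupport] using hp

theorem fine_injective (V F : Finset ι) : (fine V F).Injective := Subtype.val_injective

theorem coarse_injective (V F : Finset ι) : (coarse V F).Injective := fun _ _ h =>
  Subtype.ext (congrArg (Subtype.val : ↥V → ι) h)

/-- M₀ supplies the sparsity pattern that determines the gates, while the matrices M ω vary with the
instance. -/
theorem reach_fineSolve {S : Set (Ω → ℝ)} (hS : Free inp ⊆ S) {M : Ω → Matrix V V ℝ}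
    (hM : ∀ u v, (fun ω => M ω u v) ∈ Free inp) {M₀ : Matrix V V ℝ}
    (hM₀ : ∀ ω u v, M₀ u v = 0 → M ω u v = 0) (hcard : Fintype.card V ≤ nnz M₀) {r : ℕ}
    (hr : Fintype.card V ≤ 2 ^ r) {F : Finset ι} (hx : ∀ ω i, 0 < ∑ j, blockFF (M ω) F i j)
    {c : {v : ↥V // (v : ι) ∈ F} → Ω → ℝ} (hc : Set.range c ⊆ S) (k : ℕ) :
    Reach inp (nnz M₀ + k * (5 * nnz M₀)) (r + k * (r + 4)) S
      (Set.range fun j ω => fineSolve (M ω) F k (fun i => c i ω) j) := by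
  set P := blockSupport M₀ (fine V F) (fine V F)
  have hP0 : ∀ ω i j, (i, j) ∉ P → blockFF (M ω) F i j = 0 := fun ω i j h =>
    hM₀ ω _ _ (by simpa [P, blockSupport] using h)
  have hJ : Fintype.card {v : ↥V // (v : ι) ∈ F} ≤ Fintype.card V := Fintype.card_subtype_le _
  have hPc := card_blockSupport_le M₀ (fine_injective V F) (fine_injective V F)
  have h1 := reach_rowSum hS (M := fun ω => blockFF (M ω) F) P (fun p _ => hS (hM _ _)) hP0
    (hJ.trans hr)
  have h2 := h1.trans (reach_jacobi (hS.trans Set.subset_union_left)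
    (B := fun ω => blockFF (M ω) F) P (fun p _ => Or.inl (hS (hM _ _))) hP0 (hJ.trans hr)
    (x := fun i ω => ∑ j, blockFF (M ω) F i j) Set.subset_union_right
    (fun i ω => (hx ω i).ne') (hc.trans Set.subset_union_left) k)
  refine h2.mono (add_le_add hPc (Nat.mul_le_mul_left k ?_)) le_rfl subset_rfl subset_rfl
  have : #P ≤ nnz M₀ := hPc
  omega

/-- The recursion calls W only once, so w and δ enter with coefficient 1 and costs add up over the
levels. -/
theorem reach_levelSolve {S : Set (Ω → ℝ)} (hS : Free inp ⊆ S) {M : Ω → Matrix V V ℝ}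
    (hM : ∀ u v, (fun ω => M ω u v) ∈ Free inp) {M₀ : Matrix V V ℝ}
    (hM₀ : ∀ ω u v, M₀ u v = 0 → M ω u v = 0) (hcard : Fintype.card V ≤ nnz M₀) {r : ℕ}
    (hr : Fintype.card V ≤ 2 ^ r) {F : Finset ι} (hx : ∀ ω i, 0 < ∑ j, blockFF (M ω) F i j)
    {W : Ω → Matrix ↥(V \ F) ↥(V \ F) ℝ} {w δ : ℕ}
    (hW : ∀ S : Set (Ω → ℝ), Free inp ⊆ S → ∀ c : ↥(V \ F) → Ω → ℝ, Set.range c ⊆ S →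
      Reach inp w δ S (Set.range fun v ω => (W ω *ᵥ fun u => c u ω) v))
    {b : V → Ω → ℝ} (hb : Set.range b ⊆ S) {k : ℕ} (hk : 1 ≤ k) :
    Reach inp (18 * (k * nnz M₀) + w) (6 * k * (r + 4) + δ) S
      (Set.range fun v ω => levelSolve (M ω) F k (W ω) (fun u => b u ω) v) := by
  set m := nnz M₀
  have hF : Fintype.card {v : ↥V // (v : ι) ∈ F} ≤ Fintype.card V := Fintype.card_subtype_le _
  have hC : Fintype.card ↥(V \ F) ≤ Fintype.card V :=
    Fintype.card_le_of_injective _ (coarse_injective V F)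
  have hsup : ∀ {κ₁ κ₂ : Type} [Fintype κ₁] [Fintype κ₂] (f : κ₁ → ↥V) (g : κ₂ → ↥V) (ω : Ω)
      (i : κ₁) (j : κ₂), (i, j) ∉ blockSupport M₀ f g → (M ω).submatrix f g i j = 0 :=
    fun f g ω i j h => hM₀ ω _ _ (by simpa [blockSupport] using h)
  set y : {v : ↥V // (v : ι) ∈ F} → Ω → ℝ :=
    fun j ω => fineSolve (M ω) F k (fun i => b (fine V F i) ω) j with hy
  have h1 : Reach inp (m + k * (5 * m)) (r + k * (r + 4)) S (Set.range y) :=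
    reach_fineSolve hS hM hM₀ hcard hr hx (c := fun i => b (fine V F i))
      (by rintro _ ⟨i, rfl⟩; exact hb ⟨_, rfl⟩) k
  set S₁ := S ∪ Set.range y
  have hS₁ : S ⊆ S₁ := Set.subset_union_left
  set t : ↥(V \ F) → Ω → ℝ :=
    fun j ω => ((M ω).submatrix (coarse V F) (fine V F) *ᵥ fun i => y i ω) j with ht
  have h2 : Reach inp (2 * #(blockSupport M₀ (coarse V F) (fine V F))) (r + 1) S₁ (Set.range t) :=
    reach_mulVec (M := fun ω => (M ω).submatrix (coarse V F) (fine V F)) (hS.trans hS₁)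
      (blockSupport M₀ (coarse V F) (fine V F)) (fun p _ => hS₁ (hS (hM _ _))) (hsup _ _)
      (hF.trans hr)
      Set.subset_union_right
  set S₂ := S₁ ∪ Set.range t
  have hS₂ : S₁ ⊆ S₂ := Set.subset_union_left
  set u : ↥(V \ F) → Ω → ℝ := fun j ω => b (coarse V F j) ω - t j ω with hu
  have h3 : Reach inp (Fintype.card ↥(V \ F)) 1 S₂ (Set.range u) :=
    reach_vec_sub (x := fun j => b (coarse V F j))
      (by rintro _ ⟨i, rfl⟩; exact hS₂ (hS₁ (hb ⟨_, rfl⟩))) Set.subset_union_right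
  set S₃ := S₂ ∪ Set.range u
  have hS₃ : S₂ ⊆ S₃ := Set.subset_union_left
  set z : ↥(V \ F) → Ω → ℝ := fun v ω => (W ω *ᵥ fun i => u i ω) v with hz
  have h4 : Reach inp w δ S₃ (Set.range z) :=
    hW S₃ (hS.trans (hS₁.trans (hS₂.trans hS₃))) u Set.subset_union_right
  set S₄ := S₃ ∪ Set.range z
  have hS₄ : S₃ ⊆ S₄ := Set.subset_union_left
  have hSS₄ : S ⊆ S₄ := hS₁.trans (hS₂.trans (hS₃.trans hS₄))
  set q : {v : ↥V // (v : ι) ∈ F} → Ω → ℝ :=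
    fun j ω => ((M ω).submatrix (fine V F) (coarse V F) *ᵥ fun i => z i ω) j with hq
  have h5 : Reach inp (2 * #(blockSupport M₀ (fine V F) (coarse V F))) (r + 1) S₄ (Set.range q) :=
    reach_mulVec (M := fun ω => (M ω).submatrix (fine V F) (coarse V F)) (hS.trans hSS₄)
      (blockSupport M₀ (fine V F) (coarse V F)) (fun p _ => hSS₄ (hS (hM _ _))) (hsup _ _)
      (hC.trans hr)
      Set.subset_union_right
  set S₅ := S₄ ∪ Set.range q
  have hS₅ : S₄ ⊆ S₅ := Set.subset_union_left
  set p : {v : ↥V // (v : ι) ∈ F} → Ω → ℝ :=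
    fun j ω => fineSolve (M ω) F k (fun i => q i ω) j with hp
  have h6 : Reach inp (m + k * (5 * m)) (r + k * (r + 4)) S₅ (Set.range p) :=
    reach_fineSolve (hS.trans (hSS₄.trans hS₅)) hM hM₀ hcard hr hx Set.subset_union_right k
  set S₆ := S₅ ∪ Set.range p
  have hS₆ : S₅ ⊆ S₆ := Set.subset_union_left
  have h7 : Reach inp (Fintype.card {v : ↥V // (v : ι) ∈ F}) 1 S₆
      (Set.range fun j ω => y j ω - p j ω) :=
    reach_vec_sub
      (Set.subset_union_right.trans (hS₂.trans (hS₃.trans (hS₄.trans (hS₅.trans hS₆)))))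
      Set.subset_union_right
  have h8 : Reach inp 0 1 S₆ (Set.range z) :=
    reach_of_subset (Set.subset_union_right.trans (hS₅.trans hS₆)) _ _
  refine (h1.trans (h2.trans (h3.trans (h4.trans (h5.trans (h6.trans (h7.union h8))))))).mono
    ?_ ?_ subset_rfl ?_
  -- 18 = 6 + 6 for the two fine solves, 2 + 2 for the products with the off-diagonal blocks, 1 + 1
  -- for the subtractions.
  · have e1 := card_blockSupport_le M₀ (coarse_injective V F) (fine_injective V F)
    have e2 := card_blockSupport_le M₀ (fine_injective V F) (coarse_injective V F)
    have e3 : m ≤ k * m := Nat.le_mul_of_pos_left m hk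
    have e4 : k * (5 * m) = 5 * (k * m) := by ring
    rw [e4]
    omega
  · have e1 : r + 4 ≤ k * (r + 4) := Nat.le_mul_of_pos_left _ hk
    have e2 : 6 * k * (r + 4) = 6 * (k * (r + 4)) := by ring
    rw [e2]
    omega
  · rintro _ ⟨v, rfl⟩
    rcases hv : (splitEquiv V F).symm v with i | i
    · refine Or.inl ⟨i, ?_⟩
      funext ω
      simp only [levelSolve, Function.comp_apply, hv, Sum.elim_inl]
      rfl
    · refine Or.inr ⟨i, ?_⟩
      funext ω
      simp only [levelSolve, Function.comp_apply, hv, Sum.elim_inr]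
      rfl

theorem reach_richardson {J : Type} [Fintype J] [DecidableEq J] {S : Set (Ω → ℝ)}
    (hS : Free inp ⊆ S) {A : Ω → Matrix J J ℝ} (hA : ∀ u v, (fun ω => A ω u v) ∈ Free inp)
    {A₀ : Matrix J J ℝ} (hA₀ : ∀ ω u v, A₀ u v = 0 → A ω u v = 0)
    (hcard : Fintype.card J ≤ nnz A₀) {r : ℕ} (hr : Fintype.card J ≤ 2 ^ r)
    {W : Ω → Matrix J J ℝ} {w δ : ℕ}
    (hW : ∀ S : Set (Ω → ℝ), Free inp ⊆ S → ∀ c : J → Ω → ℝ, Set.range c ⊆ S →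
      Reach inp w δ S (Set.range fun v ω => (W ω *ᵥ fun u => c u ω) v))
    {b : J → Ω → ℝ} (hb : Set.range b ⊆ S) (t : ℕ) :
    Reach inp (t * (5 * nnz A₀ + w)) (t * (r + 4 + δ)) S
      (Set.range fun v ω => richardson (A ω) (W ω) (fun u => b u ω) t v) := by
  induction t with
  | zero =>
    refine reach_of_subset ?_ _ _
    rintro _ ⟨j, rfl⟩
    exact hS (zero_mem_free inp)
  | succ t ih =>
    set x : J → Ω → ℝ := fun v ω => richardson (A ω) (W ω) (fun u => b u ω) t v with hx
    set S₁ := S ∪ Set.range x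
    have hS₁ : S ⊆ S₁ := Set.subset_union_left
    set y : J → Ω → ℝ := fun j ω => (A ω *ᵥ fun i => x i ω) j with hy
    have h1 : Reach inp (2 * #(blockSupport A₀ id id)) (r + 1) S₁ (Set.range y) :=
      reach_mulVec (hS.trans hS₁) _ (fun p _ => hS₁ (hS (hA _ _)))
        (fun ω i j h => hA₀ ω _ _ (by simpa [blockSupport] using h)) hr Set.subset_union_right
    set S₂ := S₁ ∪ Set.range y
    have hS₂ : S₁ ⊆ S₂ := Set.subset_union_left
    set u : J → Ω → ℝ := fun j ω => b j ω - y j ω with hu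
    have h2 : Reach inp (Fintype.card J) 1 S₂ (Set.range u) :=
      reach_vec_sub (hb.trans (hS₁.trans hS₂)) Set.subset_union_right
    set S₃ := S₂ ∪ Set.range u
    have hS₃ : S₂ ⊆ S₃ := Set.subset_union_left
    set z : J → Ω → ℝ := fun v ω => (W ω *ᵥ fun i => u i ω) v with hz
    have h3 : Reach inp w δ S₃ (Set.range z) :=
      hW S₃ (hS.trans (hS₁.trans (hS₂.trans hS₃))) u Set.subset_union_right
    set S₄ := S₃ ∪ Set.range z
    have hS₄ : S₃ ⊆ S₄ := Set.subset_union_left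
    have h4 : Reach inp (Fintype.card J) 1 S₄ (Set.range fun j ω => ((1 / 3 : ℚ) : ℝ) * z j ω) :=
      reach_vec_smul (hS.trans (hS₁.trans (hS₂.trans (hS₃.trans hS₄)))) _ Set.subset_union_right
    have h5 := reach_vec_add (inp := inp)
      (S := S₄ ∪ Set.range fun j ω => ((1 / 3 : ℚ) : ℝ) * z j ω) (x := x)
      (y := fun j ω => ((1 / 3 : ℚ) : ℝ) * z j ω)
      ((Set.subset_union_right.trans (hS₂.trans (hS₃.trans hS₄))).trans Set.subset_union_left)
      Set.subset_union_right
    refine (ih.trans (h1.trans (h2.trans (h3.trans (h4.trans h5))))).mono ?_ ?_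
      subset_rfl subset_rfl
    · have := card_blockSupport_le A₀ Function.injective_id Function.injective_id
      rw [Nat.succ_mul t]
      omega
    · rw [Nat.succ_mul t]
      omega

end LevelCircuit

/-! ### The solver -/

section Solver

theorem Approx.trans {κ : Type} [Fintype κ] {ε η : ℝ} {A B C : Matrix κ κ ℝ} (hA : A.IsSymm)
    (hB : B.IsSymm) (hC : C.IsSymm) (h₁ : Approx ε A B) (h₂ : Approx η B C) :
    Approx (ε + η) A C := by
  rw [approx_iff_qf hA hB] at h₁
  rw [approx_iff_qf hB hC] at h₂
  refine (approx_iff_qf hA hC).2 fun x => ⟨?_, ?_⟩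
  · rw [Real.exp_add, mul_assoc]
    exact (h₁ x).1.trans (mul_le_mul_of_nonneg_left (h₂ x).1 (Real.exp_pos _).le)
  · rw [neg_add, Real.exp_add, mul_assoc]
    exact (mul_le_mul_of_nonneg_left (h₂ x).2 (Real.exp_pos _).le).trans (h₁ x).2

theorem Approx.mono {κ : Type} [Fintype κ] {ε η : ℝ} {A B : Matrix κ κ ℝ} (hA : A.IsSymm)
    (hB : B.PosDef) (h : Approx ε A B) (hεη : ε ≤ η) : Approx η A B := by
  rw [approx_iff_qf hA (PosDef.isSymm hB)] at h ⊢
  intro x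
  have hx := PosDef.qf_nonneg hB x
  exact ⟨(h x).1.trans (mul_le_mul_of_nonneg_right (Real.exp_le_exp.2 hεη) hx),
    (mul_le_mul_of_nonneg_right (Real.exp_le_exp.2 (neg_le_neg hεη)) hx).trans (h x).2⟩

variable {n : ℕ}

/-- The inputs on which the solver for the chain `M` of `A` has to work. -/
structure SolverInstance (s : ℕ) (A : Matrix (Fin n) (Fin n) ℝ) (σ : ChainShape n)
    (M : ChainMatrices σ) where
  mat : Matrix (Fin n) (Fin n) ℝ
  chain : ChainMatrices σ
  rhs : Fin n → ℝ
  isChain : IsVertexSparsifierChain s mat σ chain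
  pattern : SamePattern mat A
  chainPattern : ∀ i, 1 ≤ i → i ≤ σ.d → SamePattern (chain i) (M i)

variable {s : ℕ} {A : Matrix (Fin n) (Fin n) ℝ} {σ : ChainShape n} {M : ChainMatrices σ}

/-- The values of the inputs of an instance. -/
def SolverInstance.inputs (ω : SolverInstance s A σ M) : SolverInput σ → ℝ :=
  solverInput ω.mat ω.chain ω.rhs

theorem IsVertexSparsifierChain.rowSum_pos (h : IsVertexSparsifierChain s A σ M) {i : ℕ}
    (h1 : 1 ≤ i) (hd : i < σ.d) (v) : 0 < ∑ j, blockFF (M i) (σ.F i) v j := by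
  have hM := h.sddm i h1 hd.le
  refine (stronglyDD_laplacian (hM.posDef.submatrix (fine_injective _ _)) (fun u v huv => ?_)
    (h.four_le_α i h1 hd) (h.stronglyDD i h1 hd)).1 v
  exact hM.offDiag_nonpos _ _ ((fine_injective _ _).ne huv)

/-- The work of a circuit for the last matrix of a chain. -/
def lastWork (s : ℕ) : ℕ := (s + 1) * (s.factorial * (s + 1) + s.factorial) + s

/-- The depth of a circuit for the last matrix of a chain. -/
def lastDepth (s : ℕ) : ℕ := (s + 1) + s.factorial + 1

/-- The circuit that applies an approximate inverse of the `i`-th matrix of a chain. -/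
theorem exists_chain_operator (hch : IsVertexSparsifierChain s A σ M) {k : ℕ → ℕ}
    (hk : ∀ i, 1 ≤ i → i < σ.d → Even (k i) ∧ 2 ≤ k i ∧
      2 * (2 / σ.α i) ^ (k i - 1) ≤ σ.ε i) {r : ℕ} (hr : n ≤ 2 ^ r) (j : ℕ) :
    ∀ i, 1 ≤ i → i + j = σ.d →
      ∃ N : SolverInstance s A σ M → Matrix (σ.vertices i) (σ.vertices i) ℝ,
        (∀ ω, (N ω).PosDef ∧ Approx (2 * ∑ l ∈ Ico i σ.d, σ.ε l) (N ω) (ω.chain i)) ∧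
        ∀ S, Free SolverInstance.inputs ⊆ S → ∀ b : σ.vertices i → SolverInstance s A σ M → ℝ,
          Set.range b ⊆ S →
          Reach SolverInstance.inputs (18 * ∑ l ∈ Ico i σ.d, k l * nnz (M l) + lastWork s)
            (6 * (∑ l ∈ Ico i σ.d, k l) * (r + 4) + lastDepth s) S
            (Set.range fun v ω => ((N ω)⁻¹ *ᵥ fun u => b u ω) v) := by
  induction j with
  | zero =>
    rintro i h1 rfl
    -- The last matrix is inverted exactly, so no error arises.
    refine ⟨fun ω => ω.chain (σ.d), fun ω => ?_, fun S hS b hb => ?_⟩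
    · have := (ω.isChain.sddm _ h1 le_rfl)
      refine ⟨this.posDef, ?_⟩
      simp only [Ico_self, sum_empty, mul_zero]
      rw [approx_iff_qf this.symm this.symm]
      simp
    · simp only [Ico_self, sum_empty, mul_zero, zero_mul, zero_add]
      exact reach_inv_mulVec hS (fun u v => hS (input_mem_free _ (SolverInput.chain _ u v)))
        (fun ω => (ω.isChain.sddm _ h1 le_rfl).nonsingular) hb
        (by rw [Fintype.card_coe]; exact hch.size_last)
  | succ j ih =>
    rintro i h1 hij
    obtain ⟨i, rfl⟩ := Nat.exists_eq_add_of_le' h1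
    have hd : i + 1 < σ.d := by omega
    obtain ⟨N', hN', hR⟩ := ih (i + 2) (by omega) (by omega)
    obtain ⟨hke, hk2, hkε⟩ := hk (i + 1) h1 hd
    have hη : 0 ≤ 2 * ∑ l ∈ Ico (i + 2) σ.d, σ.ε l :=
      mul_nonneg two_pos.le (sum_nonneg fun l hl => (hch.ε_pos l (mem_Ico.1 hl).2).le)
    -- The operator depends on the instance; the gates that apply it, given by `reach_levelSolve`,
    -- do not.
    choose N hN using fun ω : SolverInstance s A σ M =>
      exists_level_operator (S' := N' ω) (ω.isChain.sddm (i + 1) h1 hd.le)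
        (hch.four_le_α (i + 1) h1 hd) (hch.ε_pos (i + 1) hd).le hη
        (ω.isChain.stronglyDD (i + 1) h1 hd) hke hk2 hkε (hN' ω).1
        (ω.isChain.sddm (i + 2) (by omega) (by omega)) (hN' ω).2 (ω.isChain.approx_schur i hd)
    refine ⟨N, fun ω => ⟨(hN ω).1, ?_⟩, fun S hS b hb => ?_⟩
    · have e : 2 * ∑ l ∈ Ico (i + 1) σ.d, σ.ε l =
          2 * ∑ l ∈ Ico (i + 2) σ.d, σ.ε l + 2 * σ.ε (i + 1) := by
        rw [sum_eq_sum_Ico_succ_bot hd]; ring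
      rw [e]
      exact (hN ω).2.1
    · have h := reach_levelSolve (M := fun ω : SolverInstance s A σ M => ω.chain (i + 1))
        (M₀ := M (i + 1)) (W := fun ω => (N' ω)⁻¹) hS
        (fun u v => input_mem_free _ (SolverInput.chain _ u v))
        (fun ω u v h => (ω.chainPattern (i + 1) h1 hd.le u v).2 h)
        (card_le_nnz (hch.sddm (i + 1) h1 hd.le).posDef) (r := r)
        (by
          rw [Fintype.card_coe]
          exact ((card_le_univ _).trans_eq (Fintype.card_fin n)).trans hr)
        (fun ω v => ω.isChain.rowSum_pos h1 hd v) hR hb (le_trans one_le_two hk2)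
      refine h.mono ?_ ?_ subset_rfl (subset_of_eq ?_)
      · rw [sum_eq_sum_Ico_succ_bot hd]
        exact le_of_eq (by ring)
      · rw [sum_eq_sum_Ico_succ_bot hd]
        exact le_of_eq (by ring)
      · refine congrArg Set.range ?_
        funext v ω
        rw [(hN ω).2.2]

/-- A solver circuit, with explicit bounds on its work and depth. -/
theorem exists_solver (hch : IsVertexSparsifierChain s A σ M)
    (herr : 2 * ∑ i ∈ range σ.d, σ.ε i ≤ 1) {k : ℕ → ℕ}
    (hk : ∀ i, 1 ≤ i → i < σ.d → Even (k i) ∧ 2 ≤ k i ∧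
      2 * (2 / σ.α i) ^ (k i - 1) ≤ σ.ε i) {r : ℕ} (hr : n ≤ 2 ^ r) (t : ℕ) :
    ∃ C : Circuit (SolverInput σ) (Fin n),
      C.work ≤ t * (5 * nnz A + (18 * ∑ l ∈ Ico 1 σ.d, k l * nnz (M l) + lastWork s)) ∧
      C.depth ≤ t * (r + 4 + (6 * (∑ l ∈ Ico 1 σ.d, k l) * (r + 4) + lastDepth s)) ∧
      ∀ ω : SolverInstance s A σ M, C.gates.Defined ω.inputs ∧
        IsApproxSolution ((9 / 10) ^ t) ω.mat ω.rhs (C.eval ω.inputs) := by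
  obtain ⟨N, hN, hR⟩ := exists_chain_operator hch hk hr (σ.d - 1) 1 le_rfl
    (by have := hch.one_le_d; omega)
  set e : Fin n ≃ σ.vertices 1 :=
    ⟨fun v => ⟨v, mem_univ v⟩, fun v => v.1, fun _ => rfl, fun _ => rfl⟩ with he
  set N₁ : SolverInstance s A σ M → Matrix (Fin n) (Fin n) ℝ := fun ω => (N ω).submatrix e e
  have hP : ∀ ω, (N₁ ω).PosDef := fun ω => (hN ω).1.submatrix e.injective
  have hA : ∀ ω : SolverInstance s A σ M, ω.mat.PosDef := fun ω => ω.isChain.sddm_input.posDef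
  have hap : ∀ ω, Approx 1 (N₁ ω) ω.mat := fun ω => by
    have h1 := approx_submatrix (hN ω).2 e
    have hM1 := (ω.isChain.sddm 1 le_rfl hch.one_le_d).symm.submatrix e
    have h2 := Approx.trans (PosDef.isSymm (hP ω)) hM1 (PosDef.isSymm (hA ω)) h1
      ω.isChain.approx_input
    -- ε₀ enters only once here, although the error bound counts it twice.
    refine Approx.mono (PosDef.isSymm (hP ω)) (hA ω) h2 (le_trans ?_ herr)
    have hd : 0 < σ.d := hch.one_le_d
    have := hch.ε_pos 0 hd
    rw [range_eq_Ico, sum_eq_sum_Ico_succ_bot hd, zero_add]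
    linarith
  have hW : ∀ S, Free SolverInstance.inputs ⊆ S →
      ∀ c : Fin n → SolverInstance s A σ M → ℝ, Set.range c ⊆ S →
        Reach SolverInstance.inputs (18 * ∑ l ∈ Ico 1 σ.d, k l * nnz (M l) + lastWork s)
          (6 * (∑ l ∈ Ico 1 σ.d, k l) * (r + 4) + lastDepth s) S
          (Set.range fun v ω => ((N₁ ω)⁻¹ *ᵥ fun u => c u ω) v) := fun S hS c hc => by
    refine (hR S hS (fun v => c (e.symm v))
      (by rintro _ ⟨v, rfl⟩; exact hc ⟨_, rfl⟩)).mono le_rfl le_rfl subset_rfl ?_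
    rintro _ ⟨v, rfl⟩
    refine ⟨e v, ?_⟩
    funext ω
    change _ = (((N ω).submatrix e e)⁻¹ *ᵥ fun u => c u ω) v
    rw [inv_submatrix_equiv, submatrix_mulVec_equiv]
    rfl
  have h := reach_richardson (A := fun ω : SolverInstance s A σ M => ω.mat) (A₀ := A)
    (subset_rfl : Free SolverInstance.inputs ⊆ _)
    (fun u v => input_mem_free _ (SolverInput.system u v))
    (fun ω u v h => (ω.pattern u v).2 h) (card_le_nnz hch.sddm_input.posDef)
    (by simpa using hr) hW (b := fun v ω => ω.rhs v)
    (by rintro _ ⟨v, rfl⟩; exact input_mem_free _ (SolverInput.rhs v)) t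
  obtain ⟨C, hCw, hCd, hC⟩ := h.exists_circuit
  refine ⟨C, hCw, hCd, fun ω => ⟨(hC ω).1, ?_⟩⟩
  rw [(hC ω).2]
  exact isApproxSolution_richardson (hA ω) (hP ω) (hap ω) ω.rhs t

/-- The number of Jacobi iterations that suffice at one level. -/
theorem exists_iterations {α ε κ : ℝ} (hα : 4 ≤ α) (h0 : 0 < ε) (h1 : ε ≤ 1 / 2) (hκ : 0 < κ)
    (hl : κ ≤ Real.logb α ε⁻¹) : ∃ k : ℕ, Even k ∧ 2 ≤ k ∧ 2 * (2 / α) ^ (k - 1) ≤ ε ∧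
      (k : ℝ) ≤ (8 + 4 / κ) * Real.logb α ε⁻¹ := by
  set l := Real.logb α ε⁻¹ with hldef
  set t := ⌈4 * l⌉₊ with ht
  have hl0 : 0 < l := hκ.trans_le hl
  -- As α ≥ 4, 2/α ≤ α^(-1/2); an exponent of at least 4l gives at most α^(-2l) = ε² ≤ ε/2. The
  -- count is at most 8l + 4, and l ≥ κ absorbs the 4.
  refine ⟨2 * (t + 1), even_two_mul _, by omega, ?_, ?_⟩
  · have hlogα : 0 < Real.log α := Real.log_pos (by linarith)
    have hlα : l * Real.log α = Real.log ε⁻¹ := by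
      rw [hldef, Real.logb, div_mul_cancel₀ _ hlogα.ne']
    have hlog4 : Real.log 4 = 2 * Real.log 2 := by
      rw [show (4 : ℝ) = 2 ^ 2 by norm_num, Real.log_pow]; norm_num
    have hlog4α : Real.log 4 ≤ Real.log α := Real.log_le_log (by norm_num) hα
    have hlog2ε : Real.log 2 ≤ Real.log ε⁻¹ := by
      refine Real.log_le_log two_pos ?_
      rw [le_inv_comm₀ two_pos h0]; linarith
    have hhalf : Real.log (2 / α) = Real.log 2 - Real.log α :=
      Real.log_div two_ne_zero (by linarith)
    have htl : 4 * l ≤ t := Nat.le_ceil _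
    have hpow : (2 / α) ^ (2 * (t + 1) - 1) ≤ ε / 2 := by
      rw [← Real.log_le_log_iff (pow_pos (by positivity) _) (by positivity), Real.log_pow,
        Real.log_div h0.ne' two_ne_zero, hhalf]
      have hlogε : Real.log ε = -Real.log ε⁻¹ := by rw [Real.log_inv, neg_neg]
      have hN : (4 * l : ℝ) ≤ ((2 * (t + 1) - 1 : ℕ) : ℝ) := by
        refine htl.trans ?_
        exact_mod_cast (by omega : t ≤ 2 * (t + 1) - 1)
      have h2 : Real.log α / 2 ≤ Real.log α - Real.log 2 := by linarith
      have h3 := mul_le_mul hN h2 (by linarith) (Nat.cast_nonneg _)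
      rw [hlogε]
      nlinarith
    linarith
  · have h2 := (Nat.ceil_lt_add_one (a := 4 * l) (by positivity)).le
    have h3 : 4 ≤ 4 / κ * l := by
      rw [div_mul_eq_mul_div, le_div_iff₀ hκ]; linarith
    push_cast
    linarith

/-- 9/10 ≤ e^(-1/10), so 10 log(1/ε) steps suffice; rounding up costs at most one more `lg`. -/
theorem exists_refinements {ε : ℝ} (h0 : 0 < ε) (h1 : ε < 1) :
    ∃ t : ℕ, ((9 : ℝ) / 10) ^ t ≤ ε ∧ (t : ℝ) ≤ 11 * lg (1 / ε) := by
  have hlog : 0 < Real.log (1 / ε) := Real.log_pos (by rw [lt_div_iff₀ h0]; linarith)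
  refine ⟨⌈10 * Real.log (1 / ε)⌉₊, ?_, ?_⟩
  · set t := ⌈10 * Real.log (1 / ε)⌉₊ with ht
    have h2 : 10 * Real.log (1 / ε) ≤ t := Nat.le_ceil _
    calc ((9 : ℝ) / 10) ^ t ≤ Real.exp (-(1 / 10)) ^ t := by
          refine pow_le_pow_left₀ (by norm_num) ?_ t
          linarith [Real.add_one_le_exp (-(1 / 10 : ℝ))]
      _ = Real.exp (t * -(1 / 10)) := by rw [Real.exp_nat_mul]
      _ ≤ Real.exp (Real.log ε) := by
          refine Real.exp_le_exp.2 ?_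
          rw [one_div, Real.log_inv] at h2
          linarith
      _ = ε := Real.exp_log h0
  · have h2 := (Nat.ceil_lt_add_one (a := 10 * Real.log (1 / ε)) (by positivity)).le
    have h3 : Real.log (1 / ε) ≤ lg (1 / ε) := le_max_right _ _
    have h4 : 1 ≤ lg (1 / ε) := le_max_left _ _
    linarith

theorem clog_add_four_le {n : ℕ} (hn : 2 ≤ n) : ((Nat.clog 2 n : ℝ) + 4) ≤ 10 * Real.log n := by
  have hlog2 := Real.log_two_gt_d9
  have hn' : Real.log 2 ≤ Real.log n := Real.log_le_log two_pos (by exact_mod_cast hn)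
  have hlt : 2 ^ (Nat.clog 2 n - 1) < n := by
    have := Nat.pow_pred_clog_lt_self one_lt_two (show 1 < n by omega)
    simpa using this
  have h1 : ((Nat.clog 2 n - 1 : ℕ) : ℝ) * Real.log 2 ≤ Real.log n := by
    rw [← Real.log_pow]
    exact Real.log_le_log (by positivity) (by exact_mod_cast hlt.le)
  have h2 : (Nat.clog 2 n : ℝ) ≤ ((Nat.clog 2 n - 1 : ℕ) : ℝ) + 1 := by
    exact_mod_cast (by omega : Nat.clog 2 n ≤ Nat.clog 2 n - 1 + 1)
  nlinarith

theorem IsApproxSolution.mono {κ : Type} [Fintype κ] [DecidableEq κ] {ε ε' : ℝ}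
    {A : Matrix κ κ ℝ} {b y : κ → ℝ} (h : IsApproxSolution ε A b y) (hε : ε ≤ ε') :
    IsApproxSolution ε' A b y :=
  h.trans (mul_le_mul_of_nonneg_right hε (Real.sqrt_nonneg _))

/-- A good chain yields a solver. -/
theorem exists_solver_of_good_chain (s : ℕ) (κ c₁ c₂ : ℝ) (hκ : 0 < κ) : ∃ C : ℝ,
    ∀ (n : ℕ) (A : Matrix (Fin n) (Fin n) ℝ) (σ : ChainShape n) (M : ChainMatrices σ),
      IsVertexSparsifierChainWith 1 (c₁ * (lg n ^ 2 * lg (Real.log n))) (c₂ * n) s A σ M →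
      (∀ i, 1 ≤ i → i < σ.d → κ ≤ Real.logb (σ.α i) (σ.ε i)⁻¹) →
      ∀ ε : ℝ, 0 < ε → ε < 1 →
        ∃ S : Circuit (SolverInput σ) (Fin n),
          (S.work : ℝ) ≤ C * (nnz A * lg (1 / ε)) ∧
          (S.depth : ℝ) ≤ C * (lg n ^ 2 * lg (Real.log n) * lg (1 / ε)) ∧
          ∀ ω : SolverInstance s A σ M, S.gates.Defined ω.inputs ∧
            IsApproxSolution ε ω.mat ω.rhs (S.eval ω.inputs) := by
  set c := 8 + 4 / κ with hc
  have hc0 : 0 < c := by positivity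
  -- Absolute values keep the constants positive, since c₁ and c₂ are arbitrary reals.
  set a : ℝ := 5 + (18 * c * |c₂| + lastWork s) with ha
  set a' : ℝ := 10 + (60 * c * |c₁| + lastDepth s) with ha'
  have ha0 : 0 < a := by positivity
  have ha0' : 0 < a' := by positivity
  refine ⟨11 * (a + a'), fun n A σ M hch hlow ε h0 h1 => ?_⟩
  set ℓ := lg (1 / ε)
  have hℓ : 1 ≤ ℓ := le_max_left _ _
  have hlgn : 1 ≤ lg n := le_max_left _ _
  have hlgl : 1 ≤ lg (Real.log n) := le_max_left _ _
  set Λ := lg n ^ 2 * lg (Real.log n) with hΛdef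
  have hΛ : 1 ≤ Λ := by nlinarith
  rcases Nat.eq_zero_or_pos n with rfl | hn
  -- In dimension 0 there are no nonzero entries, so the work bound demands a circuit without gates.
  · refine ⟨⟨0, .nil, fun v => v.elim0⟩, ?_, ?_, fun ω => ⟨trivial, ?_⟩⟩
    · simp only [CharP.cast_eq_zero]; positivity
    · have : (⟨0, .nil, fun v => v.elim0⟩ : Circuit (SolverInput σ) (Fin 0)).depth = 0 := rfl
      rw [this, CharP.cast_eq_zero]
      positivity
    · simp [IsApproxSolution, energyNorm]
  have hn' : (1 : ℝ) ≤ n := by exact_mod_cast hn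
  have hm : (n : ℝ) ≤ nnz A := by
    have := card_le_nnz hch.chain.sddm_input.posDef
    rw [Fintype.card_fin] at this
    exact_mod_cast this
  have hex : ∀ i, ∃ k : ℕ, 1 ≤ i → i < σ.d → Even k ∧ 2 ≤ k ∧
      2 * (2 / σ.α i) ^ (k - 1) ≤ σ.ε i ∧ (k : ℝ) ≤ c * Real.logb (σ.α i) (σ.ε i)⁻¹ := fun i => by
    by_cases h : 1 ≤ i ∧ i < σ.d
    · obtain ⟨k, hk⟩ := exists_iterations (hch.chain.four_le_α i h.1 h.2)
        (hch.chain.ε_pos i h.2) (hch.chain.ε_le i h.2) hκ (hlow i h.1 h.2)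
      exact ⟨k, fun _ _ => hk⟩
    · exact ⟨0, fun h1 h2 => absurd ⟨h1, h2⟩ h⟩
  choose k hk using hex
  obtain ⟨t, ht, htl⟩ := exists_refinements h0 h1
  obtain ⟨S, hSw, hSd, hS⟩ := exists_solver hch.chain hch.error
    (fun i hi hd => ⟨(hk i hi hd).1, (hk i hi hd).2.1, (hk i hi hd).2.2.1⟩)
    (Nat.le_pow_clog one_lt_two n) t
  have hwork : (S.work : ℝ) ≤ 11 * a * (nnz A * ℓ) := by
    have h2 : (S.work : ℝ) ≤ t * (5 * nnz A + (18 * ∑ l ∈ Ico 1 σ.d, (k l : ℝ) * nnz (M l) +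
        lastWork s)) := by exact_mod_cast hSw
    have h3 : ∑ l ∈ Ico 1 σ.d, (k l : ℝ) * nnz (M l) ≤ c * (|c₂| * n) := by
      calc ∑ l ∈ Ico 1 σ.d, (k l : ℝ) * nnz (M l) ≤ c * chainWork σ M := by
            rw [chainWork, mul_sum]
            refine sum_le_sum fun i hi => ?_
            obtain ⟨hi1, hi2⟩ := mem_Ico.1 hi
            have := mul_le_mul_of_nonneg_right (hk i hi1 hi2).2.2.2
              (Nat.cast_nonneg (nnz (M i)) : (0 : ℝ) ≤ _)
            linarith
        _ ≤ c * (|c₂| * n) := by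
            refine mul_le_mul_of_nonneg_left (hch.work.trans ?_) hc0.le
            exact mul_le_mul_of_nonneg_right (le_abs_self _) (by linarith)
    have h4 : 5 * (nnz A : ℝ) + (18 * ∑ l ∈ Ico 1 σ.d, (k l : ℝ) * nnz (M l) + lastWork s) ≤
        a * nnz A := by
      have h5 : c * (|c₂| * n) ≤ c * (|c₂| * nnz A) := by gcongr
      have h6 : (lastWork s : ℝ) ≤ lastWork s * nnz A :=
        le_mul_of_one_le_right (Nat.cast_nonneg _) (hn'.trans hm)
      rw [ha]
      linarith
    calc (S.work : ℝ) ≤ t * (a * nnz A) := h2.trans (mul_le_mul_of_nonneg_left h4 (Nat.cast_nonneg _))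
      _ ≤ 11 * ℓ * (a * nnz A) := mul_le_mul_of_nonneg_right htl (by positivity)
      _ = _ := by ring
  have hmℓ : (0 : ℝ) ≤ nnz A * ℓ := by positivity
  have hΛℓ : 0 ≤ Λ * ℓ := by positivity
  refine ⟨S, ?_, ?_, fun ω => ⟨(hS ω).1, (hS ω).2.mono ht⟩⟩
  · refine hwork.trans (mul_le_mul_of_nonneg_right ?_ hmℓ)
    linarith
  · rcases Nat.lt_or_ge n 2 with hn2 | hn2
    · obtain rfl : n = 1 := by omega
      have hnnz : (nnz A : ℝ) ≤ 1 := by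
        have : nnz A ≤ Fintype.card (Fin 1 × Fin 1) := card_le_univ _
        simpa using this
      have hdw : (S.depth : ℝ) ≤ S.work := by exact_mod_cast S.depth_le_work
      refine hdw.trans (hwork.trans ?_)
      have h2 : (nnz A : ℝ) * ℓ ≤ Λ * ℓ := mul_le_mul_of_nonneg_right (hnnz.trans hΛ) (by linarith)
      exact mul_le_mul (by linarith) h2 hmℓ (by positivity)
    · have hr := clog_add_four_le hn2
      set r := Nat.clog 2 n
      have hlogn : 0 ≤ Real.log n := Real.log_nonneg hn'
      have h2 : (S.depth : ℝ) ≤ t * (r + 4 + (6 * (∑ l ∈ Ico 1 σ.d, (k l : ℝ)) * (r + 4) +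
          lastDepth s)) := by exact_mod_cast hSd
      -- The factor log n in the depth of a chain stands for the summation trees of depth r, as r +
      -- 4 ≤ 10 log n for n ≥ 2.
      have h3 : (∑ l ∈ Ico 1 σ.d, (k l : ℝ)) * Real.log n ≤ c * (|c₁| * Λ) := by
        calc (∑ l ∈ Ico 1 σ.d, (k l : ℝ)) * Real.log n ≤ c * chainDepth σ := by
              rw [chainDepth, mul_sum, sum_mul]
              refine sum_le_sum fun i hi => ?_
              obtain ⟨hi1, hi2⟩ := mem_Ico.1 hi
              have := mul_le_mul_of_nonneg_right (hk i hi1 hi2).2.2.2 hlogn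
              linarith
          _ ≤ c * (|c₁| * Λ) := by
              refine mul_le_mul_of_nonneg_left (hch.depth.trans ?_) hc0.le
              exact mul_le_mul_of_nonneg_right (le_abs_self _) (by linarith)
      have hks : 0 ≤ ∑ l ∈ Ico 1 σ.d, (k l : ℝ) := sum_nonneg fun l _ => Nat.cast_nonneg _
      have h4 : (∑ l ∈ Ico 1 σ.d, (k l : ℝ)) * (r + 4) ≤ 10 * (c * (|c₁| * Λ)) := by
        have := mul_le_mul_of_nonneg_left hr hks
        linarith
      have h5 : (r : ℝ) + 4 ≤ 10 * Λ := by
        have h6 : Real.log n ≤ lg n := le_max_right _ _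
        have h7 : lg n ≤ Λ := by nlinarith
        linarith
      have h6 : (lastDepth s : ℝ) ≤ lastDepth s * Λ :=
        le_mul_of_one_le_right (Nat.cast_nonneg _) hΛ
      have h7 : (r : ℝ) + 4 + (6 * (∑ l ∈ Ico 1 σ.d, (k l : ℝ)) * (r + 4) + lastDepth s) ≤
          a' * Λ := by
        rw [ha']
        linarith
      calc (S.depth : ℝ) ≤ t * (a' * Λ) :=
            h2.trans (mul_le_mul_of_nonneg_left h7 (Nat.cast_nonneg _))
        _ ≤ 11 * ℓ * (a' * Λ) := mul_le_mul_of_nonneg_right htl (by positivity)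
        _ = 11 * a' * (Λ * ℓ) := by ring
        _ ≤ 11 * (a + a') * (Λ * ℓ) := mul_le_mul_of_nonneg_right (by linarith) hΛℓ

end Solver

end SparseChol

theorem mainTheorem2 :
    -- every SDDM matrix has a 1-vertex sparsifier chain of the claimed depth and work
    (∃ (s : ℕ) (κ c₁ c₂ : ℝ), 0 < κ ∧
      ∀ (n : ℕ) (A : Matrix (Fin n) (Fin n) ℝ), SparseChol.IsSDDM A →
        ∃ (σ : SparseChol.ChainShape n) (M : SparseChol.ChainMatrices σ),
          SparseChol.IsVertexSparsifierChainWith 1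
            (c₁ * (SparseChol.lg n ^ 2 * SparseChol.lg (Real.log n))) (c₂ * n) s A σ M ∧
          ∀ i, 1 ≤ i → i < σ.d → κ ≤ Real.logb (σ.α i) (σ.ε i)⁻¹) ∧
    -- given such a chain, approximate solutions can be computed in the claimed work and depth;
    -- the circuit depends only on `ε`, on the shape of the chain and on the positions of the
    -- nonzero entries of the matrices
    (∀ (s : ℕ) (κ c₁ c₂ : ℝ), 0 < κ → ∃ C : ℝ,
      ∀ (n : ℕ) (A : Matrix (Fin n) (Fin n) ℝ)
        (σ : SparseChol.ChainShape n) (M : SparseChol.ChainMatrices σ),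
        SparseChol.IsVertexSparsifierChainWith 1
          (c₁ * (SparseChol.lg n ^ 2 * SparseChol.lg (Real.log n))) (c₂ * n) s A σ M →
        (∀ i, 1 ≤ i → i < σ.d → κ ≤ Real.logb (σ.α i) (σ.ε i)⁻¹) →
        ∀ ε : ℝ, 0 < ε → ε < 1 →
          ∃ S : SparseChol.Circuit (SparseChol.SolverInput σ) (Fin n),
            (S.work : ℝ) ≤ C * (SparseChol.nnz A * SparseChol.lg (1 / ε)) ∧
            (S.depth : ℝ) ≤ C * (SparseChol.lg n ^ 2 * SparseChol.lg (Real.log n) *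
              SparseChol.lg (1 / ε)) ∧
            ∀ (A' : Matrix (Fin n) (Fin n) ℝ) (M' : SparseChol.ChainMatrices σ),
              SparseChol.IsVertexSparsifierChain s A' σ M' →
              SparseChol.SamePattern A' A →
              (∀ i, 1 ≤ i → i ≤ σ.d → SparseChol.SamePattern (M' i) (M i)) →
              ∀ b : Fin n → ℝ,
                S.gates.Defined (SparseChol.solverInput A' M' b) ∧
                SparseChol.IsApproxSolution ε A' b
                  (S.eval (SparseChol.solverInput A' M' b))) := by
  refine ⟨SparseChol.exists_good_chain, fun s κ c₁ c₂ hκ => ?_⟩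
  obtain ⟨C, hC⟩ := SparseChol.exists_solver_of_good_chain s κ c₁ c₂ hκ
  refine ⟨C, fun n A σ M hch hlow ε h0 h1 => ?_⟩
  obtain ⟨S, hw, hd, hS⟩ := hC n A σ M hch hlow ε h0 h1
  exact ⟨S, hw, hd, fun A' M' hch' hA hM b => hS ⟨A', M', b, hch', hA, hM⟩⟩
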